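/- **Definitions.** Let $k,d\ge 1$, $[k]=\{1,\dots,k\}$, and let $n=k^d$. For a set $V\subseteq[k]^d$ and a string $\sigma\in[k]^{\le d}$ let $V_\sigma$ (the cluster $\sigma$) be the set of the $v\in V$ with prefix $\sigma$; the child clusters of $\sigma\in[k]^{<d}$ are $\sigma+i$, $i\in[k]$. A *$(k,d)$-semi-hypercube* is a graph $G=([k]^d,E)$ such that for all $\sigma\in[k]^{<d}$ and $i\ne i'$ the edges between the clusters $\sigma+i$ and $\sigma+i'$ of $[k]^d$ form a perfect matching. For $\tau\in(0,1)$, a cluster $\sigma$ is *$\tau$-critical* in $G[V]$ if $0<|V_\sigma|<(1-\tau)k^{d-|\sigma|}$. The induced subgraph $G[V]$ is a *$(k,d,\tau)$-semi-hypercube* if every $\sigma\in[k]^{<d}$ has at most one $\tau$-critical child cluster $\sigma+t$ and, if there is one, $|E[V_{\sigma+t},V_\sigma\setminus V_{\sigma+t}]|\ge\frac9{10}k'|V_{\sigma+t}|$, where $k'$ is the number of nonempty, non-$\tau$-critical child clusters of $\sigma$. **The algorithm EfficientSelfPruningSHC.** Put $r=2d+1$ and $\rho=\lceil 2H_k r/\tau\rceil$,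 where $H_k$ is the $k$-th harmonic number. The edge set $E$ is given by adjacency lists, in any order. The algorithm stores the remaining set $V$ (initially $[k]^d$), the sizes $\mathrm{size}_\sigma$ (initially $k^{d-|\sigma|}$), target children $t_\sigma$ (initially $1$) and sets $S_\sigma$ (initially $[k]\setminus\{1\}$) for $\sigma\in[k]^{<d}$, sets $M_{\sigma,\sigma',j}$ (initially $\emptyset$) for strict prefixes $\sigma'$ of $\sigma$ and $j\in[k]$, and $\mathrm{minfo}_\sigma$, which is $\bot$ or a pair $(\sigma',j)$; initially $\mathrm{minfo}_{\sigma+1}=(\sigma,\lceil\frac{19}{20}(k-1)\rceil)$ for $\sigma\in[k]^{<d}$, and $\mathrm{minfo}_\sigma=\bot$ for all other $\sigma$. Put $M_{\sigma,\bot}=\emptyset$. Ties in $\arg\min$ and $\arg\max$ are broken towards the smallest index. * $\mathrm{Retarget}(\sigma)$: while $S_\sigma\ne\emptyset$ and $\mathrm{size}_{\sigma+t_\sigma}=0$: if $S_\sigma=\{i\}$, set $t_\sigma\gets i$ and $\mathrm{minfo}_{\sigma+i}\gets\mathrm{minfo}_\sigma$; otherwise set $t_\sigma\gets\arg\min_{i\in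 S_\sigma}\mathrm{size}_{\sigma+i}$ if $|S_\sigma|\equiv1\pmod r$ and $t_\sigma\gets\arg\max_{i\in S_\sigma}|M_{\sigma+i,\mathrm{minfo}_\sigma}|$ if not, and then $\mathrm{minfo}_{\sigma+t_\sigma}\gets(\sigma,\lceil\frac{19}{20}(|S_\sigma|-1)\rceil)$. In either case then remove $t_\sigma$ from $S_\sigma$. * $\mathrm{ProcessRemoval}(x)$: for every neighbour $v\in V$ of $x$ in $G$, let $\sigma$ be the longest common prefix of $v$ and $x$, and let $\delta$ be the number of neighbours of $v$ in $V$ whose longest common prefix with $v$ is exactly $\sigma$; add $v$ to $M_{\sigma'',\sigma,\delta}$ for every prefix $\sigma''$ of $v$ with $|\sigma''|>|\sigma|$. Then remove $x$ from $V$ and decrease $\mathrm{size}_\sigma$ by $1$ for every prefix $\sigma$ of $x$. * $\mathrm{Trim}(\sigma)$: if $|\sigma|=d$, call $\mathrm{ProcessRemoval}(\sigma)$ and return $\sigma$; otherwise let $v=\mathrm{Trim}(\sigma+t_\sigma)$, call $\mathrm{Retarget}(\sigma)$, and return $v$. * $\mathrm{Delete}(v)$: call $\mathrm{ProcessRemoval}(v)$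 and put $R=\{v\}$. For the strict prefixes $\sigma$ of $v$, from the longest to the empty one: call $\mathrm{Retarget}(\sigma)$, and then $\min(\rho|R|,\mathrm{size}_\sigma)$ times (this number being fixed beforehand) call $\mathrm{Trim}(\sigma)$ and add the returned vertex to $R$. Return $R\setminus\{v\}$. *Work* is counted by charging one unit for every arithmetic operation, comparison and loop iteration, and $(2d+1)\cdot b$ units, where $b$ is the number of binary digits of $k$ (so $\Theta(\log n)$ units), for every access to a table or a dynamic set and every operation on strings. **Theorem (Algorithmic Self-Pruning).** There are absolute constants $C>0$ and $c\in\mathbb N$ such that the following holds for all positive integers $k,d$ with $k\ge16d$, all real $0<\tau\le\frac1{4350d}$ and every $(k,d)$-semi-hypercube $G=([k]^d,E)$. Initialize the deterministic algorithm above with $k,d,\tau,E$, so that initially $V=[k]^d$, and carry out any finite number of updates $\mathrm{Delete}(v)$, each for an arbitrary vertex $v$ of the current $V$ (which may depend on everything that happened before). Then, initially and after every update, $G[V]$ is a $(k,d,\tau)$-semi-hypercube. Moreover every update $\mathrm{Delete}(v)$ returns a set $V^{\mathrm{prune}}\subseteq V\setminus\{v\}$, replaces $V$ by $V\setminus(V^{\mathrm{prune}}\cup\{v\})$,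 and satisfies in the worst case $$|V^{\mathrm{prune}}|\le\left(C\,\frac{\log n}{\tau}\right)^d,\qquad \text{work}\le C\left(k\cdot\left(\frac{\log n}{\tau}\right)^d\right)^{c}.$$ -/

import Mathlib

namespace SemiHypercube

/-! ## Semi-hypercubes -/

/-- The vertex set `[k]^d`: strings of length `d` over an alphabet with `k` characters. -/
abbrev Vertex (k d : ℕ) := List.Vector (Fin k) d

/-- `V_σ`: the vertices of `V` that have the string `σ` as a prefix. -/
def cluster {k d : ℕ} (V : Finset (Vertex k d)) (σ : List (Fin k)) : Finset (Vertex k d) :=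
  V.filter fun v => σ <+: v.toList

/-- A `(k, d)`-semi-hypercube: a graph on `[k]^d` such that for every `σ ∈ [k]^{<d}` and every pair
of distinct child clusters `σ + i`, `σ + i'`, the edges between them form a perfect matching, i.e.
every vertex of either one has exactly one neighbour in the other one. -/
def IsSemiHypercube {k d : ℕ} (G : SimpleGraph (Vertex k d)) : Prop :=
  ∀ σ : List (Fin k), σ.length < d → ∀ i i' : Fin k, i ≠ i' →
    ∀ u ∈ cluster Finset.univ (σ ++ [i]), ∃! w, w ∈ cluster Finset.univ (σ ++ [i']) ∧ G.Adj u w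

/-- The cluster `σ` is `τ`-critical in `G[V]`: `0 < |V_σ| < (1 - τ) k^(d - |σ|)`. -/
def IsCritical {k d : ℕ} (τ : ℝ) (V : Finset (Vertex k d)) (σ : List (Fin k)) : Prop :=
  0 < (cluster V σ).card ∧
    ((cluster V σ).card : ℝ) < (1 - τ) * (k : ℝ) ^ (d - σ.length)

open Classical in
/-- The number of nonempty, noncritical child clusters of `σ`. -/
noncomputable def goodChildren {k d : ℕ} (τ : ℝ) (V : Finset (Vertex k d)) (σ : List (Fin k)) : ℕ :=
  (Finset.univ.filter fun i : Fin k =>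
    (cluster V (σ ++ [i])).Nonempty ∧ ¬ IsCritical τ V (σ ++ [i])).card

open Classical in
/-- `G[V]` is a `(k, d, τ)`-semi-hypercube: it is an induced subgraph of the `(k, d)`-semi-hypercube
`G` in which every `σ ∈ [k]^{<d}` has at most one `τ`-critical child cluster `σ + t`, and
`|E[V_{σ+t}, V_σ \ V_{σ+t}]| ≥ 9/10 * k' * |V_{σ+t}|` for such a child, where `k'` is the number of
nonempty, noncritical child clusters of `σ`. -/
def IsTauSemiHypercube {k d : ℕ} (τ : ℝ) (G : SimpleGraph (Vertex k d))
    (V : Finset (Vertex k d)) : Prop :=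
  IsSemiHypercube G ∧ ∀ σ : List (Fin k), σ.length < d →
    (∀ t t' : Fin k, IsCritical τ V (σ ++ [t]) → IsCritical τ V (σ ++ [t']) → t = t') ∧
    ∀ t : Fin k, IsCritical τ V (σ ++ [t]) →
      (9 / 10 : ℝ) * (goodChildren τ V σ : ℝ) * ((cluster V (σ ++ [t])).card : ℝ) ≤
        ((G.interedges (cluster V (σ ++ [t])) (cluster V σ \ cluster V (σ ++ [t]))).card : ℝ)

/-! ## The data structure and its elementary operations

Clusters are named by strings, i.e. lists of characters. All tables are indexed by strings; only
strings of length at most `d` are ever used. -/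

/-- The memory of the data structure, together with a counter for the work done so far. -/
structure State (k d : ℕ) where
  /-- the remaining vertex set `V` -/
  V : Finset (Vertex k d)
  /-- the cluster sizes `size_σ` -/
  size : List (Fin k) → ℕ
  /-- the target children `t_σ` -/
  target : List (Fin k) → Fin k
  /-- the indices `S_σ` of the children that have not been targets yet -/
  nontarget : List (Fin k) → Finset (Fin k)
  /-- the shadow mark sets `M_{σ, σ', j}` -/
  shadow : List (Fin k) → List (Fin k) → ℕ → Finset (Vertex k d)
  /-- the mark set parameters `minfo_σ`: an ancestor of `σ` and a degree threshold, or `⊥` -/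
  minfo : List (Fin k) → Option (List (Fin k) × ℕ)
  /-- the total work done so far -/
  work : ℕ

/-- Deterministic programs acting on the data structure. -/
abbrev Prog (k d : ℕ) := StateM (State k d)

section Operations

variable {k d : ℕ}

/-- Charge `c` units of work. One unit is charged for every arithmetic operation, comparison and
loop iteration. -/
def tick (c : ℕ) : Prog k d Unit :=
  modify fun s => { s with work := s.work + c }

/-- The charge for one access to a table or dynamic set, or for one operation on strings: the
number of bits of the longest possible key, which consists of two strings of length at most `d` and
a number at most `k`. It is of order `log (k ^ d)`. -/
def accessCost (k d : ℕ) : ℕ := (2 * d + 1) * Nat.size k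

/-- Charge for one access. -/
def access : Prog k d Unit := tick (accessCost k d)

def getSize (σ : List (Fin k)) : Prog k d ℕ := do
  access
  return (← get).size σ

def decrSize (σ : List (Fin k)) : Prog k d Unit := do
  access
  modify fun s => { s with size := Function.update s.size σ (s.size σ - 1) }

def getTarget (σ : List (Fin k)) : Prog k d (Fin k) := do
  access
  return (← get).target σ

def setTarget (σ : List (Fin k)) (i : Fin k) : Prog k d Unit := do
  access
  modify fun s => { s with target := Function.update s.target σ i }

def nontargetCard (σ : List (Fin k)) : Prog k d ℕ := do
  access
  return ((← get).nontarget σ).card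

def nontargetMem (σ : List (Fin k)) (i : Fin k) : Prog k d Bool := do
  access
  return decide (i ∈ (← get).nontarget σ)

def nontargetErase (σ : List (Fin k)) (i : Fin k) : Prog k d Unit := do
  access
  modify fun s =>
    { s with nontarget := Function.update s.nontarget σ ((s.nontarget σ).erase i) }

def getMinfo (σ : List (Fin k)) : Prog k d (Option (List (Fin k) × ℕ)) := do
  access
  return (← get).minfo σ

def setMinfo (σ : List (Fin k)) (p : Option (List (Fin k) × ℕ)) : Prog k d Unit := do
  access
  modify fun s => { s with minfo := Function.update s.minfo σ p }

/-- `|M_{σ, p}|`, where `M_{σ, ⊥} = ∅`. -/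
def shadowCard (σ : List (Fin k)) (p : Option (List (Fin k) × ℕ)) : Prog k d ℕ := do
  access
  match p with
  | none => return 0
  | some (σ', j) => return ((← get).shadow σ σ' j).card

/-- `M_{σ, σ', j} ← M_{σ, σ', j} ∪ {v}`. -/
def shadowInsert (σ σ' : List (Fin k)) (j : ℕ) (v : Vertex k d) : Prog k d Unit := do
  access
  modify fun s => { s with
    shadow := fun a b c =>
      if a = σ ∧ b = σ' ∧ c = j then insert v (s.shadow a b c) else s.shadow a b c }

def vertexMem (v : Vertex k d) : Prog k d Bool := do
  access
  return decide (v ∈ (← get).V)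

def vertexErase (v : Vertex k d) : Prog k d Unit := do
  access
  modify fun s => { s with V := s.V.erase v }

/-! ## The algorithm -/

/-- The longest common prefix of two strings. -/
def lcp : List (Fin k) → List (Fin k) → List (Fin k)
  | a :: as, b :: bs => if a = b then a :: lcp as bs else []
  | _, _ => []

/-- `⌈19/20 * m⌉`. -/
def threshold (m : ℕ) : ℕ := ⌈(19 / 20 : ℚ) * (m : ℚ)⌉₊

/-- The trim multiplier `ρ = ⌈2 H_k (2d + 1) / τ⌉`. -/
noncomputable def rho (k d : ℕ) (τ : ℝ) : ℕ :=
  ⌈2 * ((harmonic k : ℚ) : ℝ) * ((2 * d + 1 : ℕ) : ℝ) / τ⌉₊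

/-- The initial state: nothing is deleted, the first child is the target child of every cluster. -/
def initState (k d : ℕ) (hk : 0 < k) : State k d where
  V := Finset.univ
  size := fun σ => k ^ (d - σ.length)
  target := fun _ => ⟨0, hk⟩
  nontarget := fun _ => Finset.univ.erase ⟨0, hk⟩
  shadow := fun _ _ _ => ∅
  minfo := fun σ =>
    if σ.getLast? = some ⟨0, hk⟩ then some (σ.dropLast, threshold (k - 1)) else none
  work := 0

/-- Scan the indices `i ∈ S_σ` in increasing order and return the first one whose key is best. -/
def scan (σ : List (Fin k)) (better : ℕ → ℕ → Bool) (key : Fin k → Prog k d ℕ) :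
    Prog k d (Option (Fin k)) := do
  let best ← (List.finRange k).foldlM (init := (none : Option (Fin k × ℕ))) fun best i => do
    tick 1
    if ← nontargetMem σ i then
      let x ← key i
      tick 1
      match best with
      | none => return some (i, x)
      | some (i₀, y) => return if better x y then some (i, x) else some (i₀, y)
    else
      return best
  return best.map Prod.fst

/-- An index `i ∈ S_σ` with the smallest key. -/
def argMin (σ : List (Fin k)) (key : Fin k → Prog k d ℕ) : Prog k d (Option (Fin k)) :=
  scan σ (fun x y => decide (x < y)) key

/-- An index `i ∈ S_σ` with the largest key. -/
def argMax (σ : List (Fin k)) (key : Fin k → Prog k d ℕ) : Prog k d (Option (Fin k)) :=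
  scan σ (fun x y => decide (y < x)) key

/-- The body of the loop of `retarget`: choose the next target child from the nonempty set `S_σ`. -/
def retargetStep (σ : List (Fin k)) : Prog k d Unit := do
  let c ← nontargetCard σ
  let p ← getMinfo σ
  tick 4
  if c = 1 then
    let some i ← argMin σ (fun _ => pure 0) | return ()
    setTarget σ i
    setMinfo (σ ++ [i]) p
    nontargetErase σ i
  else
    let some i ←
        (if c % (2 * d + 1) = 1 then argMin σ (fun i => getSize (σ ++ [i]))
        else argMax σ (fun i => shadowCard (σ ++ [i]) p)) | return ()
    setTarget σ i
    setMinfo (σ ++ [i]) (some (σ, threshold (c - 1)))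
    nontargetErase σ i

/-- At most `fuel` rounds of the loop: while `S_σ ≠ ∅` and `size_{σ + t_σ} = 0`, choose the next
target child. -/
def retargetLoop (σ : List (Fin k)) : ℕ → Prog k d Unit
  | 0 => pure ()
  | fuel + 1 => do
    let c ← nontargetCard σ
    let t ← getTarget σ
    let z ← getSize (σ ++ [t])
    tick 2
    if c ≠ 0 ∧ z = 0 then
      retargetStep σ
      retargetLoop σ fuel

/-- The complete loop. As each round removes an element from `S_σ`, it has ended after `|S_σ|`
rounds. -/
def retarget (σ : List (Fin k)) : Prog k d Unit := do
  let c ← nontargetCard σ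
  retargetLoop σ (c + 1)

/-- The cluster-`σ`-degree of `v`: the number of remaining neighbours `u` of `v` in a child cluster
of `σ` different from the one that contains `v`. -/
def clusterDegree (adj : Vertex k d → List (Vertex k d)) (σ : List (Fin k)) (v : Vertex k d) :
    Prog k d ℕ :=
  (adj v).foldlM (init := 0) fun n u => do
    tick 2
    access
    if (← vertexMem u) ∧ lcp v.toList u.toList = σ then return n + 1 else return n

/-- Remove `x` from the remaining vertex set, and update the shadow mark sets and the sizes. -/
def processRemoval (adj : Vertex k d → List (Vertex k d)) (x : Vertex k d) : Prog k d Unit := do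
  (adj x).forM fun v => do
    tick 1
    if ← vertexMem v then
      access
      let σ := lcp v.toList x.toList
      let deg ← clusterDegree adj σ v
      (List.range' (σ.length + 1) (d - σ.length)).forM fun m => do
        tick 1
        shadowInsert (v.toList.take m) σ deg v
  vertexErase x
  (List.range (d + 1)).forM fun m => do
    tick 1
    decrSize (x.toList.take m)

/-- Remove one vertex of the cluster `σ`, which has height `r`, by descending to target children;
return that vertex. -/
def trim (adj : Vertex k d → List (Vertex k d)) :
    (r : ℕ) → (σ : List (Fin k)) → σ.length + r = d → Prog k d (Vertex k d)
  | 0, σ, h => do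
    processRemoval adj ⟨σ, h⟩
    return ⟨σ, h⟩
  | r + 1, σ, h => do
    tick 1
    let t ← getTarget σ
    let v ← trim adj r (σ ++ [t]) (by simp only [List.length_append, List.length_singleton]; omega)
    retarget σ
    return v

/-- Call `trim` on `σ` the given number of times, and add the removed vertices to `R`. -/
def trimRepeat (adj : Vertex k d → List (Vertex k d)) (r : ℕ) (σ : List (Fin k))
    (h : σ.length + r = d) : ℕ → Finset (Vertex k d) → Prog k d (Finset (Vertex k d))
  | 0, R => return R
  | n + 1, R => do
    tick 1
    let v ← trim adj r σ h
    access
    trimRepeat adj r σ h n (insert v R)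

/-- The ancestors of `v` of depth less than `m` are processed, from the deepest one to the root; `R`
is the set of vertices removed so far. -/
def climb (adj : Vertex k d → List (Vertex k d)) (ρ : ℕ) (v : Vertex k d) :
    (m : ℕ) → m ≤ d → Finset (Vertex k d) → Prog k d (Finset (Vertex k d))
  | 0, _, R => return R
  | m + 1, hm, R => do
    tick 1
    access
    let σ := v.toList.take m
    retarget σ
    let n ← getSize σ
    tick 2
    let R' ← trimRepeat adj (d - m) σ
      (by simp only [σ, List.length_take, List.Vector.toList_length]; omega) (min (ρ * R.card) n) R
    climb adj ρ v m (by omega) R'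

/-- The update: delete `v`, and return the set of the vertices that are pruned in addition. -/
def delete (adj : Vertex k d → List (Vertex k d)) (ρ : ℕ) (v : Vertex k d) :
    Prog k d (Finset (Vertex k d)) := do
  processRemoval adj v
  access
  let R ← climb adj ρ v d le_rfl {v}
  access
  return R.erase v

/-- The states that the data structure can be in after finitely many updates, each of which deletes
an arbitrary remaining vertex. -/
inductive Reachable (adj : Vertex k d → List (Vertex k d)) (ρ : ℕ) (s₀ : State k d) :
    State k d → Prop
  | init : Reachable adj ρ s₀ s₀
  | step {s : State k d} {v : Vertex k d} : Reachable adj ρ s₀ s → v ∈ s.V →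
      Reachable adj ρ s₀ ((delete adj ρ v).run s).2

end Operations

/-- `adj` lists, in an arbitrary order and without repetition, the neighbours of every vertex. -/
def IsAdjacencyList {k d : ℕ} (G : SimpleGraph (Vertex k d))
    (adj : Vertex k d → List (Vertex k d)) : Prop :=
  ∀ v, (adj v).Nodup ∧ ∀ u, u ∈ adj v ↔ G.Adj v u

end SemiHypercube

/-! The proof is an amortized analysis with payments. A removal that descends from a cluster `P`
along target children is one payment at `P`, and it creates a debt of `ρ` payments at every strict
prefix of `P`; the deletion of `v` itself only creates debts. `delete` settles the debts from the
deepest prefix of `v` upwards by trimming, so all debts are zero between updates. A debt that cannot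
be settled belongs to an emptied cluster and no longer matters.

Losses. While a child `i` of `σ` has not been a target, each vertex lost in it has been charged with
`ρ` payments at `σ`, and each payment at `σ` takes a vertex from the current target child. So the
losses form a cup game: `ρ` times the contents grows only as fast as payments are made, at most
`2d+1` full targets are used between two choices by size, and such a choice takes out the fullest
cup. The harmonic bound for this game (`CupBound`) and the choice of `ρ` show that every child that
has not been a target has lost at most a fraction `τ` (`Inv.loss_le`). Children abandoned earlier
are empty, hence only the target can be critical.

Marks. A vertex is marked for `σ` and `j` when its cluster-`σ`-degree drops below `j`. When a target
of `σ` is chosen with threshold about 19/20 of the number `m` of remaining siblings, double counting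
against the losses of the siblings shows that the marks have density at most `10 τ`
(`Inv.marks_new_target`). Inside the target `B`, later removals add marks, while choosing targets of
`B` by marks plays a second cup game on the children of `B`. Only one choice in `2d+1` is made by
size, so the last child of `B` receives at most about `1/k` of the marks, up to a factor `1 + 1/d`,
plus a term of density `τ/d`. That child inherits the mark parameters, at most `d` times in a chain,
so the density stays below `30 τ` (`markDensity_le`).

Conclusion. By induction on the height, at most 1/19 of the remaining vertices of a target are
marked for its parent (`Inv.marks_le`). The others have degree at least `19/20 * m`, and 18/19 times
19/20 is 9/10 (`Inv.isTauSemiHypercube`).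

The invariant `Inv` is stated for an abstract `Core` of the memory and is preserved by its two
atomic changes, `Inv.remove` and `Inv.choose`. The programs are then shown to realize sequences of
such changes within stated work bounds (`Sim`). On each of the `d` levels the number of removed
vertices grows by a factor of at most `1 + ρ`, and `ρ = O(log n / τ)`; this bounds the pruned set
and the work. -/

namespace SemiHypercube

open Finset

/-! ### Clusters, prefixes and longest common prefixes. -/

section Prefixes

variable {k d : ℕ}

theorem vertex_ext {v w : Vertex k d} (h : v.toList = w.toList) : v = w := Subtype.ext h

theorem mem_cluster {V : Finset (Vertex k d)} {σ : List (Fin k)} {v : Vertex k d} :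
    v ∈ cluster V σ ↔ v ∈ V ∧ σ <+: v.toList := by
  simp [cluster]

theorem cluster_subset_of_prefix (V : Finset (Vertex k d)) {σ σ' : List (Fin k)} (h : σ <+: σ') :
    cluster V σ' ⊆ cluster V σ := fun v hv => by
  rw [mem_cluster] at hv ⊢
  exact ⟨hv.1, h.trans hv.2⟩

theorem cluster_subset_cluster {V W : Finset (Vertex k d)} (h : V ⊆ W) (σ : List (Fin k)) :
    cluster V σ ⊆ cluster W σ := Finset.filter_subset_filter _ h

theorem exists_child_prefix {α : Type*} {σ l : List α} (h : σ <+: l) (hl : σ.length < l.length) :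
    ∃ i, σ ++ [i] <+: l := by
  obtain ⟨m, rfl⟩ := h
  cases m with
  | nil => simp at hl
  | cons i m => exact ⟨i, m, by simp⟩

theorem child_prefix_unique {α : Type*} {σ l : List α} {i j : α} (hi : σ ++ [i] <+: l)
    (hj : σ ++ [j] <+: l) : i = j := by
  have h := List.prefix_of_prefix_length_le hi hj (by simp)
  have h2 := h.eq_of_length (by simp)
  simpa using h2

theorem prefix_append_singleton {α : Type*} (σ : List α) (i : α) : σ <+: σ ++ [i] := ⟨[i], rfl⟩

theorem disjoint_cluster_child (V W : Finset (Vertex k d)) (σ : List (Fin k)) {i j : Fin k}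
    (h : i ≠ j) : Disjoint (cluster V (σ ++ [i])) (cluster W (σ ++ [j])) := by
  rw [Finset.disjoint_left]
  intro v hv hw
  exact h (child_prefix_unique (mem_cluster.1 hv).2 (mem_cluster.1 hw).2)

theorem cluster_eq_biUnion (V : Finset (Vertex k d)) {σ : List (Fin k)} (hσ : σ.length < d) :
    cluster V σ = univ.biUnion fun i => cluster V (σ ++ [i]) := by
  ext v
  simp only [mem_biUnion, mem_univ, true_and, mem_cluster]
  constructor
  · rintro ⟨h1, h2⟩
    obtain ⟨i, hi⟩ := exists_child_prefix h2 (by simpa using hσ)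
    exact ⟨i, h1, hi⟩
  · rintro ⟨i, h1, h2⟩
    exact ⟨h1, (prefix_append_singleton σ i).trans h2⟩

theorem card_cluster_eq_sum (V : Finset (Vertex k d)) {σ : List (Fin k)} (hσ : σ.length < d) :
    (cluster V σ).card = ∑ i, (cluster V (σ ++ [i])).card := by
  rw [cluster_eq_biUnion V hσ, card_biUnion]
  intro i _ j _ hij
  exact disjoint_cluster_child V V σ hij

theorem card_cluster_univ {σ : List (Fin k)} (hσ : σ.length ≤ d) :
    (cluster (univ : Finset (Vertex k d)) σ).card = k ^ (d - σ.length) := by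
  obtain ⟨h, hh⟩ := Nat.exists_eq_add_of_le hσ
  induction h generalizing σ with
  | zero =>
    obtain ⟨w, rfl⟩ : ∃ w : Vertex k d, w.toList = σ := ⟨⟨σ, by omega⟩, rfl⟩
    have : cluster (univ : Finset (Vertex k d)) w.toList = {w} := by
      ext v
      rw [mem_cluster, mem_singleton]
      constructor
      · rintro ⟨-, h⟩
        exact (vertex_ext (h.eq_of_length (by simp))).symm
      · rintro rfl
        exact ⟨mem_univ _, List.prefix_rfl⟩
    rw [this, card_singleton]
    simp
  | succ h ih =>
    rw [card_cluster_eq_sum _ (by omega)]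
    have : ∀ i : Fin k, (cluster (univ : Finset (Vertex k d)) (σ ++ [i])).card
        = k ^ (d - (σ.length + 1)) := fun i => by
      rw [ih (by simp; omega) (by simp; omega)]
      simp
    simp only [this, sum_const, card_univ, Fintype.card_fin, smul_eq_mul]
    rw [← pow_succ']
    congr 1
    omega

theorem card_cluster_le (V : Finset (Vertex k d)) {σ : List (Fin k)} (hσ : σ.length ≤ d) :
    (cluster V σ).card ≤ k ^ (d - σ.length) := by
  rw [← card_cluster_univ hσ]
  exact card_le_card (cluster_subset_cluster (subset_univ V) σ)

theorem cluster_eq_self_child {V : Finset (Vertex k d)} {σ : List (Fin k)} (hσ : σ.length < d)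
    {t : Fin k} (h : ∀ i, i ≠ t → cluster V (σ ++ [i]) = ∅) :
    cluster V σ = cluster V (σ ++ [t]) := by
  apply Subset.antisymm
  · intro v hv
    rw [cluster_eq_biUnion V hσ, mem_biUnion] at hv
    obtain ⟨i, -, hi⟩ := hv
    by_cases hit : i = t
    · exact hit ▸ hi
    · rw [h i hit] at hi
      simp at hi
  · exact cluster_subset_of_prefix V (prefix_append_singleton σ t)

theorem lcp_prefix_left (a b : List (Fin k)) : lcp a b <+: a := by
  induction a generalizing b with
  | nil => simp [lcp]
  | cons x a ih =>
    cases b with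
    | nil => simp [lcp]
    | cons y b =>
      rw [lcp]
      split_ifs with h
      · exact (List.cons_prefix_cons).2 ⟨rfl, ih b⟩
      · exact List.nil_prefix

theorem lcp_of_split {σ a b : List (Fin k)} {i j : Fin k} (hij : i ≠ j) (ha : σ ++ [i] <+: a)
    (hb : σ ++ [j] <+: b) : lcp a b = σ := by
  induction σ generalizing a b with
  | nil =>
    obtain ⟨a, rfl⟩ := ha
    obtain ⟨b, rfl⟩ := hb
    simp [lcp, hij]
  | cons x σ ih =>
    obtain ⟨a, rfl⟩ := ha
    obtain ⟨b, rfl⟩ := hb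
    simp only [List.cons_append, lcp, if_true]
    rw [ih ⟨a, rfl⟩ ⟨b, rfl⟩]

theorem split_of_lcp {a b : List (Fin k)} (hab : a ≠ b) (hl : a.length = b.length) :
    ∃ i j, i ≠ j ∧ lcp a b ++ [i] <+: a ∧ lcp a b ++ [j] <+: b := by
  induction a generalizing b with
  | nil =>
    cases b with
    | nil => exact absurd rfl hab
    | cons y b => simp at hl
  | cons x a ih =>
    cases b with
    | nil => simp at hl
    | cons y b =>
      rw [lcp]
      split_ifs with h
      · subst h
        obtain ⟨i, j, hij, h1, h2⟩ := ih (b := b) (by simpa using hab) (by simpa using hl)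
        refine ⟨i, j, hij, ?_, ?_⟩ <;> simp only [List.cons_append, List.cons_prefix_cons] <;> simp [h1, h2]
      · exact ⟨x, y, h, by simp, by simp⟩

theorem lcp_self (a : List (Fin k)) : lcp a a = a := by
  induction a with
  | nil => simp [lcp]
  | cons x a ih => simp [lcp, ih]

/-- Distinct vertices whose longest common prefix is `σ` lie in distinct children of `σ`. -/
theorem lcp_eq_iff {v u : Vertex k d} {σ : List (Fin k)} (hσ : σ.length < d) :
    lcp v.toList u.toList = σ ↔ ∃ i j, i ≠ j ∧ σ ++ [i] <+: v.toList ∧ σ ++ [j] <+: u.toList := by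
  constructor
  · intro h
    by_cases hvu : v = u
    · subst hvu
      rw [lcp_self] at h
      rw [← h] at hσ
      simp at hσ
    · subst h
      exact split_of_lcp (fun h => hvu (Subtype.ext h)) (by simp)
  · rintro ⟨i, j, hij, h1, h2⟩
    exact lcp_of_split hij h1 h2

end Prefixes

/-! ### Degrees in a semi-hypercube and double counting of lost neighbours. -/

section Degrees

variable {k d : ℕ} {G : SimpleGraph (Vertex k d)}

open Classical in
/-- The remaining neighbours of `v` that split off from `v` at the cluster `σ`. -/
noncomputable def nbrs (G : SimpleGraph (Vertex k d)) (V : Finset (Vertex k d))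
    (σ : List (Fin k)) (v : Vertex k d) : Finset (Vertex k d) :=
  V.filter fun u => G.Adj v u ∧ lcp v.toList u.toList = σ

theorem mem_nbrs {V : Finset (Vertex k d)} {σ : List (Fin k)} {v u : Vertex k d} :
    u ∈ nbrs G V σ v ↔ u ∈ V ∧ G.Adj v u ∧ lcp v.toList u.toList = σ := by
  simp [nbrs]

theorem nbrs_mono {V W : Finset (Vertex k d)} (h : V ⊆ W) (σ : List (Fin k)) (v : Vertex k d) :
    nbrs G V σ v ⊆ nbrs G W σ v := fun u hu => by
  rw [mem_nbrs] at hu ⊢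
  exact ⟨h hu.1, hu.2⟩

/-- A vertex of one child cluster has its unique neighbours in all other ones. -/
theorem IsSemiHypercube.exists_nbr_map (hG : IsSemiHypercube G) {σ : List (Fin k)}
    (hσ : σ.length < d) {t : Fin k} {v : Vertex k d} (hv : σ ++ [t] <+: v.toList) :
    ∃ f : Fin k → Vertex k d, ∀ i, i ≠ t → G.Adj v (f i) ∧ σ ++ [i] <+: (f i).toList := by
  have : ∀ i, ∃ u : Vertex k d, i ≠ t → G.Adj v u ∧ σ ++ [i] <+: u.toList := by
    intro i
    by_cases hi : i = t
    · exact ⟨v, fun h => absurd hi h⟩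
    · obtain ⟨u, ⟨h1, h2⟩, -⟩ := hG σ hσ t i (Ne.symm hi) v (mem_cluster.2 ⟨mem_univ _, hv⟩)
      exact ⟨u, fun _ => ⟨h2, (mem_cluster.1 h1).2⟩⟩
  choose f hf using this
  exact ⟨f, hf⟩

theorem IsSemiHypercube.nbr_unique (hG : IsSemiHypercube G) {σ : List (Fin k)}
    (hσ : σ.length < d) {s t : Fin k} (hst : s ≠ t) {x v w : Vertex k d}
    (hx : σ ++ [s] <+: x.toList) (hv : σ ++ [t] <+: v.toList) (hw : σ ++ [t] <+: w.toList)
    (h1 : G.Adj x v) (h2 : G.Adj x w) : v = w :=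
  (hG σ hσ s t hst x (mem_cluster.2 ⟨mem_univ _, hx⟩)).unique
    ⟨mem_cluster.2 ⟨mem_univ _, hv⟩, h1⟩ ⟨mem_cluster.2 ⟨mem_univ _, hw⟩, h2⟩

/-- There is one neighbour in each sibling cluster. This makes the empty initial mark sets correct
for all thresholds up to `k - 1`. -/
theorem IsSemiHypercube.le_card_nbrs_univ (hG : IsSemiHypercube G) {σ : List (Fin k)}
    (hσ : σ.length < d) {v : Vertex k d} (hv : σ <+: v.toList) :
    k - 1 ≤ (nbrs G univ σ v).card := by
  obtain ⟨t, ht⟩ := exists_child_prefix hv (by simpa using hσ)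
  obtain ⟨f, hf⟩ := hG.exists_nbr_map hσ ht
  have : k - 1 = ((univ : Finset (Fin k)).erase t).card := by simp
  rw [this]
  apply card_le_card_of_injOn f
  · intro i hi
    have hit : i ≠ t := by simpa using hi
    simp only [mem_coe, mem_nbrs, mem_univ, true_and]
    exact ⟨(hf i hit).1, lcp_of_split (Ne.symm hit) ht (hf i hit).2⟩
  · intro i hi j hj hij
    have hit : i ≠ t := by simpa using hi
    have hjt : j ≠ t := by simpa using hj
    exact child_prefix_unique (hf i hit).2 (hij ▸ (hf j hjt).2)

/-- The number of removed vertices of the cluster `σ`. -/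
def loss (V : Finset (Vertex k d)) (σ : List (Fin k)) : ℕ := (cluster (univ \ V) σ).card

theorem loss_add_card (V : Finset (Vertex k d)) {σ : List (Fin k)} (hσ : σ.length ≤ d) :
    loss V σ + (cluster V σ).card = k ^ (d - σ.length) := by
  rw [← card_cluster_univ hσ, loss, ← card_union_of_disjoint]
  · congr 1
    ext v
    simp only [mem_union, mem_cluster, mem_sdiff, mem_univ, true_and]
    tauto
  · rw [Finset.disjoint_left]
    intro v h1 h2
    simp only [mem_cluster, mem_sdiff, mem_univ, true_and] at h1 h2
    exact h1.1 h2.1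

/-- Few vertices of the child `t` lose many of their neighbours in the children `i ∈ S`. -/
theorem IsSemiHypercube.card_mul_le_loss (hG : IsSemiHypercube G) {σ : List (Fin k)}
    (hσ : σ.length < d) {t : Fin k} {S : Finset (Fin k)} (ht : t ∉ S) {V : Finset (Vertex k d)}
    {j : ℕ} {M : Finset (Vertex k d)} (hM : ∀ v ∈ M, (nbrs G V σ v).card < j) :
    (cluster M (σ ++ [t])).card * (S.card + 1 - j) ≤ ∑ i ∈ S, loss V (σ ++ [i]) := by
  classical
  set L : Finset (Vertex k d) := S.biUnion fun i => cluster (univ \ V) (σ ++ [i]) with hL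
  have hcard : L.card = ∑ i ∈ S, loss V (σ ++ [i]) := by
    rw [hL, card_biUnion]
    · rfl
    · intro i _ j _ hij
      exact disjoint_cluster_child _ _ σ hij
  rw [← hcard, ← mul_one L.card]
  -- Count the edges between the vertices of `M` in the child `t` and the lost vertices `L`. A
  -- vertex on the left has a neighbour in each of the `S.card` siblings, and fewer than `j` of
  -- these remain; a lost vertex has at most one neighbour in the child `t`.
  apply Finset.card_mul_le_card_mul (fun v u => G.Adj v u)
  · intro v hv
    rw [mem_cluster] at hv
    obtain ⟨f, hf⟩ := hG.exists_nbr_map hσ hv.2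
    have hSt : ∀ i ∈ S, i ≠ t := fun i hi h => ht (h ▸ hi)
    have h1 : S.card ≤ (S.image f).card := by
      rw [card_image_of_injOn]
      intro i hi j hj hij
      exact child_prefix_unique (hf i (hSt i hi)).2 (hij ▸ (hf j (hSt j hj)).2)
    have h2 : S.image f ⊆ nbrs G V σ v ∪ L.bipartiteAbove (fun v u => G.Adj v u) v := by
      intro u hu
      obtain ⟨i, hi, rfl⟩ := mem_image.1 hu
      rw [mem_union, mem_nbrs, mem_bipartiteAbove]
      have hfi := hf i (hSt i hi)
      by_cases hV : f i ∈ V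
      · exact Or.inl ⟨hV, hfi.1, lcp_of_split (Ne.symm (hSt i hi)) hv.2 hfi.2⟩
      · refine Or.inr ⟨?_, hfi.1⟩
        rw [hL, mem_biUnion]
        exact ⟨i, hi, mem_cluster.2 ⟨by simp [hV], hfi.2⟩⟩
    have h3 := (card_le_card h2).trans (card_union_le _ _)
    have h4 := hM v hv.1
    omega
  · intro u hu
    rw [hL, mem_biUnion] at hu
    obtain ⟨i, hi, hu⟩ := hu
    rw [card_le_one]
    intro v hv w hw
    rw [mem_bipartiteBelow, mem_cluster] at hv hw
    exact hG.nbr_unique hσ (s := i) (t := t) (fun h => ht (h ▸ hi)) (mem_cluster.1 hu).2 hv.1.2 hw.1.2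
      hv.2.symm hw.2.symm

/-- A vertex has at most `k` neighbours on each of the `d` levels. -/
theorem IsSemiHypercube.length_adj_le (hG : IsSemiHypercube G)
    {adj : Vertex k d → List (Vertex k d)} (hadj : IsAdjacencyList G adj) (v : Vertex k d) :
    (adj v).length ≤ d * k := by
  classical
  have hsplit : ∀ u ∈ adj v, ∃ m : ℕ, ∃ i j : Fin k, m < d ∧ i ≠ j ∧
      v.toList.take m ++ [i] <+: v.toList ∧ v.toList.take m ++ [j] <+: u.toList := by
    intro u hu
    have hne : v ≠ u := ((hadj v).2 u |>.1 hu).ne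
    obtain ⟨i, j, hij, h1, h2⟩ := split_of_lcp (a := v.toList) (b := u.toList)
      (fun h => hne (Subtype.ext h)) (by simp)
    have hlen := h1.length_le
    simp only [List.length_append, List.length_singleton, List.Vector.toList_length] at hlen
    have htake := List.prefix_iff_eq_take.1 (lcp_prefix_left v.toList u.toList)
    refine ⟨(lcp v.toList u.toList).length, i, j, by omega, hij, ?_, ?_⟩
    · rw [← htake]; exact h1
    · rw [← htake]; exact h2
  choose m i j hm hij h1 h2 using hsplit
  have hprod : d * k = ((univ : Finset (Fin d)) ×ˢ (univ : Finset (Fin k))).card := by simp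
  rw [← List.toFinset_card_of_nodup (hadj v).1, hprod, ← card_attach]
  -- A neighbour is determined by the level at which it splits off from `v` and by the index of the
  -- child into which it goes.
  apply card_le_card_of_injOn
    (fun u => (⟨m u.1 (List.mem_toFinset.1 u.2), hm _ _⟩, j u.1 (List.mem_toFinset.1 u.2)))
  · intro u _
    simp
  · rintro ⟨u, hu⟩ - ⟨w, hw⟩ - huw
    have hu' := List.mem_toFinset.1 hu
    have hw' := List.mem_toFinset.1 hw
    simp only [Prod.mk.injEq, Fin.mk.injEq] at huw
    refine Subtype.ext (hG.nbr_unique (σ := v.toList.take (m u hu')) (s := i u hu') (t := j u hu')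
      ?_ (hij u hu') (h1 u hu') (h2 u hu') ?_ ((hadj v).2 u |>.1 hu') ((hadj v).2 w |>.1 hw'))
    · simpa using hm u hu'
    · rw [huw.1, huw.2]
      exact h2 w hw'

end Degrees

end SemiHypercube

namespace SemiHypercube

open Finset

/-! ### A cup game with greedy removal of the fullest cup. -/

section CupGame

variable {ι : Type*}

/-- The real value of the `n`-th harmonic number. -/
noncomputable def harm (n : ℕ) : ℝ := ((harmonic n : ℚ) : ℝ)

theorem harm_zero : harm 0 = 0 := by simp [harm]

theorem harm_succ (n : ℕ) : harm (n + 1) = harm n + 1 / ((n : ℝ) + 1) := by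
  rw [harm, harm, harmonic_succ]
  push_cast
  rw [one_div]

theorem harm_mono {m n : ℕ} (h : m ≤ n) : harm m ≤ harm n := by
  induction h with
  | refl => exact le_rfl
  | step _ ih => rw [Nat.succ_eq_add_one, harm_succ]; exact ih.trans (by simp; positivity)

theorem harm_one : harm 1 = 1 := by simpa [harm_zero] using harm_succ 0

theorem one_le_harm {n : ℕ} (h : 0 < n) : 1 ≤ harm n := by
  rw [← harm_one]
  exact harm_mono h

/-- The invariant of a game in which cups `i ∈ S` with contents `w i` are filled with a total of `I`
in the beginning, then slowly while `y` out of at most `α` payments of `1 / ρ` are made in each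
round, and the fullest cup is taken out in the end of each of the `g` rounds; payments of `D / ρ`
are outstanding. -/
def CupBound (ρ : ℕ) (α I : ℝ) (S : Finset ι) (w : ι → ℕ) (g y D : ℕ) : Prop :=
  ∀ T ⊆ S, (ρ : ℝ) * ((∑ i ∈ T, w i : ℕ) : ℝ) ≤
    (T.card : ℝ) / (T.card + g : ℕ) * I + α * (T.card * (harm (T.card + g) - harm T.card)) + y + D

variable {ρ : ℕ} {α I : ℝ} {S : Finset ι} {w w' : ι → ℕ} {g y D y' D' : ℕ}

/-- One unit is poured into the cups, and is financed by `ρ` new outstanding payments. -/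
theorem CupBound.of_sum_le (h : CupBound ρ α I S w g y D)
    (hw : ∀ T ⊆ S, ∑ i ∈ T, w' i ≤ ∑ i ∈ T, w i + 1) (hD : D' = D + ρ) :
    CupBound ρ α I S w' g y D' := by
  intro T hT
  have h1 : ((∑ i ∈ T, w' i : ℕ) : ℝ) ≤ ((∑ i ∈ T, w i : ℕ) : ℝ) + 1 := by exact_mod_cast hw T hT
  have h2 := h T hT
  have h3 := mul_le_mul_of_nonneg_left h1 (Nat.cast_nonneg (α := ℝ) ρ)
  subst hD
  push_cast at h2 h3 ⊢
  linarith

/-- Making a payment moves one unit from the debt `D` to the payments `y` of the current round,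
without touching the cups. -/
theorem CupBound.congr (h : CupBound ρ α I S w g y D) (hw : ∀ i ∈ S, w' i = w i)
    (hD : y + D = y' + D') : CupBound ρ α I S w' g y' D' := by
  intro T hT
  rw [sum_congr rfl fun i hi => hw i (hT hi)]
  have h2 := h T hT
  have h3 : (y : ℝ) + D = y' + D' := by exact_mod_cast hD
  linarith

theorem CupBound.subset {S' : Finset ι} (h : CupBound ρ α I S w g y D) (hS : S' ⊆ S) :
    CupBound ρ α I S' w g y D := fun T hT => h T (hT.trans hS)

/-- Averaging: as `i` is the fullest cup, a set `T` without `i` holds at most the fraction `|T| /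
(|T| + 1)` of the contents of `T` together with `i`. Scaling the old bound for the larger set by
this fraction gives the new bound for `T`. -/
theorem CupBound.greedy [DecidableEq ι] (h : CupBound ρ α I S w g y D) {i : ι} (hi : i ∈ S)
    (hmax : ∀ j ∈ S, w j ≤ w i) (hy : (y : ℝ) ≤ α) :
    CupBound ρ α I (S.erase i) w (g + 1) 0 D := by
  intro T hT
  have hiT : i ∉ T := fun h => by simpa using hT h
  have hins : insert i T ⊆ S := insert_subset hi (hT.trans (erase_subset _ _))
  have h1 := h _ hins
  rw [sum_insert hiT, card_insert_of_notMem hiT] at h1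
  have h2 : ∑ j ∈ T, w j ≤ T.card * w i := by
    rw [← smul_eq_mul]
    exact sum_le_card_nsmul _ _ _ fun j hj => hmax j (hins (mem_insert_of_mem hj))
  set W := ∑ j ∈ T, w j
  set m := T.card
  have hD : (0 : ℝ) ≤ D := Nat.cast_nonneg _
  have hm0 : (0 : ℝ) ≤ m := Nat.cast_nonneg _
  have hy0 : (0 : ℝ) ≤ y := Nat.cast_nonneg _
  have h3 : (W : ℝ) ≤ m * w i := by exact_mod_cast h2
  have h4 : (ρ : ℝ) * W * (m + 1) ≤ m * (ρ * (w i + W : ℕ)) := by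
    have := mul_le_mul_of_nonneg_left h3 (Nat.cast_nonneg (α := ℝ) ρ)
    push_cast
    linarith
  have h5 := mul_le_mul_of_nonneg_left h1 hm0
  rw [show m + 1 + g = m + (g + 1) by ring, harm_succ m] at h5
  have hm1 : (0 : ℝ) < m + 1 := by positivity
  have hmg : (0 : ℝ) < (m + (g + 1) : ℕ) := by positivity
  refine le_of_mul_le_mul_right (h4.trans (h5.trans ?_)) hm1
  set A := harm (m + (g + 1))
  set B := harm m
  have e1 : (m : ℝ) * (((m + 1 : ℕ) : ℝ) / (m + (g + 1) : ℕ) * I)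
      = m / (m + (g + 1) : ℕ) * I * (m + 1) := by
    push_cast
    ring
  -- The passage from `harm m` to `harm (m + 1)` frees `m * α`, which covers the payments `m * y` of
  -- the round that ends.
  have e2 : (m : ℝ) * (α * (((m + 1 : ℕ) : ℝ) * (A - (B + 1 / ((m : ℝ) + 1)))))
      = α * (m * (A - B)) * (m + 1) - m * α := by
    push_cast
    field_simp
    ring
  rw [mul_add, mul_add, mul_add, e1, e2]
  have := mul_le_mul_of_nonneg_left hy hm0
  push_cast
  nlinarith

theorem CupBound.single (h : CupBound ρ α I S w g y D) {i : ι} (hi : i ∈ S) {N : ℕ}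
    (hα : 0 ≤ α) (hN : g + 1 ≤ N) :
    (ρ : ℝ) * w i ≤ I / (g + 1 : ℕ) + α * (harm N - 1) + y + D := by
  have h1 := h {i} (by simpa using hi)
  rw [sum_singleton, card_singleton, harm_one, add_comm 1 g] at h1
  have h2 := mul_le_mul_of_nonneg_left (harm_mono hN) hα
  push_cast at h1 ⊢
  rw [one_div, inv_mul_eq_div] at h1
  linarith

theorem CupBound.total (h : CupBound ρ α I S w g y D) {T : Finset ι} (hT : T ⊆ S)
    (hα : 0 ≤ α) (hy : (y : ℝ) ≤ α) {N : ℕ} (hN : T.card + g ≤ N) (hT0 : 0 < T.card) :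
    (ρ : ℝ) * ((∑ i ∈ T, w i : ℕ) : ℝ) ≤
      (T.card : ℝ) / (T.card + g : ℕ) * I + α * (T.card * harm N) + D := by
  have h1 := h T hT
  have h2 := harm_mono hN
  have h3 := one_le_harm hT0
  have h4 : (1 : ℝ) ≤ T.card := by exact_mod_cast hT0
  -- The subtracted term `T.card * harm T.card` is at least 1, which leaves room for `y ≤ α`.
  have h5 : (T.card : ℝ) * (harm (T.card + g) - harm T.card) + 1 ≤ T.card * harm N := by nlinarith
  have h6 := mul_le_mul_of_nonneg_left h5 hα
  linarith

theorem CupBound.init (hw : (ρ : ℝ) * ((∑ i ∈ S, w i : ℕ) : ℝ) ≤ I + D) :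
    CupBound ρ α I S w 0 0 D := by
  intro T hT
  rcases T.eq_empty_or_nonempty with rfl | hne
  · simp
  · have hc : (T.card : ℝ) ≠ 0 := by exact_mod_cast hne.card_pos.ne'
    have h1 : ((∑ i ∈ T, w i : ℕ) : ℝ) ≤ ((∑ i ∈ S, w i : ℕ) : ℝ) := by
      exact_mod_cast sum_le_sum_of_subset hT
    have h2 := mul_le_mul_of_nonneg_left h1 (Nat.cast_nonneg (α := ℝ) ρ)
    simp only [add_zero, div_self hc, sub_self, mul_zero, one_mul, CharP.cast_eq_zero]
    linarith

end CupGame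

/-! ### The abstract memory and the invariant. -/

section Core

variable {k d : ℕ}

/-- The part of the memory that determines the behaviour of the algorithm: a vertex belongs to
`mark σ j` if its cluster-`σ`-degree has dropped below `j` while it was a remaining vertex. -/
structure Core (k d : ℕ) where
  V : Finset (Vertex k d)
  target : List (Fin k) → Fin k
  nontarget : List (Fin k) → Finset (Fin k)
  minfo : List (Fin k) → Option (List (Fin k) × ℕ)
  mark : List (Fin k) → ℕ → Finset (Vertex k d)

open Classical in
/-- Removal of a vertex. -/
noncomputable def Core.remove (G : SimpleGraph (Vertex k d)) (x : Vertex k d) (q : Core k d) :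
    Core k d :=
  { q with
    V := q.V.erase x
    mark := fun σ j => q.mark σ j ∪ q.V.filter fun v =>
      G.Adj v x ∧ lcp v.toList x.toList = σ ∧ (nbrs G q.V σ v).card = j }

/-- A round of the loop of `retarget` in which `i` becomes the target child of `σ`. -/
def Core.choose (σ : List (Fin k)) (i : Fin k) (q : Core k d) : Core k d :=
  { q with
    target := Function.update q.target σ i
    nontarget := Function.update q.nontarget σ ((q.nontarget σ).erase i)
    minfo := Function.update q.minfo (σ ++ [i])
      (if (q.nontarget σ).card = 1 then q.minfo σ
        else some (σ, threshold ((q.nontarget σ).card - 1))) }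

/-- The number of remaining vertices of a cluster. -/
def Core.vol (q : Core k d) (σ : List (Fin k)) : ℕ := (cluster q.V σ).card

/-- The loss of the children of `σ` that have not been targets, with outstanding payments `D`. -/
def LossInv (ρ : ℕ) (q : Core k d) (D : ℕ) (σ : List (Fin k)) : Prop :=
  ∃ g y : ℕ, g + (q.nontarget σ).card + 1 ≤ k ∧
    -- The factor counts the targets used since the last choice by size, the current one included:
    -- it is 1 when `|S_σ|` is divisible by `2d+1`, which is the case right after such a choice, and
    -- it grows by one with every other choice.
    y + q.vol (σ ++ [q.target σ]) ≤
      ((2 * d + 1 - (q.nontarget σ).card % (2 * d + 1)) % (2 * d + 1) + 1) *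
        k ^ (d - (σ.length + 1)) ∧
    CupBound ρ (((2 * d + 1) * k ^ (d - (σ.length + 1)) : ℕ) : ℝ) 0 (q.nontarget σ)
      (fun i => loss q.V (σ ++ [i])) g y D

/-- `τ` times this is the bound for the density of marks in a cluster that inherited its mark set
`n` times. -/
noncomputable def markDensity (d n : ℕ) : ℝ := 11 * (1 + 1 / (d : ℝ)) ^ n - 1

/-- The bound for the number of marks for `σ` in the cluster `B` at the beginning. -/
noncomputable def markInit (k d : ℕ) (τ : ℝ) (B σ : List (Fin k)) : ℝ :=
  markDensity d (B.length - (σ.length + 1)) * τ * ((k ^ (d - B.length) : ℕ) : ℝ)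

/-- The number of marks for `σ` and `j` in a cluster. -/
def Core.marks (q : Core k d) (σ : List (Fin k)) (j : ℕ) (B : List (Fin k)) : ℕ :=
  (cluster (q.mark σ j) B).card

/-- The marks in the children of a cluster `B` with mark set parameters `(σ, j)`, with outstanding
payments `D`. -/
def MarkInv (ρ : ℕ) (τ : ℝ) (q : Core k d) (D : ℕ) (B σ : List (Fin k)) (j : ℕ) : Prop :=
  (B.length = d → (ρ : ℝ) * q.marks σ j B ≤ ρ * markInit k d τ B σ + D) ∧
  (B.length < d →
    (q.nontarget B = ∅ → q.minfo (B ++ [q.target B]) = q.minfo B) ∧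
    ∃ g y : ℕ,
      -- A round lasts from one choice by marks to the next one. It uses one target, or two if a
      -- choice by size, which leaves `|S_B|` divisible by `2d+1`, comes in between.
      y + q.vol (B ++ [q.target B]) ≤
        (if (q.nontarget B).card % (2 * d + 1) = 0 then 2 else 1) * k ^ (d - (B.length + 1)) ∧
      -- The quotient is `|S_B| / (2d+1)` rounded up, the number of choices by size still to come. A
      -- choice by marks leaves both sides unchanged, and a choice by size lowers both by one.
      (k : ℝ) * d / (d + 1) + (((q.nontarget B).card + 2 * d) / (2 * d + 1) : ℕ) ≤
        (g + (q.nontarget B).card + 1 : ℕ) ∧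
      g + (q.nontarget B).card + 1 ≤ k ∧
      CupBound ρ ((2 * k ^ (d - (B.length + 1)) : ℕ) : ℝ) (ρ * markInit k d τ B σ)
        (q.nontarget B) (fun i => q.marks σ j (B ++ [i])) g y D ∧
      (ρ : ℝ) * q.marks σ j (B ++ [q.target B]) ≤
        ρ * markInit k d τ B σ / (max g 1 : ℕ) +
          ((2 * k ^ (d - (B.length + 1)) : ℕ) : ℝ) * harm k + y + D)

/-- The invariant of the algorithm, where payments of `D σ` are outstanding at each cluster `σ`. -/
structure Inv (G : SimpleGraph (Vertex k d)) (ρ : ℕ) (τ : ℝ) (q : Core k d)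
    (D : List (Fin k) → ℕ) : Prop where
  target_notMem : ∀ σ, σ.length < d → q.target σ ∉ q.nontarget σ
  abandoned : ∀ σ, σ.length < d → ∀ i, i ∉ q.nontarget σ → i ≠ q.target σ → q.vol (σ ++ [i]) = 0
  minfo_target : ∀ σ, σ.length < d → q.nontarget σ ≠ ∅ →
    q.minfo (σ ++ [q.target σ]) = some (σ, threshold (q.nontarget σ).card)
  owner_prefix : ∀ B σ j, B.length ≤ d → q.minfo B = some (σ, j) → σ <+: B ∧ σ ≠ B
  owner_cluster : ∀ B σ j, B.length ≤ d → q.minfo B = some (σ, j) → 0 < q.vol B →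
    cluster q.V (σ ++ [q.target σ]) = cluster q.V B
  -- The restriction to `j ≤ k - 1` is needed for the initial state, where degrees are only known to
  -- be at least `k - 1` and nothing is marked.
  mem_mark : ∀ σ, σ.length < d → ∀ v ∈ cluster q.V σ, ∀ j ≤ k - 1,
    (nbrs G q.V σ v).card < j → v ∈ q.mark σ j
  nbrs_of_mark : ∀ σ, σ.length < d → ∀ j, ∀ v ∈ q.mark σ j, (nbrs G q.V σ v).card < j
  loss_inv : ∀ σ, σ.length < d → 0 < q.vol σ → LossInv ρ q (D σ) σ
  -- If some cluster from `σ` down to `B` has a debt of at least `q.vol B`, then paying it may empty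
  -- `B`, and nothing is claimed. Otherwise the debts are small enough for the loss bounds that are
  -- used when `B` receives its parameters.
  mark_inv : ∀ B σ j, B.length ≤ d → q.minfo B = some (σ, j) →
    (∀ P, σ <+: P → P <+: B → P ≠ B → D P < q.vol B) → MarkInv ρ τ q (D σ) B σ j

theorem cluster_erase (V : Finset (Vertex k d)) (x : Vertex k d) (σ : List (Fin k)) :
    cluster (V.erase x) σ = (cluster V σ).erase x := by
  ext v
  simp only [mem_cluster, mem_erase]
  tauto

theorem card_cluster_erase {V : Finset (Vertex k d)} {x : Vertex k d} (hx : x ∈ V)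
    (σ : List (Fin k)) : (cluster (V.erase x) σ).card + (if σ <+: x.toList then 1 else 0) =
      (cluster V σ).card := by
  rw [cluster_erase]
  split_ifs with h
  · exact card_erase_add_one (mem_cluster.2 ⟨hx, h⟩)
  · rw [erase_eq_of_notMem fun h' => h (mem_cluster.1 h').2, add_zero]

theorem loss_erase {V : Finset (Vertex k d)} {x : Vertex k d} (hx : x ∈ V) (σ : List (Fin k)) :
    loss (V.erase x) σ = loss V σ + (if σ <+: x.toList then 1 else 0) := by
  have : univ \ V.erase x = insert x (univ \ V) := by
    ext v
    simp only [mem_sdiff, mem_univ, true_and, mem_erase, mem_insert]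
    tauto
  rw [loss, loss, this, cluster, filter_insert]
  split_ifs with h
  · rw [card_insert_of_notMem (by simp [hx])]
    rfl
  · rfl

theorem sum_ite_child_le (T : Finset (Fin k)) (σ l : List (Fin k)) :
    ∑ i ∈ T, (if σ ++ [i] <+: l then 1 else 0) ≤ 1 := by
  rw [← card_filter, card_le_one]
  intro i hi j hj
  exact child_prefix_unique (mem_filter.1 hi).2 (mem_filter.1 hj).2

theorem prefix_child_of_strict {α : Type*} {σ P l : List α} {i : α} (h1 : σ <+: P) (h2 : σ ≠ P)
    (hP : P <+: l) (hi : σ ++ [i] <+: l) : σ ++ [i] <+: P := by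
  apply List.prefix_of_prefix_length_le hi hP
  have := h1.length_le
  have : σ.length ≠ P.length := fun h => h2 (h1.eq_of_length h)
  simp
  omega

end Core

end SemiHypercube

namespace SemiHypercube

open Finset

variable {k d : ℕ} {G : SimpleGraph (Vertex k d)} {ρ : ℕ} {τ : ℝ} {q : Core k d}
  {D D' : List (Fin k) → ℕ}

/-! ### Removals preserve the invariant. -/

section Remove

variable {x : Vertex k d} {P : List (Fin k)}

theorem remove_V : (q.remove G x).V = q.V.erase x := rfl

theorem vol_remove (hx : x ∈ q.V) (σ : List (Fin k)) :
    (q.remove G x).vol σ + (if σ <+: x.toList then 1 else 0) = q.vol σ :=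
  card_cluster_erase hx σ

theorem vol_remove_le (hx : x ∈ q.V) (σ : List (Fin k)) : (q.remove G x).vol σ ≤ q.vol σ := by
  have := vol_remove (G := G) hx σ
  omega

theorem mem_mark_remove {σ : List (Fin k)} {j : ℕ} {v : Vertex k d} :
    v ∈ (q.remove G x).mark σ j ↔ v ∈ q.mark σ j ∨
      v ∈ q.V ∧ G.Adj v x ∧ lcp v.toList x.toList = σ ∧ (nbrs G q.V σ v).card = j := by
  classical
  simp [Core.remove]

/-- A removal marks at most one vertex in every child of a cluster. -/
theorem IsSemiHypercube.exists_new_mark (hG : IsSemiHypercube G) {σ : List (Fin k)}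
    (hσ : σ.length < d) (t : Fin k) (j : ℕ) : ∃ w : Vertex k d,
      ∀ v ∈ (q.remove G x).mark σ j, σ ++ [t] <+: v.toList → v ∈ q.mark σ j ∨ v = w := by
  by_cases h : ∃ w, w ∈ (q.remove G x).mark σ j ∧ σ ++ [t] <+: w.toList ∧ w ∉ q.mark σ j
  · obtain ⟨w, hw, hwt, hwm⟩ := h
    refine ⟨w, fun v hv hvt => ?_⟩
    rw [mem_mark_remove] at hv hw
    rcases hv with hv | ⟨-, hv, hlv, -⟩
    · exact Or.inl hv
    · right
      rcases hw with hw | ⟨-, hw, hlw, -⟩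
      · exact absurd hw hwm
      · obtain ⟨a, b, hab, ha, hb⟩ := (lcp_eq_iff hσ).1 hlv
        have hat := child_prefix_unique ha hvt
        subst hat
        exact hG.nbr_unique hσ (Ne.symm hab) hb hvt hwt hv.symm hw.symm
  · push Not at h
    exact ⟨x, fun v hv hvt => Or.inl (h v hv hvt)⟩

/-- All children of `B` lie in one child of `σ`, which contains at most one new mark, and that
vertex lies in at most one child of `B`. -/
theorem IsSemiHypercube.sum_marks_remove_le (hG : IsSemiHypercube G) {σ : List (Fin k)}
    (hσ : σ.length < d) {B : List (Fin k)} {t : Fin k} (hB : σ ++ [t] <+: B) (j : ℕ)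
    (T : Finset (Fin k)) :
    ∑ i ∈ T, (q.remove G x).marks σ j (B ++ [i]) ≤ ∑ i ∈ T, q.marks σ j (B ++ [i]) + 1 := by
  obtain ⟨w, hw⟩ := hG.exists_new_mark (q := q) (x := x) hσ t j
  have h : ∀ i ∈ T, (q.remove G x).marks σ j (B ++ [i]) ≤
      q.marks σ j (B ++ [i]) + if B ++ [i] <+: w.toList then 1 else 0 := by
    intro i _
    have hBi := hB.trans (prefix_append_singleton B i)
    unfold Core.marks
    split_ifs with h
    · refine (card_le_card (t := insert w (cluster (q.mark σ j) (B ++ [i]))) ?_).trans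
        (card_insert_le _ _)
      intro v hv
      rw [mem_cluster] at hv
      rw [mem_insert, mem_cluster]
      rcases hw v hv.1 (hBi.trans hv.2) with h1 | h1
      · exact Or.inr ⟨h1, hv.2⟩
      · exact Or.inl h1
    · rw [add_zero]
      refine card_le_card fun v hv => ?_
      rw [mem_cluster] at hv ⊢
      rcases hw v hv.1 (hBi.trans hv.2) with h1 | h1
      · exact ⟨h1, hv.2⟩
      · exact absurd (h1 ▸ hv.2) h
  refine (sum_le_sum h).trans ?_
  rw [sum_add_distrib]
  exact Nat.add_le_add_left (sum_ite_child_le T B w.toList) _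

theorem IsSemiHypercube.marks_remove_le (hG : IsSemiHypercube G) {σ : List (Fin k)}
    (hσ : σ.length < d) {B : List (Fin k)} {t : Fin k} (hB : σ ++ [t] <+: B) (j : ℕ) :
    (q.remove G x).marks σ j B ≤ q.marks σ j B + 1 := by
  obtain ⟨w, hw⟩ := hG.exists_new_mark (q := q) (x := x) hσ t j
  refine (card_le_card (t := insert w (cluster (q.mark σ j) B)) ?_).trans (card_insert_le _ _)
  intro v hv
  rw [mem_cluster] at hv
  rw [mem_insert, mem_cluster]
  rcases hw v hv.1 (hB.trans hv.2) with h1 | h1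
  · exact Or.inr ⟨h1, hv.2⟩
  · exact Or.inl h1

/-- A vertex is only marked for `σ` if it and `x` lie in different children of `σ`; so a removal
outside `σ`, or in the same child as `B`, leaves the marks in `B` alone. -/
theorem marks_remove_eq {σ : List (Fin k)} (hσ : σ.length < d) {B : List (Fin k)} {t : Fin k}
    (hB : σ ++ [t] <+: B) (hx : σ <+: x.toList → σ ++ [t] <+: x.toList) (j : ℕ) :
    (q.remove G x).marks σ j B = q.marks σ j B := by
  unfold Core.marks
  congr 1
  ext v
  rw [mem_cluster, mem_cluster, mem_mark_remove]
  constructor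
  · rintro ⟨h1 | ⟨-, -, h, -⟩, h2⟩
    · exact ⟨h1, h2⟩
    · exfalso
      obtain ⟨a, b, hab, ha, hb⟩ := (lcp_eq_iff hσ).1 h
      have h3 := hx ((prefix_append_singleton σ b).trans hb)
      exact hab ((child_prefix_unique ha (hB.trans h2)).trans (child_prefix_unique h3 hb))
  · rintro ⟨h1, h2⟩
    exact ⟨Or.inl h1, h2⟩

/-- The vertex `x` is removed by descending from `P` along target children; this is a payment at
`P`, unless `P = x`, and has to be paid for at all strict prefixes of `P`. -/
structure RemovalStep (ρ : ℕ) (q : Core k d) (D D' : List (Fin k) → ℕ) (P : List (Fin k))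
    (x : Vertex k d) : Prop where
  mem : x ∈ q.V
  isPrefix : P <+: x.toList
  chain : ∀ σ, P <+: σ → σ <+: x.toList → σ.length < d → σ ++ [q.target σ] <+: x.toList
  debt_above : ∀ σ, σ <+: P → σ ≠ P → D' σ = D σ + ρ
  debt_self : P.length < d → D' P + 1 = D P
  debt_other : ∀ σ, ¬ σ <+: P → D' σ = D σ

/-- Strictly above `P`, the loss grows by at most one and the debt by `ρ`. At `P`, one payment is
made and the target shrinks by one vertex. Everywhere else the removal does not touch the children
that have not been targets, since the path below `P` follows targets. -/
theorem RemovalStep.loss_inv (hs : RemovalStep ρ q D D' P x) (h : Inv G ρ τ q D)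
    {σ : List (Fin k)} (hσ : σ.length < d) (hv : 0 < (q.remove G x).vol σ) :
    LossInv ρ (q.remove G x) (D' σ) σ := by
  obtain ⟨g, y, h1, h2, h3⟩ := h.loss_inv σ hσ (hv.trans_le (vol_remove_le hs.mem σ))
  have hvt := vol_remove (G := G) hs.mem (σ ++ [q.target σ])
  have hle := vol_remove_le (G := G) hs.mem (σ ++ [q.target σ])
  by_cases hP : σ <+: P ∧ σ ≠ P
  · refine ⟨g, y, h1, (Nat.add_le_add_left hle y).trans h2, h3.of_sum_le ?_
      (hs.debt_above σ hP.1 hP.2)⟩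
    intro T _
    simp only [remove_V, loss_erase hs.mem, sum_add_distrib]
    exact Nat.add_le_add_left (sum_ite_child_le T σ _) _
  · have hloss : ∀ i ∈ q.nontarget σ, loss (q.remove G x).V (σ ++ [i]) = loss q.V (σ ++ [i]) := by
      intro i hi
      rw [remove_V, loss_erase hs.mem, if_neg, add_zero]
      intro hix
      have hσx := (prefix_append_singleton σ i).trans hix
      have hPσ : P <+: σ := by
        rcases List.prefix_or_prefix_of_prefix hs.isPrefix hσx with h | h
        · exact h
        · by_cases e : σ = P
          · exact e ▸ List.prefix_rfl
          · exact absurd ⟨h, e⟩ hP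
      have := child_prefix_unique hix (hs.chain σ hPσ hσx hσ)
      exact h.target_notMem σ hσ (this ▸ hi)
    by_cases e : σ = P
    · subst e
      have hσx := hs.chain σ List.prefix_rfl hs.isPrefix hσ
      rw [if_pos hσx] at hvt
      have hd := hs.debt_self hσ
      refine ⟨g, y + 1, h1, ?_, h3.congr hloss (by omega)⟩
      refine le_trans (le_of_eq ?_) h2
      rw [← hvt]
      change y + 1 + (q.remove G x).vol (σ ++ [q.target σ]) = _
      ring
    · have hd := hs.debt_other σ fun h => hP ⟨h, e⟩
      exact ⟨g, y, h1, (Nat.add_le_add_left hle y).trans h2, h3.congr hloss (by rw [hd])⟩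

/-- The cases are those of the loss, for the position of the owner `σ` relative to `P`. What makes a
payment at `σ` count inside `B` is that `B` contains all remaining vertices of the target of `σ`, so
the path from `σ` enters `B` and continues to the target of `B`. -/
theorem RemovalStep.mark_inv (hG : IsSemiHypercube G) (hs : RemovalStep ρ q D D' P x)
    (h : Inv G ρ τ q D) {B σ : List (Fin k)} {j : ℕ} (hB : B.length ≤ d)
    (hm : q.minfo B = some (σ, j))
    (hD : ∀ P, σ <+: P → P <+: B → P ≠ B → D' P < (q.remove G x).vol B) :
    MarkInv ρ τ (q.remove G x) (D' σ) B σ j := by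
  obtain ⟨hσB, hne⟩ := h.owner_prefix B σ j hB hm
  have hσ : σ.length < d := by
    have h1 := hσB.length_le
    have h2 : σ.length ≠ B.length := fun h => hne (hσB.eq_of_length h)
    omega
  have hvol' : 0 < (q.remove G x).vol B := (Nat.zero_le _).trans_lt (hD σ List.prefix_rfl hσB hne)
  have hvol : 0 < q.vol B := hvol'.trans_le (vol_remove_le hs.mem B)
  have hcl := h.owner_cluster B σ j hB hm hvol
  have hvB := vol_remove (G := G) hs.mem B
  have htB : σ ++ [q.target σ] <+: B := by
    obtain ⟨b, hb⟩ := card_pos.1 hvol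
    exact prefix_child_of_strict hσB hne (mem_cluster.1 hb).2 (mem_cluster.1 (hcl ▸ hb)).2
  have hxB : σ ++ [q.target σ] <+: x.toList → B <+: x.toList := fun hx =>
    (mem_cluster.1 (hcl ▸ mem_cluster.2 ⟨hs.mem, hx⟩)).2
  -- The guard is only harder to satisfy after the removal: debts strictly above `P` grow, and if
  -- `P` lies between `σ` and `B`, then `x` lies in `B`, so the debt of `P` and the volume of `B`
  -- both drop by one.
  have hold : MarkInv ρ τ q (D σ) B σ j := by
    refine h.mark_inv B σ j hB hm fun Q hσQ hQB hQne => ?_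
    have hQ := hD Q hσQ hQB hQne
    by_cases hQP : Q <+: P
    · by_cases e : Q = P
      · subst e
        have hQd : Q.length < d := by
          have h1 := hQB.length_le
          have h2 : Q.length ≠ B.length := fun h => hQne (hQB.eq_of_length h)
          omega
        have hBx : B <+: x.toList := by
          apply hxB
          by_cases e' : σ = Q
          · subst e'
            exact hs.chain σ List.prefix_rfl hs.isPrefix hσ
          · exact (prefix_child_of_strict hσQ e' hQB htB).trans hs.isPrefix
        rw [if_pos hBx] at hvB
        have := hs.debt_self hQd
        omega
      · have := hs.debt_above Q hQP e
        omega
    · have := hs.debt_other Q hQP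
      omega
  have hvt := vol_remove (G := G) hs.mem (B ++ [q.target B])
  have hle := vol_remove_le (G := G) hs.mem (B ++ [q.target B])
  by_cases hP : σ <+: P ∧ σ ≠ P
  · have hDσ := hs.debt_above σ hP.1 hP.2
    have hstep : ∀ B', B <+: B' → (ρ : ℝ) * (q.remove G x).marks σ j B' ≤
        ρ * q.marks σ j B' + ρ := fun B' hB' => by
      have h1 : ((q.remove G x).marks σ j B' : ℝ) ≤ q.marks σ j B' + 1 := by
        exact_mod_cast hG.marks_remove_le (q := q) (x := x) hσ (htB.trans hB') j
      have := mul_le_mul_of_nonneg_left h1 (Nat.cast_nonneg (α := ℝ) ρ)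
      linarith
    refine ⟨fun hBd => ?_, fun hBd => ?_⟩
    · have h1 := hold.1 hBd
      have h2 := hstep B List.prefix_rfl
      rw [hDσ]
      push_cast
      linarith
    · obtain ⟨h0, g, y, h1, h2, h3, h4, h5⟩ := hold.2 hBd
      refine ⟨h0, g, y, (Nat.add_le_add_left hle y).trans h1, h2, h3, h4.of_sum_le
        (fun T _ => hG.sum_marks_remove_le hσ htB j T) hDσ, ?_⟩
      have h6 := hstep (B ++ [q.target B]) (prefix_append_singleton _ _)
      rw [hDσ]
      push_cast at h5 ⊢
      change (ρ : ℝ) * (q.remove G x).marks σ j (B ++ [q.target B]) ≤ _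
      linarith
  · have hxt : σ <+: x.toList → σ ++ [q.target σ] <+: x.toList := by
      intro hσx
      apply hs.chain σ _ hσx hσ
      rcases List.prefix_or_prefix_of_prefix hs.isPrefix hσx with h | h
      · exact h
      · by_cases e : σ = P
        · exact e ▸ List.prefix_rfl
        · exact absurd ⟨h, e⟩ hP
    have hmarks : ∀ B', B <+: B' → (q.remove G x).marks σ j B' = q.marks σ j B' := fun B' hB' =>
      marks_remove_eq hσ (htB.trans hB') hxt j
    by_cases e : σ = P
    · subst e
      have hBx := hxB (hxt hs.isPrefix)
      have hd := hs.debt_self hσ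
      rw [if_pos hBx] at hvB
      refine ⟨fun hBd => ?_, fun hBd => ?_⟩
      -- A leaf `B` that contains `x` is empty after the removal, which contradicts the guard.
      · exfalso
        have : q.vol B ≤ k ^ (d - B.length) := card_cluster_le _ hB
        rw [hBd] at this
        simp at this
        omega
      · obtain ⟨h0, g, y, h1, h2, h3, h4, h5⟩ := hold.2 hBd
        have hBt := hs.chain B hσB hBx hBd
        rw [if_pos hBt] at hvt
        refine ⟨h0, g, y + 1, ?_, h2, h3, h4.congr (fun i _ => hmarks _
          (prefix_append_singleton _ _)) (by omega), ?_⟩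
        · refine le_trans (le_of_eq ?_) h1
          rw [← hvt]
          change y + 1 + (q.remove G x).vol (B ++ [q.target B]) = _
          ring
        · change (ρ : ℝ) * (q.remove G x).marks σ j (B ++ [q.target B]) ≤ _
          rw [hmarks _ (prefix_append_singleton _ _)]
          have : (D' σ : ℝ) + 1 = D σ := by exact_mod_cast hd
          push_cast at h5 ⊢
          linarith
    · have hDσ := hs.debt_other σ fun h => hP ⟨h, e⟩
      rw [hDσ]
      refine ⟨fun hBd => ?_, fun hBd => ?_⟩
      · rw [hmarks B List.prefix_rfl]
        exact hold.1 hBd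
      · obtain ⟨h0, g, y, h1, h2, h3, h4, h5⟩ := hold.2 hBd
        refine ⟨h0, g, y, (Nat.add_le_add_left hle y).trans h1, h2, h3, h4.congr (fun i _ => hmarks _
          (prefix_append_singleton _ _)) rfl, ?_⟩
        change (ρ : ℝ) * (q.remove G x).marks σ j (B ++ [q.target B]) ≤ _
        rw [hmarks _ (prefix_append_singleton _ _)]
        exact h5

theorem Inv.remove (hG : IsSemiHypercube G) (h : Inv G ρ τ q D)
    (hs : RemovalStep ρ q D D' P x) : Inv G ρ τ (q.remove G x) D' where
  target_notMem := h.target_notMem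
  abandoned σ hσ i hi hit :=
    Nat.eq_zero_of_le_zero ((vol_remove_le hs.mem _).trans_eq (h.abandoned σ hσ i hi hit))
  minfo_target := h.minfo_target
  owner_prefix := h.owner_prefix
  owner_cluster B σ j hB hm hv := by
    have := h.owner_cluster B σ j hB hm (hv.trans_le (vol_remove_le hs.mem B))
    change cluster (q.V.erase x) (σ ++ [q.target σ]) = cluster (q.V.erase x) B
    rw [cluster_erase, cluster_erase, this]
  mem_mark σ hσ v hv j hj hlt := by
    rw [mem_mark_remove]
    rw [remove_V, cluster_erase, mem_erase] at hv
    by_cases hold : (nbrs G q.V σ v).card < j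
    · exact Or.inl (h.mem_mark σ hσ v hv.2 j hj hold)
    -- A removal lowers a degree by at most one, so a degree that falls below `j` was exactly `j`;
    -- this is the degree for which `Core.remove` adds the mark.
    · right
      have hsub : (nbrs G q.V σ v).erase x ⊆ nbrs G (q.V.erase x) σ v := by
        intro u hu
        rw [mem_erase, mem_nbrs] at hu
        rw [mem_nbrs, mem_erase]
        exact ⟨⟨hu.1, hu.2.1⟩, hu.2.2⟩
      have hc := card_le_card hsub
      have hxn : x ∈ nbrs G q.V σ v := by
        by_contra hx
        rw [erase_eq_of_notMem hx] at hc
        rw [remove_V] at hlt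
        omega
      rw [card_erase_of_mem hxn] at hc
      rw [remove_V] at hlt
      rw [mem_nbrs] at hxn
      exact ⟨(mem_cluster.1 hv.2).1, hxn.2.1, hxn.2.2, by omega⟩
  nbrs_of_mark σ hσ j v hv := by
    rw [mem_mark_remove] at hv
    rw [remove_V]
    rcases hv with hv | ⟨-, h1, h2, h3⟩
    · exact (card_le_card (nbrs_mono (erase_subset _ _) σ v)).trans_lt (h.nbrs_of_mark σ hσ j v hv)
    · rw [← h3]
      apply card_lt_card
      rw [ssubset_iff_of_subset (nbrs_mono (erase_subset _ _) σ v)]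
      refine ⟨x, mem_nbrs.2 ⟨hs.mem, h1, h2⟩, fun hx => ?_⟩
      rw [mem_nbrs] at hx
      simp at hx
  loss_inv σ hσ hv := hs.loss_inv h hσ hv
  mark_inv B σ j hB hm hD := hs.mark_inv hG h hB hm hD

end Remove

end SemiHypercube

/-! ### Parameters, loss bounds and marks of new targets. -/

namespace SemiHypercube

open Finset

variable {k d : ℕ} {G : SimpleGraph (Vertex k d)} {ρ : ℕ} {τ : ℝ} {q : Core k d}
  {D : List (Fin k) → ℕ}

/-- The assumptions on the parameters of the algorithm. -/
structure Params (k d ρ : ℕ) (τ : ℝ) : Prop where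
  d_pos : 0 < d
  k_ge : 16 * d ≤ k
  τ_pos : 0 < τ
  τ_le : τ * (4350 * d) ≤ 1
  ρ_ge : 2 * harm k * (2 * d + 1) ≤ ρ * τ

namespace Params

theorem k_pos (hp : Params k d ρ τ) : 0 < k := by
  have := hp.d_pos
  have := hp.k_ge
  omega

theorem one_le_harm (hp : Params k d ρ τ) : 1 ≤ harm k := SemiHypercube.one_le_harm hp.k_pos

theorem one_le_d (hp : Params k d ρ τ) : (1 : ℝ) ≤ d := by exact_mod_cast hp.d_pos

theorem sixteen_le (hp : Params k d ρ τ) : 16 * (d : ℝ) ≤ k := by exact_mod_cast hp.k_ge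

theorem τ_le' (hp : Params k d ρ τ) : τ * 4350 ≤ 1 := by
  have := hp.one_le_d
  have := hp.τ_le
  have := hp.τ_pos
  nlinarith

theorem ρ_pos (hp : Params k d ρ τ) : (0 : ℝ) < ρ := by
  have h1 := hp.ρ_ge
  have h2 := hp.one_le_harm
  have h3 := hp.one_le_d
  have h4 := hp.τ_pos
  by_contra h
  have h5 : (ρ : ℝ) * τ ≤ 0 := mul_nonpos_of_nonpos_of_nonneg (not_lt.1 h) h4.le
  nlinarith

theorem two_harm_le (hp : Params k d ρ τ) : 2 * harm k ≤ ρ * τ := by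
  have h1 := hp.ρ_ge
  have h2 := hp.one_le_harm
  have h3 := hp.one_le_d
  nlinarith

end Params

/-- The recursion for one inheritance: the factor comes from having only about `k * d / (d + 1)`
choices by marks, the summand from the marks added during the game. -/
theorem markDensity_succ {d : ℕ} (n : ℕ) :
    markDensity d (n + 1) = markDensity d n * (1 + 1 / (d : ℝ)) + 1 / (d : ℝ) := by
  unfold markDensity
  rw [pow_succ]
  ring

theorem markDensity_pos (d n : ℕ) : 0 < markDensity d n := by
  unfold markDensity
  have : (1 : ℝ) ≤ (1 + 1 / (d : ℝ)) ^ n := one_le_pow₀ (by simp)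
  linarith

theorem markDensity_le {d n : ℕ} (hd : 0 < d) (h : n ≤ d) : markDensity d n ≤ 30 := by
  unfold markDensity
  have hd' : (d : ℝ) ≠ 0 := by exact_mod_cast hd.ne'
  have h1 : (1 + 1 / (d : ℝ)) ^ n ≤ (1 + 1 / (d : ℝ)) ^ d := pow_le_pow_right₀ (by simp) h
  -- The density is thus at most `11 e - 1 < 30`.
  have h2 : (1 + 1 / (d : ℝ)) ^ d ≤ Real.exp 1 := by
    have h3 : (1 + 1 / (d : ℝ)) ≤ Real.exp (1 / d) := by
      have := Real.add_one_le_exp (1 / (d : ℝ))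
      linarith
    refine (pow_le_pow_left₀ (by positivity) h3 d).trans_eq ?_
    rw [← Real.exp_nat_mul, mul_one_div_cancel hd']
  have := Real.exp_one_lt_d9
  linarith

theorem threshold_le (m : ℕ) : threshold m ≤ m := by
  unfold threshold
  rw [Nat.ceil_le]
  have : (0 : ℚ) ≤ m := Nat.cast_nonneg m
  linarith

theorem le_threshold (m : ℕ) : (19 / 20 : ℝ) * m ≤ threshold m := by
  have h : (19 / 20 : ℚ) * m ≤ threshold m := Nat.le_ceil _
  have h' : (((19 / 20 : ℚ) * m : ℚ) : ℝ) ≤ ((threshold m : ℚ) : ℝ) := by exact_mod_cast h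
  push_cast at h'
  linarith

/-- A vertex with degree below the threshold has lost at least a twentieth of its `m` neighbours.
The truncated subtraction is harmless by `threshold_le`. -/
theorem le_mul_sub_threshold (m : ℕ) : m ≤ 20 * (m + 1 - threshold m) := by
  have h : (threshold m : ℚ) < (19 / 20 : ℚ) * m + 1 := Nat.ceil_lt_add_one (by positivity)
  have h2 := threshold_le m
  have h3 : (20 * threshold m : ℕ) < (19 * m + 20 : ℕ) := by
    have : (20 : ℚ) * threshold m < 19 * m + 20 := by linarith
    exact_mod_cast this
  omega

theorem LossInv.payments_le {N : ℕ} {σ : List (Fin k)} {n y c : ℕ}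
    (h : y + q.vol (σ ++ [q.target σ]) ≤
      ((2 * d + 1 - n % (2 * d + 1)) % (2 * d + 1) + 1) * c) (hN : N = (2 * d + 1) * c) :
    (y : ℝ) ≤ (N : ℝ) := by
  have h1 : (2 * d + 1 - n % (2 * d + 1)) % (2 * d + 1) + 1 ≤ 2 * d + 1 :=
    Nat.succ_le_of_lt (Nat.mod_lt _ (by omega))
  have h2 := Nat.mul_le_mul_right c h1
  subst hN
  exact_mod_cast (by omega : y ≤ (2 * d + 1) * c)

/-- A child that has not been a target is almost complete. -/
theorem Inv.loss_le (hp : Params k d ρ τ) (h : Inv G ρ τ q D) {σ : List (Fin k)}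
    (hσ : σ.length < d) (hv : 0 < q.vol σ) {i : Fin k} (hi : i ∈ q.nontarget σ)
    (hD : D σ ≤ k ^ (d - (σ.length + 1))) :
    (loss q.V (σ ++ [i]) : ℝ) ≤ τ * ((k ^ (d - (σ.length + 1)) : ℕ) : ℝ) := by
  obtain ⟨g, y, h1, h2, h3⟩ := h.loss_inv σ hσ hv
  have hy := LossInv.payments_le h2 rfl
  have h4 := h3.single hi (N := k) (Nat.cast_nonneg _) (by omega)
  set c := k ^ (d - (σ.length + 1))
  have hc : (0 : ℝ) ≤ c := Nat.cast_nonneg _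
  have hD' : (D σ : ℝ) ≤ c := by exact_mod_cast hD
  have h5 := mul_le_mul_of_nonneg_right hp.ρ_ge hc
  have h6 := hp.one_le_harm
  have h7 := hp.one_le_d
  -- The payments `y` cancel against the `- 1` in `CupBound.single`, and the debt, at most `c`, is
  -- bounded by a second copy of `harm k * (2d+1) * c`. This is why `ρ` has the factor 2.
  have h8 : (c : ℝ) ≤ harm k * (2 * d + 1) * c := by
    have : (1 : ℝ) ≤ harm k * (2 * d + 1) := by nlinarith
    nlinarith
  push_cast at h4 hy
  refine le_of_mul_le_mul_left ?_ hp.ρ_pos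
  rw [zero_div] at h4
  nlinarith

theorem vol_child_le {σ : List (Fin k)} (hσ : σ.length < d) (i : Fin k) :
    q.vol (σ ++ [i]) ≤ k ^ (d - (σ.length + 1)) := by
  have := card_cluster_le q.V (σ := σ ++ [i]) (by simpa using hσ)
  rwa [List.length_append, List.length_singleton] at this

/-- Used with `n + 1` and `n` as the values of `|S_σ|` before and after a choice not made by size:
the count of targets since the last choice by size goes up by one. -/
theorem sub_mod_mod_eq {r n : ℕ} (hr : 1 < r) (hn : (n + 1) % r ≠ 1) :
    (r - n % r) % r = (r - (n + 1) % r) % r + 1 := by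
  have hlt := Nat.mod_lt n (show 0 < r by omega)
  have e : (n + 1) % r = (n % r + 1) % r := by rw [Nat.mod_add_mod]
  rw [e] at hn ⊢
  generalize n % r = m at *
  rcases eq_or_ne m 0 with rfl | h0
  · exact absurd (Nat.mod_eq_of_lt hr) hn
  · rw [Nat.mod_eq_of_lt (show r - m < r by omega)]
    rcases eq_or_ne (m + 1) r with h1 | h1
    · rw [h1, Nat.mod_self, Nat.sub_zero, Nat.mod_self]
      omega
    · rw [Nat.mod_eq_of_lt (show m + 1 < r by omega), Nat.mod_eq_of_lt (by omega)]
      omega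

theorem vol_le_of_abandoned {B : List (Fin k)} (hB : B.length < d) (U : Finset (Fin k))
    (hU : ∀ i, i ∉ U → q.vol (B ++ [i]) = 0) :
    q.vol B ≤ U.card * k ^ (d - (B.length + 1)) := by
  unfold Core.vol at hU ⊢
  rw [card_cluster_eq_sum _ hB, ← sum_subset (subset_univ U) fun i _ hi => hU i hi,
    ← smul_eq_mul]
  refine sum_le_card_nsmul _ _ _ fun i _ => ?_
  have := card_cluster_le q.V (σ := B ++ [i]) (by simpa using hB)
  simpa using this

/-- The game inside `B` starts when `B` receives its parameters. Some children of `B` may have been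
abandoned by then, but `B` has lost only a fraction `τ`, so almost all of its children are still
available. -/
theorem MarkInv.start (hp : Params k d ρ τ) {B σ : List (Fin k)} {j N : ℕ} (hB : B.length ≤ d)
    (ht : B.length < d → q.target B ∉ q.nontarget B)
    (hab : B.length < d → ∀ i, i ∉ q.nontarget B → i ≠ q.target B → q.vol (B ++ [i]) = 0)
    (hloss : (loss q.V B : ℝ) ≤ τ * ((k ^ (d - B.length) : ℕ) : ℝ))
    (hm : (ρ : ℝ) * q.marks σ j B ≤ ρ * markInit k d τ B σ + N) :
    MarkInv ρ τ q N B σ j := by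
  refine ⟨fun _ => hm, fun hBd => ?_⟩
  have hcard : (q.nontarget B).card + 1 ≤ k := by
    have := card_le_univ (insert (q.target B) (q.nontarget B))
    rwa [card_insert_of_notMem (ht hBd), Fintype.card_fin] at this
  have hv1 : q.vol B ≤ ((q.nontarget B).card + 1) * k ^ (d - (B.length + 1)) := by
    rw [← card_insert_of_notMem (ht hBd)]
    refine vol_le_of_abandoned hBd _ fun i hi => ?_
    rw [mem_insert, not_or] at hi
    exact hab hBd i hi.2 hi.1
  have hv2 := loss_add_card q.V hB
  have hkc : k ^ (d - B.length) = k * k ^ (d - (B.length + 1)) := by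
    rw [← pow_succ']
    congr 1
    omega
  have hτ := hp.τ_pos
  have hτ2 := hp.τ_le
  have hd1 := hp.one_le_d
  have hk16 := hp.sixteen_le
  -- All remaining vertices lie in the target and in the children indexed by `S_B`, and there must
  -- be at least `(1 - τ) k` such children to hold them.
  have hs : (1 - τ) * k ≤ (q.nontarget B).card + 1 := by
    have hc0 : 0 < k ^ (d - (B.length + 1)) := pow_pos hp.k_pos _
    rw [hkc] at hloss hv2
    set c := k ^ (d - (B.length + 1))
    have hc1 : (0 : ℝ) < c := by exact_mod_cast hc0
    have h1 : (loss q.V B : ℝ) + q.vol B = k * c := by exact_mod_cast hv2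
    have h2 : (q.vol B : ℝ) ≤ ((q.nontarget B).card + 1) * c := by exact_mod_cast hv1
    refine le_of_mul_le_mul_right ?_ hc1
    push_cast at hloss
    linarith
  have hτk : τ * d * k * 4350 ≤ k := by nlinarith
  have hmax : max 0 1 = 1 := rfl
  refine ⟨fun h0 => ?_, 0, 0, ?_, ?_, by omega, CupBound.init ?_, ?_⟩
  · exfalso
    rw [h0, card_empty] at hs
    have := hp.τ_le'
    push_cast at hs
    nlinarith
  · have h1 := vol_child_le (q := q) hBd (q.target B)
    have h2 : 1 ≤ (if (q.nontarget B).card % (2 * d + 1) = 0 then 2 else 1) := by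
      split_ifs <;> simp
    nlinarith
  -- All but about a fraction `1 / (2d+1)` of the choices are made by marks. The gap between `2d /
  -- (2d+1)` and `d / (d+1)` pays for the children already abandoned and for rounding, given `16 d ≤
  -- k` and the bound for `τ`.
  · set s := (q.nontarget B).card
    have h1 : (((s + 2 * d) / (2 * d + 1) : ℕ) : ℝ) ≤ ((s + 2 * d : ℕ) : ℝ) / ((2 * d + 1 : ℕ) : ℝ) :=
      Nat.cast_div_le
    push_cast at h1 ⊢
    refine (add_le_add_right h1 _).trans ?_
    have hd0 : (0 : ℝ) < d := by linarith
    rw [div_add_div _ _ (by positivity) (by positivity), div_le_iff₀ (by positivity)]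
    have h3 : (1 - τ) * k * (2 * d * (d + 1)) ≤ ((s : ℝ) + 1) * (2 * d * (d + 1)) :=
      mul_le_mul_of_nonneg_right hs (by positivity)
    have h4 : τ * d * k * 4350 * (d + 1) ≤ k * (d + 1) :=
      mul_le_mul_of_nonneg_right hτk (by positivity)
    have h5 : (k : ℝ) * 1 ≤ k * d := mul_le_mul_of_nonneg_left hd1 (Nat.cast_nonneg k)
    have h6 : 16 * (d : ℝ) * d ≤ k * d := mul_le_mul_of_nonneg_right hk16 hd0.le
    have h7 : (d : ℝ) * 1 ≤ d * d := mul_le_mul_of_nonneg_left hd1 hd0.le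
    nlinarith
  · have h1 : ∑ i ∈ q.nontarget B, q.marks σ j (B ++ [i]) ≤ q.marks σ j B := by
      unfold Core.marks
      rw [card_cluster_eq_sum _ hBd]
      exact sum_le_sum_of_subset (subset_univ _)
    have h2 : ((∑ i ∈ q.nontarget B, q.marks σ j (B ++ [i]) : ℕ) : ℝ) ≤ q.marks σ j B := by
      exact_mod_cast h1
    exact (mul_le_mul_of_nonneg_left h2 hp.ρ_pos.le).trans hm
  · have h2 : (q.marks σ j (B ++ [q.target B]) : ℝ) ≤ q.marks σ j B := by
      exact_mod_cast card_le_card (cluster_subset_of_prefix _ (prefix_append_singleton _ _))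
    have h3 := (mul_le_mul_of_nonneg_left h2 hp.ρ_pos.le).trans hm
    have h4 := hp.one_le_harm
    have h5 : (0 : ℝ) ≤ ((2 * k ^ (d - (B.length + 1)) : ℕ) : ℝ) * harm k :=
      mul_nonneg (Nat.cast_nonneg _) (by linarith)
    rw [hmax]
    simp only [Nat.cast_one, div_one, Nat.cast_zero, add_zero]
    linarith

/-- The vertices that are marked when a new target child is chosen. -/
theorem Inv.marks_new_target (hG : IsSemiHypercube G) (hp : Params k d ρ τ) (h : Inv G ρ τ q D)
    {σ : List (Fin k)} (hσ : σ.length < d) (hv : 0 < q.vol σ) {i : Fin k}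
    (hi : i ∈ q.nontarget σ) (hc : (q.nontarget σ).card ≠ 1) :
    (ρ : ℝ) * q.marks σ (threshold ((q.nontarget σ).card - 1)) (σ ++ [i]) ≤
      ρ * markInit k d τ (σ ++ [i]) σ + D σ := by
  obtain ⟨g, y, h1, h2, h3⟩ := h.loss_inv σ hσ hv
  have hy := LossInv.payments_le h2 rfl
  have hcard := card_erase_add_one hi
  set m := (q.nontarget σ).card - 1
  have hm : ((q.nontarget σ).erase i).card = m := by omega
  have hm0 : 0 < m := by
    have := card_pos.2 ⟨i, hi⟩
    omega
  have h4 := h3.total (T := (q.nontarget σ).erase i) (erase_subset _ _) (Nat.cast_nonneg _) hy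
    (N := k) (by omega) (by omega)
  have h5 := hG.card_mul_le_loss hσ (notMem_erase i (q.nontarget σ))
    (h.nbrs_of_mark σ hσ (threshold m))
  have h6 := le_mul_sub_threshold m
  have h7 := threshold_le m
  rw [hm] at h4 h5
  -- The parameters are new and have not been inherited, so the density is `markDensity d 0 = 10`.
  have hI : markInit k d τ (σ ++ [i]) σ = 10 * τ * ((k ^ (d - (σ.length + 1)) : ℕ) : ℝ) := by
    simp only [markInit, markDensity, List.length_append, List.length_singleton, Nat.sub_self,
      pow_zero]
    norm_num
  rw [hI]
  change (ρ : ℝ) * q.marks σ (threshold m) (σ ++ [i]) ≤ _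
  have hh := hp.one_le_harm
  have hd := hp.one_le_d
  have hρ := hp.ρ_ge
  set c := k ^ (d - (σ.length + 1))
  set M := q.marks σ (threshold m) (σ ++ [i])
  set f := m + 1 - threshold m
  set Λ := ∑ i ∈ (q.nontarget σ).erase i, loss q.V (σ ++ [i])
  have h5' : (M : ℝ) * f ≤ (Λ : ℝ) := by exact_mod_cast h5
  have h6' : (m : ℝ) ≤ 20 * f := by exact_mod_cast h6
  have hf1 : (1 : ℝ) ≤ f := by
    have : 1 ≤ f := by omega
    exact_mod_cast this
  have hc0 : (0 : ℝ) ≤ c := Nat.cast_nonneg _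
  have hD0 : (0 : ℝ) ≤ D σ := Nat.cast_nonneg _
  set E : ℝ := (2 * d + 1) * c * harm k
  have hE : 0 ≤ E := by positivity
  have h8 : (ρ : ℝ) * M * f ≤ m * E + D σ := by
    have := mul_le_mul_of_nonneg_left h5' hp.ρ_pos.le
    have e : ((2 * d + 1) * c : ℕ) * ((m : ℝ) * harm k) = m * E := by
      push_cast
      ring
    rw [mul_zero, zero_add, e] at h4
    linarith
  -- The number `M` of marks is at most 20 times the average loss of the siblings; the debt is
  -- simply multiplied by `f ≥ 1`.
  have h9 : (ρ : ℝ) * M * f ≤ (20 * E + D σ) * f := by nlinarith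
  have h10 := le_of_mul_le_mul_right h9 (by linarith)
  have h11 := mul_le_mul_of_nonneg_right hρ hc0
  have h12 : 20 * E ≤ ρ * (10 * τ * c) := by
    simp only [E]
    linarith
  linarith

/-- A round of the loop of `retarget` chooses the best child. -/
structure ChooseStep (q : Core k d) (σ : List (Fin k)) (i : Fin k) : Prop where
  length_lt : σ.length < d
  empty : q.vol (σ ++ [q.target σ]) = 0
  mem : i ∈ q.nontarget σ
  size_le : (q.nontarget σ).card % (2 * d + 1) = 1 → ∀ i' ∈ q.nontarget σ,
    q.vol (σ ++ [i]) ≤ q.vol (σ ++ [i'])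
  marks_le : (q.nontarget σ).card % (2 * d + 1) ≠ 1 → ∀ σ' j, q.minfo σ = some (σ', j) →
    ∀ i' ∈ q.nontarget σ, q.marks σ' j (σ ++ [i']) ≤ q.marks σ' j (σ ++ [i])

/-! ### Choices of new targets preserve the invariant. -/

section Choose

variable {σ : List (Fin k)} {i : Fin k}

theorem choose_target_self : (q.choose σ i).target σ = i := by simp [Core.choose]

theorem choose_target_ne {B : List (Fin k)} (h : B ≠ σ) : (q.choose σ i).target B = q.target B := by
  simp [Core.choose, Function.update_of_ne h]

theorem choose_nontarget_self : (q.choose σ i).nontarget σ = (q.nontarget σ).erase i := by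
  simp [Core.choose]

theorem choose_nontarget_ne {B : List (Fin k)} (h : B ≠ σ) :
    (q.choose σ i).nontarget B = q.nontarget B := by
  simp [Core.choose, Function.update_of_ne h]

theorem choose_minfo_self : (q.choose σ i).minfo (σ ++ [i]) =
    if (q.nontarget σ).card = 1 then q.minfo σ
      else some (σ, threshold ((q.nontarget σ).card - 1)) := by
  simp [Core.choose]

theorem choose_minfo_ne {B : List (Fin k)} (h : B ≠ σ ++ [i]) :
    (q.choose σ i).minfo B = q.minfo B := by
  simp [Core.choose, Function.update_of_ne h]

theorem choose_vol (B : List (Fin k)) : (q.choose σ i).vol B = q.vol B := rfl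

theorem choose_marks (B σ' : List (Fin k)) (j : ℕ) :
    (q.choose σ i).marks σ' j B = q.marks σ' j B := rfl

theorem ne_append_singleton (σ : List (Fin k)) (i : Fin k) : σ ≠ σ ++ [i] := fun h => by
  have := congrArg List.length h
  simp at this

/-- A choice by size takes out the child with the largest loss and ends the round. Any other choice
only discards a cup, and the new target adds one full cluster to the payments allowed in the round.
-/
theorem ChooseStep.lossInv (hp : Params k d ρ τ) (hs : ChooseStep q σ i) {N : ℕ}
    (h : LossInv ρ q N σ) : LossInv ρ (q.choose σ i) N σ := by
  obtain ⟨g, y, h1, h2, h3⟩ := h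
  have hcard := card_erase_add_one hs.mem
  have hd := hp.d_pos
  have hvi : q.vol (σ ++ [i]) ≤ k ^ (d - (σ.length + 1)) :=
    vol_child_le hs.length_lt i
  have hy := LossInv.payments_le h2 rfl
  unfold LossInv
  rw [choose_target_self, choose_nontarget_self, choose_vol]
  by_cases hc : (q.nontarget σ).card % (2 * d + 1) = 1
  · refine ⟨g + 1, 0, by omega, ?_, h3.greedy hs.mem (fun i' hi' => ?_) hy⟩
    · have e : ((q.nontarget σ).erase i).card % (2 * d + 1) = 0 := by
        have : ((q.nontarget σ).erase i).card = (q.nontarget σ).card - 1 := by omega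
        rw [this]
        exact (Nat.modEq_iff_dvd' (by have := card_pos.2 ⟨i, hs.mem⟩; omega)).1
          (by rw [Nat.ModEq, hc]; exact Nat.mod_eq_of_lt (by omega)) |> Nat.mod_eq_zero_of_dvd
      rw [e]
      simpa using hvi
    · have h5 := hs.size_le hc i' hi'
      have h6 := loss_add_card q.V (σ := σ ++ [i]) (by simpa using hs.length_lt)
      have h7 := loss_add_card q.V (σ := σ ++ [i']) (by simpa using hs.length_lt)
      simp only [List.length_append, List.length_singleton] at h6 h7
      change loss q.V (σ ++ [i']) ≤ loss q.V (σ ++ [i])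
      unfold Core.vol at h5
      omega
  · refine ⟨g, y, by omega, ?_, h3.subset (erase_subset _ _)⟩
    rw [← hcard] at hc h2
    rw [sub_mod_mod_eq (by omega) hc]
    rw [hs.empty] at h2
    linarith

/-- Here the roles are reversed: a choice by marks is the greedy step, and a choice by size discards
a cup and prolongs the round by one more target. In both cases `CupBound.single`, applied before the
choice, bounds the marks of the new target. -/
theorem ChooseStep.markInv (hp : Params k d ρ τ) (hs : ChooseStep q σ i) {σ' : List (Fin k)}
    {j N : ℕ} (hm : q.minfo σ = some (σ', j)) (h : MarkInv ρ τ q N σ σ' j) :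
    MarkInv ρ τ (q.choose σ i) N σ σ' j := by
  have hσ := hs.length_lt
  refine ⟨fun hd => absurd hd hσ.ne, fun _ => ?_⟩
  obtain ⟨-, g, y, h1, h2, h3, h4, -⟩ := h.2 hσ
  have hcard := card_erase_add_one hs.mem
  have hd := hp.d_pos
  have hvi : q.vol (σ ++ [i]) ≤ k ^ (d - (σ.length + 1)) :=
    vol_child_le hs.length_lt i
  rw [choose_target_self, choose_nontarget_self, choose_vol, choose_minfo_self,
    choose_minfo_ne (ne_append_singleton σ i)]
  refine ⟨fun he => ?_, ?_⟩
  · rw [he, card_empty] at hcard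
    rw [if_pos hcard.symm]
  have hI : (0 : ℝ) ≤ ρ * markInit k d τ σ σ' :=
    mul_nonneg (Nat.cast_nonneg _) (mul_nonneg (mul_nonneg (markDensity_pos _ _).le hp.τ_pos.le)
      (Nat.cast_nonneg _))
  have hsingle := h4.single hs.mem (N := k) (Nat.cast_nonneg _)
    (by have := card_pos.2 ⟨i, hs.mem⟩; omega)
  have hy2 : y ≤ 2 * k ^ (d - (σ.length + 1)) := by
    split_ifs at h1 <;> omega
  have hy2' : (y : ℝ) ≤ ((2 * k ^ (d - (σ.length + 1)) : ℕ) : ℝ) := by exact_mod_cast hy2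
  by_cases hc : (q.nontarget σ).card % (2 * d + 1) = 1
  · have e : ((q.nontarget σ).erase i).card % (2 * d + 1) = 0 := by
      have : ((q.nontarget σ).erase i).card = (q.nontarget σ).card - 1 := by omega
      rw [this]
      exact (Nat.modEq_iff_dvd' (by have := card_pos.2 ⟨i, hs.mem⟩; omega)).1
        (by rw [Nat.ModEq, hc]; exact Nat.mod_eq_of_lt (by omega)) |> Nat.mod_eq_zero_of_dvd
    have hdiv : ((q.nontarget σ).card + 2 * d) / (2 * d + 1) =
        (((q.nontarget σ).erase i).card + 2 * d) / (2 * d + 1) + 1 := by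
      rw [← hcard, show ((q.nontarget σ).erase i).card + 1 + 2 * d =
        ((q.nontarget σ).erase i).card + (2 * d + 1) by ring, Nat.add_div_right _ (by omega)]
      obtain ⟨b, hb⟩ := Nat.dvd_of_mod_eq_zero e
      rw [hb, Nat.mul_add_div (by omega), Nat.mul_div_cancel_left _ (by omega),
        Nat.div_eq_of_lt (by omega)]
    refine ⟨g, y, ?_, ?_, by omega, h4.subset (erase_subset _ _), ?_⟩
    · rw [hs.empty, hc] at h1
      rw [e]
      simp only [one_ne_zero, if_false, if_true] at h1 ⊢
      omega
    · rw [hdiv, ← hcard] at h2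
      push_cast at h2 ⊢
      linarith
    · rw [choose_marks]
      refine hsingle.trans ?_
      have h5 : ρ * markInit k d τ σ σ' / ((g + 1 : ℕ) : ℝ) ≤
          ρ * markInit k d τ σ σ' / ((max g 1 : ℕ) : ℝ) := by
        apply div_le_div_of_nonneg_left hI
        · exact_mod_cast (by omega : 0 < max g 1)
        · exact_mod_cast (by omega : max g 1 ≤ g + 1)
      have h6 : (0 : ℝ) ≤ ((2 * k ^ (d - (σ.length + 1)) : ℕ) : ℝ) := Nat.cast_nonneg _
      linarith
  · have e : ((q.nontarget σ).erase i).card % (2 * d + 1) ≠ 0 := fun e => by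
      rw [← hcard, Nat.add_mod, e, zero_add, Nat.mod_mod] at hc
      exact hc (Nat.mod_eq_of_lt (by omega))
    have hdiv : ((q.nontarget σ).card + 2 * d) / (2 * d + 1) =
        (((q.nontarget σ).erase i).card + 2 * d) / (2 * d + 1) := by
      rw [← hcard]
      set n := ((q.nontarget σ).erase i).card
      rw [show n + 1 + 2 * d = n + 2 * d + 1 by ring, Nat.succ_div, if_neg, add_zero]
      intro hdvd
      apply e
      apply Nat.mod_eq_zero_of_dvd
      rwa [show n + 2 * d + 1 = n + (2 * d + 1) by ring, Nat.dvd_add_self_right] at hdvd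
    refine ⟨g + 1, 0, ?_, ?_, by omega, h4.greedy hs.mem (hs.marks_le hc σ' j hm) hy2', ?_⟩
    · rw [if_neg e]
      omega
    · rw [hdiv] at h2
      refine h2.trans ?_
      rw [show g + 1 + ((q.nontarget σ).erase i).card + 1 = g + (q.nontarget σ).card + 1 by omega]
    · rw [choose_marks, show max (g + 1) 1 = g + 1 by omega]
      refine hsingle.trans ?_
      push_cast at hy2' ⊢
      linarith

theorem Inv.choose (hG : IsSemiHypercube G) (hp : Params k d ρ τ) (h : Inv G ρ τ q D)
    (hs : ChooseStep q σ i) : Inv G ρ τ (q.choose σ i) D := by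
  have hσ := hs.length_lt
  have hlen : (σ ++ [i]).length ≤ d := by simpa using hσ
  have hcard := card_erase_add_one hs.mem
  -- If `i` is the last child, all remaining vertices of `σ` lie in it, so it can take over the
  -- parameters of `σ`.
  have hempty : (q.nontarget σ).card = 1 → ∀ a, a ≠ i → q.vol (σ ++ [a]) = 0 := by
    intro hc a ha
    obtain ⟨b, hb⟩ := card_eq_one.1 hc
    have hib : i = b := by simpa [hb] using hs.mem
    by_cases hat : a = q.target σ
    · exact hat ▸ hs.empty
    · exact h.abandoned σ hσ a (by rw [hb, ← hib]; simpa using ha) hat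
  have hself : (q.nontarget σ).card = 1 → cluster q.V σ = cluster q.V (σ ++ [i]) := fun hc =>
    cluster_eq_self_child hσ fun a ha => card_eq_zero.1 (hempty hc a ha)
  have hprefix : ∀ B σ' j, B.length ≤ d → (q.choose σ i).minfo B = some (σ', j) →
      σ' <+: B ∧ σ' ≠ B := by
    intro B σ' j hB hm
    by_cases hBi : B = σ ++ [i]
    · subst hBi
      rw [choose_minfo_self] at hm
      split_ifs at hm with hc
      · have h1 := (h.owner_prefix σ σ' j hσ.le hm).1
        refine ⟨h1.trans (prefix_append_singleton _ _), fun e => ?_⟩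
        have := h1.length_le
        rw [e] at this
        simp at this
      · simp only [Option.some.injEq, Prod.mk.injEq] at hm
        rw [← hm.1]
        exact ⟨prefix_append_singleton _ _, ne_append_singleton _ _⟩
    · rw [choose_minfo_ne hBi] at hm
      exact h.owner_prefix B σ' j hB hm
  refine ⟨?_, ?_, ?_, hprefix, ?_, h.mem_mark, h.nbrs_of_mark, ?_, ?_⟩
  · intro B hB
    by_cases hBσ : B = σ
    · subst hBσ
      rw [choose_target_self, choose_nontarget_self]
      simp
    · rw [choose_target_ne hBσ, choose_nontarget_ne hBσ]
      exact h.target_notMem B hB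
  · intro B hB a ha hat
    by_cases hBσ : B = σ
    · subst hBσ
      rw [choose_target_self] at hat
      rw [choose_nontarget_self, mem_erase, not_and] at ha
      by_cases hat' : a = q.target B
      · rw [hat']
        exact hs.empty
      · exact h.abandoned B hB a (ha hat) hat'
    · rw [choose_target_ne hBσ] at hat
      rw [choose_nontarget_ne hBσ] at ha
      exact h.abandoned B hB a ha hat
  · intro B hB hne
    by_cases hBσ : B = σ
    · subst hBσ
      rw [choose_nontarget_self] at hne ⊢
      rw [choose_target_self, choose_minfo_self, if_neg, ← hcard]
      · simp
      · intro hc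
        rw [hc] at hcard
        exact hne (card_eq_zero.1 (by omega))
    · rw [choose_nontarget_ne hBσ] at hne ⊢
      rw [choose_target_ne hBσ, choose_minfo_ne]
      · exact h.minfo_target B hB hne
      · intro e
        exact hBσ (List.append_inj_left' e rfl)
  · intro B σ' j hB hm hv
    rw [choose_vol] at hv
    change cluster q.V (σ' ++ [(q.choose σ i).target σ']) = cluster q.V B
    by_cases hBi : B = σ ++ [i]
    · subst hBi
      rw [choose_minfo_self] at hm
      split_ifs at hm with hc
      · have hne := (h.owner_prefix σ σ' j hσ.le hm).2
        rw [choose_target_ne hne, ← hself hc]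
        apply h.owner_cluster σ σ' j hσ.le hm
        unfold Core.vol at hv ⊢
        rwa [hself hc]
      · simp only [Option.some.injEq, Prod.mk.injEq] at hm
        rw [← hm.1, choose_target_self]
    · rw [choose_minfo_ne hBi] at hm
      have h1 := h.owner_cluster B σ' j hB hm hv
      by_cases hσ' : σ' = σ
      · subst hσ'
        -- A nonempty cluster owned by `σ` would be all that remains of the old target, which is
        -- empty. So outdated parameters only survive at empty clusters.
        exfalso
        have := hs.empty
        unfold Core.vol at this hv
        rw [h1] at this
        omega
      · rw [choose_target_ne hσ']
        exact h1
  · intro B hB hv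
    by_cases hBσ : B = σ
    · subst hBσ
      exact hs.lossInv hp (h.loss_inv B hB hv)
    · have h1 := h.loss_inv B hB hv
      unfold LossInv at h1 ⊢
      rw [choose_target_ne hBσ, choose_nontarget_ne hBσ]
      exact h1
  · intro B σ' j hB hm hD
    simp only [choose_vol] at hD
    have hpre := hprefix B σ' j hB hm
    by_cases hBi : B = σ ++ [i]
    · subst hBi
      have hvi : 0 < q.vol (σ ++ [i]) :=
        (Nat.zero_le _).trans_lt (hD σ' List.prefix_rfl hpre.1 hpre.2)
      have hvσ : 0 < q.vol σ := hvi.trans_le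
        (card_le_card (cluster_subset_of_prefix _ (prefix_append_singleton _ _)))
      have hcap : q.vol (σ ++ [i]) ≤ k ^ (d - (σ.length + 1)) :=
        vol_child_le hσ i
      have hσσ' : σ' <+: σ := by
        apply List.prefix_of_prefix_length_le hpre.1 (prefix_append_singleton σ i)
        have h1 := hpre.1.length_le
        have h2 : σ'.length ≠ (σ ++ [i]).length := fun e => hpre.2 (hpre.1.eq_of_length e)
        simp at h1 h2
        omega
      -- The guard at `σ` bounds its debt by the size of a child, as `Inv.loss_le` requires.
      have hDσ := hD σ hσσ' (prefix_append_singleton _ _) (ne_append_singleton _ _)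
      have hloss := h.loss_le hp hσ hvσ hs.mem (hDσ.le.trans hcap)
      have hne := (ne_append_singleton σ i).symm
      apply MarkInv.start hp hlen
      · intro hB
        rw [choose_target_ne hne, choose_nontarget_ne hne]
        exact h.target_notMem _ hB
      · intro hB
        rw [choose_target_ne hne, choose_nontarget_ne hne]
        exact h.abandoned _ hB
      · rw [List.length_append, List.length_singleton]
        exact hloss
      · rw [choose_marks]
        rw [choose_minfo_self] at hm
        split_ifs at hm with hc
        · have hold := h.mark_inv σ σ' j hσ.le hm (fun P h1 h2 h3 => by
            have := hD P h1 (h2.trans (prefix_append_singleton _ _)) (fun e => by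
              have := h2.length_le
              rw [e] at this
              simp at this)
            unfold Core.vol at this ⊢
            rwa [hself hc])
          obtain ⟨-, g, y, h1, h2, h3, h4, -⟩ := hold.2 hσ
          have hsingle := h4.single hs.mem (N := k) (Nat.cast_nonneg _) (by omega)
          have hd := hp.one_le_d
          have hd0 := hp.d_pos
          have hσ'lt := (h.owner_prefix σ σ' j hσ.le hm)
          have hl : σ'.length + 1 ≤ σ.length := by
            have h1 := hσ'lt.1.length_le
            have h2 : σ'.length ≠ σ.length := fun e => hσ'lt.2 (hσ'lt.1.eq_of_length e)
            omega
          have hkc : k ^ (d - σ.length) = k * k ^ (d - (σ.length + 1)) := by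
            rw [← pow_succ']
            congr 1
            omega
          have hI : markInit k d τ σ σ' = markDensity d (σ.length - (σ'.length + 1)) * τ *
              (k * ((k ^ (d - (σ.length + 1)) : ℕ) : ℝ)) := by
            rw [markInit, hkc, Nat.cast_mul]
          have hI' : markInit k d τ (σ ++ [i]) σ' =
              markDensity d (σ.length - (σ'.length + 1) + 1) * τ *
                ((k ^ (d - (σ.length + 1)) : ℕ) : ℝ) := by
            unfold markInit
            simp only [List.length_append, List.length_singleton]
            rw [show σ.length + 1 - (σ'.length + 1) = σ.length - (σ'.length + 1) + 1 by omega]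
          rw [hI', markDensity_succ]
          rw [hI] at hsingle
          have hκ := markDensity_pos d (σ.length - (σ'.length + 1))
          have hρ := hp.ρ_ge
          have hy2 : y ≤ 2 * k ^ (d - (σ.length + 1)) := by split_ifs at h1 <;> omega
          set c := k ^ (d - (σ.length + 1))
          set κ := markDensity d (σ.length - (σ'.length + 1))
          -- With a single child left, the count of choices gives `g + 1 ≥ k * d / (d + 1)`;
          -- dividing the initial marks of `σ` by `g + 1` therefore costs a factor `1 + 1/d`
          -- compared with dividing by `k`.
          rw [hc, show (1 + 2 * d) / (2 * d + 1) = 1 by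
            rw [add_comm]; exact Nat.div_self (by omega)] at h2
          have hX : (k : ℝ) * d / (d + 1) ≤ ((g + 1 : ℕ) : ℝ) := by
            push_cast at h2 ⊢
            linarith
          have hy2' : (y : ℝ) ≤ ((2 * c : ℕ) : ℝ) := by exact_mod_cast hy2
          have hk0 : (0 : ℝ) < k := by exact_mod_cast hp.k_pos
          have hc0 : (0 : ℝ) ≤ c := Nat.cast_nonneg _
          have hτ := hp.τ_pos
          have hρ0 := hp.ρ_pos
          have hdp : (0 : ℝ) < d := by linarith
          have hA : (ρ : ℝ) * (κ * τ * (k * c)) / ((g + 1 : ℕ) : ℝ) ≤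
              ρ * (κ * τ * c) * (1 + 1 / d) := by
            rw [div_le_iff₀ (by positivity)]
            have e : (ρ : ℝ) * (κ * τ * (k * c)) =
                ρ * (κ * τ * c) * (1 + 1 / d) * (k * d / (d + 1)) := by
              field_simp
            rw [e]
            exact mul_le_mul_of_nonneg_left hX (by positivity)
          -- The factor `2d+1` in `ρ` makes the marks added during the game as few as `τ c / d`.
          have hBd : ((2 * c : ℕ) : ℝ) * harm k ≤ ρ * (1 / d * τ * c) := by
            have e1 : 2 * harm k * d ≤ ρ * τ := by
              have := hp.one_le_harm
              nlinarith
            have e2 := mul_le_mul_of_nonneg_right e1 hc0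
            have e3 : (ρ : ℝ) * (1 / d * τ * c) = ρ * τ * c / d := by ring
            rw [e3, le_div_iff₀ hdp]
            push_cast
            linarith
          calc (ρ : ℝ) * q.marks σ' j (σ ++ [i]) ≤ _ := hsingle
            _ ≤ ρ * (κ * τ * c) * (1 + 1 / d) + ρ * (1 / d * τ * c) + D σ' := by linarith
            _ = _ := by ring
        · simp only [Option.some.injEq, Prod.mk.injEq] at hm
          rw [← hm.1, ← hm.2]
          exact h.marks_new_target hG hp hσ hvσ hs.mem hc
    · rw [choose_minfo_ne hBi] at hm
      have hold := h.mark_inv B σ' j hB hm hD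
      by_cases hBσ : B = σ
      · subst hBσ
        exact hs.markInv hp hm hold
      · unfold MarkInv at hold ⊢
        rw [choose_target_ne hBσ, choose_nontarget_ne hBσ, choose_minfo_ne hBi, choose_minfo_ne]
        · exact hold
        · intro e
          exact hBσ (List.append_inj_left' e rfl)

end Choose

end SemiHypercube

/-! ### The initial state, and the guarantee when no payments are outstanding. -/

namespace SemiHypercube

open Finset

variable {k d : ℕ} {G : SimpleGraph (Vertex k d)} {ρ : ℕ} {τ : ℝ} {q : Core k d}
  {D D' : List (Fin k) → ℕ}

theorem length_lt_of_strict_prefix {α : Type*} {σ B : List α} (h : σ <+: B) (hne : σ ≠ B) :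
    σ.length < B.length :=
  lt_of_le_of_ne h.length_le fun e => hne (h.eq_of_length e)

/-- Only the outstanding payments at nonempty clusters are relevant. -/
theorem Inv.of_debt (h : Inv G ρ τ q D)
    (hD : ∀ σ : List (Fin k), σ.length < d → 0 < q.vol σ → D' σ = D σ) : Inv G ρ τ q D' :=
  { h with
    loss_inv := fun σ hσ hv => by
      rw [hD σ hσ hv]
      exact h.loss_inv σ hσ hv
    mark_inv := fun B σ j hB hm hlt => by
      obtain ⟨h1, h2⟩ := h.owner_prefix B σ j hB hm
      have hv : 0 < q.vol B := (Nat.zero_le _).trans_lt (hlt σ List.prefix_rfl h1 h2)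
      have hDP : ∀ P, P <+: B → P ≠ B → D' P = D P := fun P hP hne =>
        hD P ((length_lt_of_strict_prefix hP hne).trans_le hB)
          (hv.trans_le (card_le_card (cluster_subset_of_prefix _ hP)))
      rw [hDP σ h1 h2]
      exact h.mark_inv B σ j hB hm fun P hσP hP hne => hDP P hP hne ▸ hlt P hσP hP hne }

/-- The core of the initial state. -/
def initCore (k d : ℕ) (hk : 0 < k) : Core k d where
  V := univ
  target := fun _ => ⟨0, hk⟩
  nontarget := fun _ => univ.erase ⟨0, hk⟩
  minfo := fun σ =>
    if σ.getLast? = some ⟨0, hk⟩ then some (σ.dropLast, threshold (k - 1)) else none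
  mark := fun _ _ => ∅

theorem loss_univ (σ : List (Fin k)) : loss (univ : Finset (Vertex k d)) σ = 0 := by
  simp [loss, cluster]

theorem inv_initCore (hG : IsSemiHypercube G) (hp : Params k d ρ τ) (hk : 0 < k) :
    Inv G ρ τ (initCore k d hk) fun _ => 0 := by
  have hcard : ((univ : Finset (Fin k)).erase ⟨0, hk⟩).card = k - 1 := by simp
  have howner : ∀ (B σ : List (Fin k)) j, (initCore k d hk).minfo B = some (σ, j) →
      σ ++ [⟨0, hk⟩] = B := by
    intro B σ j h
    simp only [initCore] at h
    split_ifs at h with h1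
    simp only [Option.some.injEq, Prod.mk.injEq] at h
    rw [← h.1]
    exact List.dropLast_append_getLast? _ h1
  have habandoned : ∀ i : Fin k, i ∉ (univ : Finset (Fin k)).erase ⟨0, hk⟩ → i = ⟨0, hk⟩ :=
    fun i hi => by simpa using hi
  refine ⟨fun σ _ => by simp [initCore], fun σ _ i hi hit => absurd (habandoned i hi) hit,
    fun σ _ _ => ?_, fun B σ j _ hm => ?_, fun B σ j _ hm _ => ?_, fun σ hσ v hv j hj hlt => ?_,
    fun σ _ j v hv => by simp [initCore] at hv, fun σ hσ _ => ?_, fun B σ j hB hm _ => ?_⟩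
  · simp [initCore]
  · rw [← howner B σ j hm]
    exact ⟨prefix_append_singleton _ _, ne_append_singleton _ _⟩
  · rw [← howner B σ j hm]
    rfl
  · have := hG.le_card_nbrs_univ hσ (mem_cluster.1 hv).2
    change (nbrs G univ σ v).card < j at hlt
    omega
  · refine ⟨0, 0, ?_, ?_, CupBound.init ?_⟩
    · change 0 + ((univ : Finset (Fin k)).erase ⟨0, hk⟩).card + 1 ≤ k
      omega
    · rw [zero_add, add_mul, one_mul]
      exact (vol_child_le hσ _).trans (Nat.le_add_left _ _)
    · have : ∀ i, loss (initCore k d hk).V (σ ++ [i]) = 0 := fun i => loss_univ _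
      simp [this]
  · have hmarks : (initCore k d hk).marks σ j B = 0 := by
      simp [Core.marks, initCore, cluster]
    have hloss : loss (initCore k d hk).V B = 0 := loss_univ _
    apply MarkInv.start hp hB
    · intro _
      simp [initCore]
    · intro _ i hi hit
      exact absurd (habandoned i hi) hit
    · rw [hloss]
      have := hp.τ_pos
      rw [Nat.cast_zero]
      positivity
    · have := markDensity_pos d (B.length - (σ.length + 1))
      have := hp.τ_pos
      rw [hmarks, Nat.cast_zero, mul_zero, add_zero, markInit]
      positivity

/-- Here `Λ` counts the marks in the `s` children that have not been targets and `M` those in the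
target. Together they are at most `(6 κ + 3) τ s c`, which is `183 τ s c` for `κ = 30`; it suffices
that `(19 * 183 + 1) τ ≤ 1`. -/
theorem mark_density_arith {ρ κ τ k c s g g' H y M Λ : ℝ} (hρ : 0 < ρ) (hκ0 : 0 ≤ κ) (hκ : κ ≤ 30)
    (hτ : 0 < τ) (hτ' : τ * 4350 ≤ 1) (hc : 0 ≤ c) (hs : 1 ≤ s) (hg : 0 ≤ g)
    (hsg : k ≤ 2 * (s + g)) (hg1 : 1 ≤ g') (hgg : g ≤ g') (hH1 : 1 ≤ H)
    (hH : 2 * H * c ≤ ρ * τ * c) (hy : y ≤ 2 * c)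
    (hΛ : ρ * Λ ≤ s / (s + g) * (ρ * (κ * τ * (k * c))) + 2 * c * (s * H))
    (hM : ρ * M ≤ ρ * (κ * τ * (k * c)) / g' + 2 * c * H + y) :
    19 * (M + Λ) ≤ s * ((1 - τ) * c) := by
  have hΛ' : Λ ≤ (2 * κ + 1) * (τ * (s * c)) := by
    refine le_of_mul_le_mul_left (hΛ.trans ?_) hρ
    have e1 : s / (s + g) * (ρ * (κ * τ * (k * c))) ≤ ρ * (2 * κ * (τ * (s * c))) := by
      rw [div_mul_eq_mul_div, div_le_iff₀ (by linarith)]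
      have := mul_le_mul_of_nonneg_left hsg (show 0 ≤ ρ * (κ * (τ * (s * c))) by positivity)
      linarith
    have e2 := mul_le_mul_of_nonneg_left hH (zero_le_one.trans hs)
    linarith
  have hM' : M ≤ (4 * κ + 2) * (τ * (s * c)) := by
    refine le_of_mul_le_mul_left (hM.trans ?_) hρ
    have e1 : ρ * (κ * τ * (k * c)) / g' ≤ ρ * (4 * κ * (τ * (s * c))) := by
      rw [div_le_iff₀ (by linarith)]
      have e3 : k ≤ 4 * s * g' := by nlinarith
      have := mul_le_mul_of_nonneg_left e3 (show 0 ≤ ρ * (κ * (τ * c)) by positivity)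
      linarith
    have e2 : y ≤ ρ * τ * c := hy.trans (le_trans (by nlinarith) hH)
    have e6 : ρ * τ * c ≤ ρ * τ * c * s := le_mul_of_one_le_right (by positivity) hs
    linarith
  have hsc : 0 ≤ s * c := by positivity
  have hκm := mul_le_mul_of_nonneg_right hκ (show 0 ≤ τ * (s * c) by positivity)
  have e1 := mul_le_mul_of_nonneg_right hτ' hsc
  linarith

/-- Induction on the height of `B`. As long as `S_B` is nonempty, its children are almost complete,
and their vertices outnumber the marks. Once it is empty, everything remaining lies in the target
child, which has inherited the parameters. At a leaf, the density bound is below 1 and excludes any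
mark. -/
theorem Inv.marks_le (hp : Params k d ρ τ) (h : Inv G ρ τ q fun _ => 0) (σ : List (Fin k))
    (j : ℕ) : ∀ n (B : List (Fin k)), B.length + n = d → q.minfo B = some (σ, j) → 0 < q.vol B →
      19 * (cluster (q.mark σ j ∩ q.V) B).card ≤ q.vol B
  | 0, B, hB, hm, hv => by
    have h1 := (h.mark_inv B σ j (by omega) hm fun _ _ _ _ => hv).1 (by omega)
    have h2 : q.marks σ j B = 0 := by
      by_contra h0
      have h3 : (1 : ℝ) ≤ q.marks σ j B := by exact_mod_cast Nat.one_le_iff_ne_zero.2 h0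
      have h4 := mul_le_mul_of_nonneg_left h3 hp.ρ_pos.le
      have h5 := markDensity_le hp.d_pos (n := B.length - (σ.length + 1)) (by omega)
      rw [markInit, show d - B.length = 0 by omega] at h1
      have h6 := hp.τ_le'
      have h7 := hp.τ_pos
      have h8 := hp.ρ_pos
      simp only [pow_zero, Nat.cast_one, mul_one, Nat.cast_zero, add_zero] at h1
      have h9 : markDensity d (B.length - (σ.length + 1)) * τ < 1 := by nlinarith
      nlinarith
    have h3 : (cluster (q.mark σ j ∩ q.V) B).card ≤ q.marks σ j B :=
      card_le_card (cluster_subset_cluster inter_subset_left B)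
    omega
  | n + 1, B, hB, hm, hv => by
    have hBd : B.length < d := by omega
    have hchild : ∀ i, i ∉ insert (q.target B) (q.nontarget B) → cluster q.V (B ++ [i]) = ∅ := by
      intro i hi
      rw [mem_insert, not_or] at hi
      exact card_eq_zero.1 (h.abandoned B hBd i hi.2 hi.1)
    obtain ⟨h0, g, y, h1, h2, h3, h4, h5⟩ := (h.mark_inv B σ j hBd.le hm fun _ _ _ _ => hv).2 hBd
    by_cases hS : q.nontarget B = ∅
    · have hcl : ∀ W ⊆ q.V, cluster W B = cluster W (B ++ [q.target B]) := fun W hW =>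
        cluster_eq_self_child hBd fun i hi =>
          subset_empty.1 (hchild i (by simp [hS, hi]) ▸ cluster_subset_cluster hW _)
      have hV := hcl q.V Subset.rfl
      have ih := Inv.marks_le hp h σ j n (B ++ [q.target B]) (by simp; omega)
        ((h0 hS).trans hm) (by unfold Core.vol at hv ⊢; rwa [← hV])
      rw [hcl _ inter_subset_right]
      unfold Core.vol at ih ⊢
      rwa [hV]
    · have hs0 : 0 < (q.nontarget B).card := card_pos.2 (nonempty_iff_ne_empty.2 hS)
      have htS := h.target_notMem B hBd
      have hkc : k ^ (d - B.length) = k * k ^ (d - (B.length + 1)) := by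
        rw [← pow_succ']
        congr 1
        omega
      have hy : y ≤ 2 * k ^ (d - (B.length + 1)) := by split_ifs at h1 <;> omega
      have hy' : (y : ℝ) ≤ ((2 * k ^ (d - (B.length + 1)) : ℕ) : ℝ) := by exact_mod_cast hy
      have h6 := h4.total Subset.rfl (Nat.cast_nonneg _) hy' (N := k) (by omega) hs0
      have hvol : ∀ i ∈ q.nontarget B,
          (1 - τ) * ((k ^ (d - (B.length + 1)) : ℕ) : ℝ) ≤ q.vol (B ++ [i]) := by
        intro i hi
        have e1 := h.loss_le hp hBd hv hi (Nat.zero_le _)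
        have e2 := loss_add_card q.V (σ := B ++ [i]) (by simpa using hBd)
        rw [List.length_append, List.length_singleton] at e2
        have e3 : (loss q.V (B ++ [i]) : ℝ) + q.vol (B ++ [i]) =
            ((k ^ (d - (B.length + 1)) : ℕ) : ℝ) := by exact_mod_cast e2
        linarith
      have hvolB : (q.nontarget B).card * ((1 - τ) * ((k ^ (d - (B.length + 1)) : ℕ) : ℝ)) ≤
          q.vol B := by
        have e1 := card_nsmul_le_sum _ _ _ hvol
        rw [nsmul_eq_mul] at e1
        refine e1.trans ?_
        have e2 : ∑ i ∈ q.nontarget B, q.vol (B ++ [i]) ≤ q.vol B := by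
          unfold Core.vol
          rw [card_cluster_eq_sum _ hBd]
          exact sum_le_sum_of_subset (subset_univ _)
        exact_mod_cast e2
      have hmk : (cluster (q.mark σ j ∩ q.V) B).card ≤
          q.marks σ j (B ++ [q.target B]) + ∑ i ∈ q.nontarget B, q.marks σ j (B ++ [i]) := by
        rw [card_cluster_eq_sum _ hBd,
          ← sum_insert (f := fun i => q.marks σ j (B ++ [i])) htS,
          ← sum_subset (subset_univ (insert (q.target B) (q.nontarget B)))]
        · exact sum_le_sum fun i _ => card_le_card (cluster_subset_cluster inter_subset_left _)
        · intro i _ hi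
          rw [card_eq_zero]
          exact subset_empty.1 (hchild i hi ▸ cluster_subset_cluster inter_subset_right _)
      have hκ := markDensity_le hp.d_pos (n := B.length - (σ.length + 1)) (by omega)
      have hκ0 := markDensity_pos d (B.length - (σ.length + 1))
      have hI : markInit k d τ B σ = markDensity d (B.length - (σ.length + 1)) * τ *
          (k * ((k ^ (d - (B.length + 1)) : ℕ) : ℝ)) := by
        rw [markInit, hkc, Nat.cast_mul]
      rw [hI] at h5 h6
      have hdiv : 1 ≤ ((q.nontarget B).card + 2 * d) / (2 * d + 1) :=
        (Nat.one_le_div_iff (by omega)).2 (by omega)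
      have hdiv' : (1 : ℝ) ≤ (((q.nontarget B).card + 2 * d) / (2 * d + 1) : ℕ) := by
        exact_mod_cast hdiv
      have hd1 := hp.one_le_d
      have hk0 : (0 : ℝ) < k := by exact_mod_cast hp.k_pos
      have hkd : (k : ℝ) / 2 ≤ k * d / (d + 1) := by
        rw [div_le_div_iff₀ (by norm_num) (by positivity)]
        nlinarith
      -- At least one choice by size is still counted, which cancels the `+ 1` in the bound for `g`.
      have hsg : (k : ℝ) ≤ 2 * (((q.nontarget B).card : ℝ) + g) := by
        push_cast at h2
        linarith
      have hH := mul_le_mul_of_nonneg_right hp.two_harm_le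
        (Nat.cast_nonneg (α := ℝ) (k ^ (d - (B.length + 1))))
      have hmk' : ((cluster (q.mark σ j ∩ q.V) B).card : ℝ) ≤
          q.marks σ j (B ++ [q.target B]) +
            ((∑ i ∈ q.nontarget B, q.marks σ j (B ++ [i]) : ℕ) : ℝ) := by exact_mod_cast hmk
      have hfin := mark_density_arith hp.ρ_pos hκ0.le hκ hp.τ_pos hp.τ_le'
        (Nat.cast_nonneg (k ^ (d - (B.length + 1)))) (s := (q.nontarget B).card)
        (Nat.one_le_cast.2 hs0) (Nat.cast_nonneg g) hsg
        (g' := (max g 1 : ℕ)) (y := y) (Nat.one_le_cast.2 (le_max_right g 1))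
        (Nat.cast_le.2 (le_max_left g 1)) hp.one_le_harm hH
        (by exact_mod_cast hy)
        (by rw [Nat.cast_zero, add_zero, Nat.cast_add, Nat.cast_mul, Nat.cast_two] at h6; exact h6)
        (by rw [Nat.cast_zero, add_zero, Nat.cast_mul, Nat.cast_two] at h5; exact h5)
      have hfin' : 19 * ((cluster (q.mark σ j ∩ q.V) B).card : ℝ) ≤ q.vol B := by linarith
      exact_mod_cast hfin'

open Classical in
/-- If no payments are outstanding, the remaining graph is as required. -/
theorem Inv.isTauSemiHypercube (hG : IsSemiHypercube G) (hp : Params k d ρ τ)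
    (h : Inv G ρ τ q fun _ => 0) : IsTauSemiHypercube τ G q.V := by
  refine ⟨hG, fun σ hσ => ?_⟩
  have hcrit : ∀ t, IsCritical τ q.V (σ ++ [t]) → t = q.target σ := by
    intro t ⟨h1, h2⟩
    by_contra hne
    by_cases ht : t ∈ q.nontarget σ
    · have hv : 0 < q.vol σ :=
        h1.trans_le (card_le_card (cluster_subset_of_prefix _ (prefix_append_singleton _ _)))
      have e1 := h.loss_le hp hσ hv ht (Nat.zero_le _)
      have e2 := loss_add_card q.V (σ := σ ++ [t]) (by simpa using hσ)
      rw [List.length_append, List.length_singleton] at e2 h2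
      have e3 : (loss q.V (σ ++ [t]) : ℝ) + (cluster q.V (σ ++ [t])).card =
          ((k ^ (d - (σ.length + 1)) : ℕ) : ℝ) := by exact_mod_cast e2
      push_cast at e1 e3
      linarith
    · have := h.abandoned σ hσ t ht hne
      unfold Core.vol at this
      omega
  refine ⟨fun t t' ht ht' => (hcrit t ht).trans (hcrit t' ht').symm, fun t ht => ?_⟩
  have htt := hcrit t ht
  subst htt
  -- A nonempty child is the target, which is critical here, or is indexed by `S_σ`.
  have hgood : goodChildren τ q.V σ ≤ (q.nontarget σ).card := by
    unfold goodChildren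
    apply card_le_card
    intro i hi
    rw [mem_filter] at hi
    by_contra hiS
    by_cases hit : i = q.target σ
    · exact hi.2.2 (hit ▸ ht)
    · exact hi.2.1.card_pos.ne' (h.abandoned σ hσ i hiS hit)
  rcases (q.nontarget σ).eq_empty_or_nonempty with hS | hS
  · rw [hS, card_empty, Nat.le_zero] at hgood
    rw [hgood]
    simp
  have hm := h.minfo_target σ hσ hS.ne_empty
  have hmk := h.marks_le hp σ _ (d - (σ.length + 1)) (σ ++ [q.target σ]) (by simp; omega) hm ht.1
  have hmcard : (q.nontarget σ).card + 1 ≤ k := by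
    have := card_le_univ (insert (q.target σ) (q.nontarget σ))
    rwa [card_insert_of_notMem (h.target_notMem σ hσ), Fintype.card_fin] at this
  set m := (q.nontarget σ).card
  set A := cluster q.V (σ ++ [q.target σ])
  have hU : A.card = (A \ q.mark σ (threshold m)).card +
      (cluster (q.mark σ (threshold m) ∩ q.V) (σ ++ [q.target σ])).card := by
    rw [← card_sdiff_add_card_inter A (q.mark σ (threshold m))]
    congr 2
    ext v
    simp only [A, mem_inter, mem_cluster]
    tauto
  have hedges : (A \ q.mark σ (threshold m)).card * threshold m ≤
      (G.interedges A (cluster q.V σ \ A)).card := by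
    -- By `mem_mark`, each unmarked vertex of the critical child contributes at least `threshold m`
    -- edges that leave it inside `σ`.
    have hsub : ((A \ q.mark σ (threshold m)).sigma fun v => nbrs G q.V σ v).image
        (fun p => (p.1, p.2)) ⊆ G.interedges A (cluster q.V σ \ A) := by
      intro p hp
      obtain ⟨⟨v, u⟩, hvu, rfl⟩ := mem_image.1 hp
      rw [mem_sigma, mem_sdiff, mem_nbrs] at hvu
      obtain ⟨⟨hv, -⟩, hu, hadj, hl⟩ := hvu
      obtain ⟨i, j, hij, h1, h2⟩ := (lcp_eq_iff hσ).1 hl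
      have hi := child_prefix_unique h1 (mem_cluster.1 hv).2
      rw [SimpleGraph.mem_interedges_iff, mem_sdiff]
      refine ⟨hv, ⟨mem_cluster.2 ⟨hu, (prefix_append_singleton _ _).trans h2⟩, fun huA => ?_⟩, hadj⟩
      exact hij (hi.trans (child_prefix_unique (mem_cluster.1 huA).2 h2))
    refine le_trans ?_ (card_le_card hsub)
    rw [card_image_of_injective, card_sigma, ← smul_eq_mul]
    · apply card_nsmul_le_sum
      intro v hv
      rw [mem_sdiff] at hv
      by_contra hlt
      exact hv.2 (h.mem_mark σ hσ v
        (cluster_subset_of_prefix _ (prefix_append_singleton _ _) hv.1) _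
        ((threshold_le m).trans (by omega)) (not_le.1 hlt))
    · rintro ⟨a, b⟩ ⟨a', b'⟩ hab
      simp only [Prod.mk.injEq] at hab
      obtain ⟨rfl, rfl⟩ := hab
      rfl
  have e1 : ((A \ q.mark σ (threshold m)).card : ℝ) * threshold m ≤
      ((G.interedges A (cluster q.V σ \ A)).card : ℝ) := by exact_mod_cast hedges
  have e2 := le_threshold m
  change 19 * _ ≤ A.card at hmk
  set U := (A \ q.mark σ (threshold m)).card
  -- With `threshold m ≥ 19/20 * m` this yields the constant `18/19 * 19/20 = 9/10`.
  have e3 : (18 : ℝ) * A.card ≤ 19 * U := by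
    have : 18 * A.card ≤ 19 * U := by omega
    exact_mod_cast this
  have e4 : (goodChildren τ q.V σ : ℝ) ≤ m := by exact_mod_cast hgood
  have e5 : (goodChildren τ q.V σ : ℝ) * A.card ≤ m * A.card :=
    mul_le_mul_of_nonneg_right e4 (Nat.cast_nonneg _)
  have e6 := mul_le_mul_of_nonneg_left e2 (Nat.cast_nonneg (α := ℝ) U)
  have e7 := mul_le_mul_of_nonneg_left e3 (Nat.cast_nonneg (α := ℝ) m)
  refine le_trans ?_ e1
  linarith

end SemiHypercube

/-! ### Hoare triples with work bounds for the elementary operations. -/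

namespace SemiHypercube

open Finset

variable {k d : ℕ} {G : SimpleGraph (Vertex k d)} {ρ : ℕ} {τ : ℝ} {q q' : Core k d}
  {D : List (Fin k) → ℕ} {α β : Type}

section Sim

/-- Run in a state with the property `R`, the program returns `a`, ends in a state with the property
`R'`, and does at most `B` units of work. -/
def Sim (R : State k d → Prop) (p : Prog k d α) (a : α) (R' : State k d → Prop) (B : ℕ) : Prop :=
  ∀ s, R s → (p.run s).1 = a ∧ R' (p.run s).2 ∧ (p.run s).2.work ≤ s.work + B

variable {R R₁ R₂ R' : State k d → Prop} {a : α} {b : β} {B B₁ B₂ : ℕ} {p : Prog k d α}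
  {f : α → Prog k d β}

theorem Sim.bind (hp : Sim R p a R₁ B₁) (hf : Sim R₁ (f a) b R₂ B₂) :
    Sim R (p >>= f) b R₂ (B₁ + B₂) := by
  intro s hs
  obtain ⟨h1, h2, h3⟩ := hp s hs
  have e : (p >>= f).run s = (f (p.run s).1).run (p.run s).2 := rfl
  rw [e, h1]
  obtain ⟨h4, h5, h6⟩ := hf _ h2
  exact ⟨h4, h5, by omega⟩

theorem Sim.pure (a : α) : Sim R (Pure.pure a) a R 0 := fun _ hs => ⟨rfl, hs, le_rfl⟩

theorem Sim.mono (h : Sim R p a R' B₁) (hB : B₁ ≤ B₂) : Sim R p a R' B₂ := fun s hs =>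
  ⟨(h s hs).1, (h s hs).2.1, (h s hs).2.2.trans (Nat.add_le_add_left hB s.work)⟩

theorem Sim.post (h : Sim R p a R₁ B) (hR : ∀ s, R₁ s → R' s) : Sim R p a R' B := fun s hs =>
  ⟨(h s hs).1, hR _ (h s hs).2.1, (h s hs).2.2⟩

theorem Sim.pre (h : Sim R₁ p a R' B) (hR : ∀ s, R s → R₁ s) : Sim R p a R' B := fun s hs =>
  h s (hR s hs)

/-- The state agrees with the core `q`. -/
structure Agrees (q : Core k d) (s : State k d) : Prop where
  V_eq : s.V = q.V
  target_eq : s.target = q.target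
  nontarget_eq : s.nontarget = q.nontarget
  minfo_eq : s.minfo = q.minfo
  size_eq : ∀ σ : List (Fin k), σ.length ≤ d → s.size σ = q.vol σ
  shadow_eq : ∀ (a b : List (Fin k)) (j : ℕ), b <+: a → b ≠ a → a.length ≤ d →
    s.shadow a b j = cluster (q.mark b j) a

theorem Agrees.withWork {s : State k d} (h : Agrees q s) (w : ℕ) :
    Agrees q { s with work := w } :=
  ⟨h.V_eq, h.target_eq, h.nontarget_eq, h.minfo_eq, h.size_eq, h.shadow_eq⟩

theorem sim_tick (c : ℕ) : Sim (Agrees q) (tick c) () (Agrees q) c := fun _ hs =>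
  ⟨rfl, hs.withWork _, le_rfl⟩

theorem sim_access : Sim (Agrees q) access () (Agrees q) (accessCost k d) := sim_tick _

theorem sim_getSize {σ : List (Fin k)} (hσ : σ.length ≤ d) :
    Sim (Agrees q) (getSize σ) (q.vol σ) (Agrees q) (accessCost k d) := fun _ hs =>
  ⟨hs.size_eq σ hσ, hs.withWork _, le_rfl⟩

theorem sim_getTarget (σ : List (Fin k)) :
    Sim (Agrees q) (getTarget σ) (q.target σ) (Agrees q) (accessCost k d) := fun _ hs =>
  ⟨congrFun hs.target_eq σ, hs.withWork _, le_rfl⟩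

theorem sim_nontargetCard (σ : List (Fin k)) :
    Sim (Agrees q) (nontargetCard σ) (q.nontarget σ).card (Agrees q) (accessCost k d) := fun _ hs =>
  ⟨congrArg card (congrFun hs.nontarget_eq σ), hs.withWork _, le_rfl⟩

theorem sim_nontargetMem (σ : List (Fin k)) (i : Fin k) :
    Sim (Agrees q) (nontargetMem σ i) (decide (i ∈ q.nontarget σ)) (Agrees q)
      (accessCost k d) := fun s hs =>
  ⟨by rw [← hs.nontarget_eq]; rfl, hs.withWork _, le_rfl⟩

theorem sim_getMinfo (σ : List (Fin k)) :
    Sim (Agrees q) (getMinfo σ) (q.minfo σ) (Agrees q) (accessCost k d) := fun _ hs =>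
  ⟨congrFun hs.minfo_eq σ, hs.withWork _, le_rfl⟩

theorem sim_vertexMem (v : Vertex k d) :
    Sim (Agrees q) (vertexMem v) (decide (v ∈ q.V)) (Agrees q) (accessCost k d) := fun s hs =>
  ⟨by rw [← hs.V_eq]; rfl, hs.withWork _, le_rfl⟩

theorem sim_setTarget (σ : List (Fin k)) (i : Fin k) : Sim (Agrees q) (setTarget σ i) ()
    (Agrees { q with target := Function.update q.target σ i }) (accessCost k d) := fun _ hs =>
  ⟨rfl, ⟨hs.V_eq, by rw [← hs.target_eq]; rfl, hs.nontarget_eq, hs.minfo_eq,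
    hs.size_eq, hs.shadow_eq⟩, le_rfl⟩

theorem sim_setMinfo (σ : List (Fin k)) (p : Option (List (Fin k) × ℕ)) :
    Sim (Agrees q) (setMinfo σ p) ()
      (Agrees { q with minfo := Function.update q.minfo σ p }) (accessCost k d) := fun _ hs =>
  ⟨rfl, ⟨hs.V_eq, hs.target_eq, hs.nontarget_eq, by rw [← hs.minfo_eq]; rfl,
    hs.size_eq, hs.shadow_eq⟩, le_rfl⟩

theorem sim_nontargetErase (σ : List (Fin k)) (i : Fin k) :
    Sim (Agrees q) (nontargetErase σ i) ()
      (Agrees { q with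
        nontarget := Function.update q.nontarget σ ((q.nontarget σ).erase i) })
      (accessCost k d) := fun _ hs =>
  ⟨rfl, ⟨hs.V_eq, hs.target_eq,
    by rw [← hs.nontarget_eq]; rfl, hs.minfo_eq,
    hs.size_eq, hs.shadow_eq⟩, le_rfl⟩

/-- The number of marks for the parameters `p` in a cluster. -/
def Core.marksAt (q : Core k d) (p : Option (List (Fin k) × ℕ)) (B : List (Fin k)) : ℕ :=
  match p with
  | none => 0
  | some (σ, j) => q.marks σ j B

theorem sim_shadowCard {B : List (Fin k)} (hB : B.length ≤ d) (p : Option (List (Fin k) × ℕ))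
    (hp : ∀ σ j, p = some (σ, j) → σ <+: B ∧ σ ≠ B) :
    Sim (Agrees q) (shadowCard B p) (q.marksAt p B) (Agrees q) (accessCost k d) := by
  intro s hs
  match p with
  | none => exact ⟨rfl, hs.withWork _, le_rfl⟩
  | some (σ, j) =>
    obtain ⟨h1, h2⟩ := hp σ j rfl
    exact ⟨congrArg card (hs.shadow_eq B σ j h1 h2 hB), hs.withWork _, le_rfl⟩

end Sim

/-! ### Scanning for a best index. -/

section Scan

/-- The result of scanning the indices in a list. -/
def scanStep (S : Finset (Fin k)) (better : ℕ → ℕ → Bool) (key : Fin k → ℕ)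
    (best : Option (Fin k × ℕ)) (i : Fin k) : Option (Fin k × ℕ) :=
  if i ∈ S then
    match best with
    | none => some (i, key i)
    | some (i₀, y) => if better (key i) y then some (i, key i) else some (i₀, y)
  else best

/-- The result `best` of a scan of the indices in `T`. -/
def IsBest (S T : Finset (Fin k)) (better : ℕ → ℕ → Bool) (key : Fin k → ℕ) :
    Option (Fin k × ℕ) → Prop
  | none => ∀ i ∈ T, i ∉ S
  | some (i₀, y) => i₀ ∈ S ∧ y = key i₀ ∧ ∀ i ∈ T, i ∈ S → better (key i) y = false

theorem IsBest.scanStep {S T : Finset (Fin k)} {better : ℕ → ℕ → Bool} {key : Fin k → ℕ}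
    (hirr : ∀ x, better x x = false)
    (htr : ∀ x y z, better x y = true → better z x = true → better z y = true)
    {best : Option (Fin k × ℕ)} (h : IsBest S T better key best) (i : Fin k) :
    IsBest S (insert i T) better key (scanStep S better key best i) := by
  unfold SemiHypercube.scanStep
  split_ifs with hi
  · match best with
    | none =>
      refine ⟨hi, rfl, fun i' hi' hS => ?_⟩
      rcases mem_insert.1 hi' with rfl | hT
      · exact hirr _
      · exact absurd hS (h i' hT)
    | some (i₀, y) =>
      obtain ⟨h1, h2, h3⟩ := h
      dsimp only
      split_ifs with hb
      · refine ⟨hi, rfl, fun i' hi' hS => ?_⟩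
        rcases mem_insert.1 hi' with rfl | hT
        · exact hirr _
        · by_contra hz
          rw [Bool.not_eq_false] at hz
          have := htr _ _ _ hb hz
          rw [h3 i' hT hS] at this
          cases this
      · refine ⟨h1, h2, fun i' hi' hS => ?_⟩
        rcases mem_insert.1 hi' with rfl | hT
        · simpa using hb
        · exact h3 i' hT hS
  · match best with
    | none =>
      intro i' hi'
      rcases mem_insert.1 hi' with rfl | hT
      · exact hi
      · exact h i' hT
    | some (i₀, y) =>
      refine ⟨h.1, h.2.1, fun i' hi' hS => ?_⟩
      rcases mem_insert.1 hi' with rfl | hT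
      · exact absurd hS hi
      · exact h.2.2 i' hT hS

theorem sim_foldlM {R : State k d → Prop} {f : β → α → Prog k d β} {g : β → α → β} {B : ℕ} {l : List α}
    (hf : ∀ b, ∀ a ∈ l, Sim R (f b a) (g b a) R B) (b : β) :
    Sim R (l.foldlM f b) (l.foldl g b) R (l.length * B) := by
  induction l generalizing b with
  | nil => simpa using Sim.pure b
  | cons a l ih =>
    rw [List.foldlM_cons, List.foldl_cons]
    refine ((hf b a (by simp)).bind (ih (fun b a' ha' => hf b a' (by simp [ha'])) (g b a))).mono ?_
    rw [List.length_cons]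
    linarith

theorem one_le_accessCost (hk : 0 < k) : 1 ≤ accessCost k d := by
  have := Nat.size_pos.2 hk
  unfold accessCost
  nlinarith

/-- The monadic loop computes the pure fold of `scanStep`, for which `IsBest` is the loop invariant.
How ties are broken is irrelevant to the analysis. -/
theorem sim_scan (hk : 0 < k) {σ : List (Fin k)} {better : ℕ → ℕ → Bool} {key : Fin k → Prog k d ℕ}
    {f : Fin k → ℕ} (hirr : ∀ x, better x x = false)
    (htr : ∀ x y z, better x y = true → better z x = true → better z y = true)
    (hkey : ∀ i, Sim (Agrees q) (key i) (f i) (Agrees q) (accessCost k d))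
    (hS : (q.nontarget σ).Nonempty) :
    ∃ i ∈ q.nontarget σ, (∀ i' ∈ q.nontarget σ, better (f i') (f i) = false) ∧
      Sim (Agrees q) (scan σ better key) (some i) (Agrees q) (k * (4 * accessCost k d)) := by
  have hA := one_le_accessCost (d := d) hk
  have hbest : ∀ (l : List (Fin k)) (T : Finset (Fin k)) best,
      IsBest (q.nontarget σ) T better f best →
      IsBest (q.nontarget σ) (T ∪ l.toFinset) better f
        (l.foldl (scanStep (q.nontarget σ) better f) best) := by
    intro l
    induction l with
    | nil => intro T best h; simpa using h
    | cons a l ih =>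
      intro T best h
      have := ih _ _ (h.scanStep hirr htr a)
      rw [List.foldl_cons, List.toFinset_cons, union_insert, ← insert_union]
      exact this
  have h1 := hbest (List.finRange k) ∅ none (by simp [IsBest])
  have h2 : ∀ i : Fin k, i ∈ ∅ ∪ (List.finRange k).toFinset := fun i => by simp
  have hsim : Sim (Agrees q) (scan σ better key)
      (((List.finRange k).foldl (scanStep (q.nontarget σ) better f) none).map Prod.fst) (Agrees q)
      (k * (4 * accessCost k d)) := by
    have hfold := fun p hp => sim_foldlM (R := Agrees q) (f := p)
      (g := scanStep (q.nontarget σ) better f) (B := 4 * accessCost k d) (l := List.finRange k) hp none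
    rw [List.length_finRange] at hfold
    unfold scan
    refine (hfold _ fun best i _ => ?_).bind (B₂ := 0) (Sim.pure _)
    refine ((sim_tick 1).bind ((sim_nontargetMem σ i).bind (B₂ := 2 * accessCost k d) ?_)).mono
      (by omega)
    unfold scanStep
    by_cases hi : i ∈ q.nontarget σ
    · simp only [hi, decide_true, if_true]
      refine ((hkey i).bind ((sim_tick 1).bind (B₂ := 0) ?_)).mono (by omega)
      match best with
      | none => exact Sim.pure _
      | some (i₀, y) =>
        dsimp only
        split_ifs
        · exact Sim.pure _
        · exact Sim.pure _
    · simp only [hi, decide_false, if_false]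
      exact (Sim.pure _).mono (Nat.zero_le _)
  obtain ⟨i₁, hi₁⟩ := hS
  rcases hr : (List.finRange k).foldl (scanStep (q.nontarget σ) better f) none with _ | ⟨i, y⟩
  · rw [hr] at h1
    exact absurd hi₁ (h1 i₁ (h2 i₁))
  · rw [hr] at h1 hsim
    obtain ⟨h3, h4, h5⟩ := h1
    exact ⟨i, h3, fun i' hi' => h4 ▸ h5 i' (h2 i') hi', hsim⟩

theorem sim_argMin (hk : 0 < k) {σ : List (Fin k)} {key : Fin k → Prog k d ℕ}
    {f : Fin k → ℕ} (hkey : ∀ i, Sim (Agrees q) (key i) (f i) (Agrees q) (accessCost k d))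
    (hS : (q.nontarget σ).Nonempty) :
    ∃ i ∈ q.nontarget σ, (∀ i' ∈ q.nontarget σ, f i ≤ f i') ∧
      Sim (Agrees q) (argMin σ key) (some i) (Agrees q) (k * (4 * accessCost k d)) := by
  obtain ⟨i, h1, h2, h3⟩ := sim_scan hk (better := fun x y => decide (x < y)) (by simp)
    (by simp only [decide_eq_true_eq]; omega) hkey hS
  exact ⟨i, h1, fun i' hi' => by simpa using h2 i' hi', h3⟩

theorem sim_argMax (hk : 0 < k) {σ : List (Fin k)} {key : Fin k → Prog k d ℕ}
    {f : Fin k → ℕ} (hkey : ∀ i, Sim (Agrees q) (key i) (f i) (Agrees q) (accessCost k d))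
    (hS : (q.nontarget σ).Nonempty) :
    ∃ i ∈ q.nontarget σ, (∀ i' ∈ q.nontarget σ, f i' ≤ f i) ∧
      Sim (Agrees q) (argMax σ key) (some i) (Agrees q) (k * (4 * accessCost k d)) := by
  obtain ⟨i, h1, h2, h3⟩ := sim_scan hk (better := fun x y => decide (y < x)) (by simp)
    (by simp only [decide_eq_true_eq]; omega) hkey hS
  exact ⟨i, h1, fun i' hi' => by simpa using h2 i' hi', h3⟩

end Scan

/-! ### The loop that chooses new targets. -/

section Retarget

theorem sim_choose (σ : List (Fin k)) (i : Fin k) (p : Option (List (Fin k) × ℕ))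
    (hp : p = if (q.nontarget σ).card = 1 then q.minfo σ
        else some (σ, threshold ((q.nontarget σ).card - 1))) :
    Sim (Agrees q) (do setTarget σ i; setMinfo (σ ++ [i]) p; nontargetErase σ i) ()
      (Agrees (q.choose σ i)) (3 * accessCost k d) := by
  subst hp
  exact ((sim_setTarget σ i).bind ((sim_setMinfo _ _).bind (sim_nontargetErase σ i))).mono
    (by omega)

theorem sim_retargetStep (hp : Params k d ρ τ) (h : Inv G ρ τ q D) {σ : List (Fin k)}
    (hσ : σ.length < d) (hS : (q.nontarget σ).Nonempty)
    (hempty : q.vol (σ ++ [q.target σ]) = 0) :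
    ∃ i, ChooseStep q σ i ∧ Sim (Agrees q) (retargetStep σ) () (Agrees (q.choose σ i))
      (13 * k * accessCost k d) := by
  have hA := one_le_accessCost (d := d) hp.k_pos
  have hk := hp.k_pos
  have hd := hp.d_pos
  have hlen : ∀ i, (σ ++ [i]).length ≤ d := fun i => by simpa using hσ
  have hB : 9 * accessCost k d + k * (4 * accessCost k d) ≤ 13 * k * accessCost k d := by
    nlinarith
  unfold retargetStep
  by_cases h1 : (q.nontarget σ).card = 1
  · obtain ⟨i, hi, -, hsim⟩ := sim_argMin hk (f := fun _ => 0) (key := fun _ => pure 0)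
      (fun _ => (Sim.pure (R := Agrees q) 0).mono (Nat.zero_le _)) hS
    obtain ⟨a, ha⟩ := card_eq_one.1 h1
    refine ⟨i, ⟨hσ, hempty, hi, fun _ i' hi' => ?_, fun hc => ?_⟩, ?_⟩
    · have e1 : i = a := by simpa [ha] using hi
      have e2 : i' = a := by simpa [ha] using hi'
      rw [e1, e2]
    · rw [h1] at hc
      exact absurd (Nat.mod_eq_of_lt (by omega)) hc
    · refine ((sim_nontargetCard σ).bind ((sim_getMinfo σ).bind ((sim_tick 4).bind
        (B₂ := k * (4 * accessCost k d) + 3 * accessCost k d) ?_))).mono (by omega)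
      simp only [h1, if_true]
      exact hsim.bind (sim_choose σ i _ (by rw [if_pos h1]))
  · by_cases hc : (q.nontarget σ).card % (2 * d + 1) = 1
    · obtain ⟨i, hi, hmin, hsim⟩ := sim_argMin hk (f := fun i => q.vol (σ ++ [i]))
        (key := fun i => getSize (σ ++ [i])) (fun i => sim_getSize (hlen i)) hS
      refine ⟨i, ⟨hσ, hempty, hi, fun _ => hmin, fun hc' => absurd hc hc'⟩, ?_⟩
      refine ((sim_nontargetCard σ).bind ((sim_getMinfo σ).bind ((sim_tick 4).bind
        (B₂ := k * (4 * accessCost k d) + 3 * accessCost k d) ?_))).mono (by omega)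
      simp only [h1, hc, if_true, if_false]
      exact hsim.bind (sim_choose σ i _ (by rw [if_neg h1]))
    · obtain ⟨i, hi, hmax, hsim⟩ := sim_argMax hk
        (f := fun i => q.marksAt (q.minfo σ) (σ ++ [i]))
        (key := fun i => shadowCard (σ ++ [i]) (q.minfo σ))
        (fun i => sim_shadowCard (hlen i) _ fun σ' j hm => by
          obtain ⟨e1, e2⟩ := h.owner_prefix σ σ' j hσ.le hm
          refine ⟨e1.trans (prefix_append_singleton _ _), fun e => ?_⟩
          have := e1.length_le
          rw [e] at this
          simp at this) hS
      refine ⟨i, ⟨hσ, hempty, hi, fun hc' => absurd hc' hc, fun _ σ' j hm i' hi' => ?_⟩, ?_⟩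
      · have := hmax i' hi'
        rwa [hm] at this
      · refine ((sim_nontargetCard σ).bind ((sim_getMinfo σ).bind ((sim_tick 4).bind
          (B₂ := k * (4 * accessCost k d) + 3 * accessCost k d) ?_))).mono (by omega)
        simp only [h1, hc, if_false]
        exact hsim.bind (sim_choose σ i _ (by rw [if_neg h1]))

/-- A nonempty cluster `σ` has a nonempty target child. -/
def Clean (q : Core k d) (σ : List (Fin k)) : Prop := 0 < q.vol σ → 0 < q.vol (σ ++ [q.target σ])

/-- The effect of `retarget σ`. -/
structure Retargeted (σ : List (Fin k)) (q q' : Core k d) : Prop where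
  V_eq : q'.V = q.V
  target_eq : ∀ B, B ≠ σ → q'.target B = q.target B
  clean : Clean q' σ

/-- Each round is a `ChooseStep` and shrinks `S_σ`, so the fuel never runs out before the loop
condition fails. -/
theorem sim_retargetLoop (hG : IsSemiHypercube G) (hp : Params k d ρ τ) {σ : List (Fin k)}
    (hσ : σ.length < d) (fuel : ℕ) (q : Core k d) (h : Inv G ρ τ q D)
    (hfuel : (q.nontarget σ).card < fuel) :
    ∃ q', Inv G ρ τ q' D ∧ Retargeted σ q q' ∧
      Sim (Agrees q) (retargetLoop σ fuel) () (Agrees q') (fuel * (18 * k * accessCost k d)) := by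
  have hA := one_le_accessCost (d := d) hp.k_pos
  have hk := hp.k_pos
  have hAk : accessCost k d ≤ k * accessCost k d := Nat.le_mul_of_pos_left _ hk
  induction fuel generalizing q with
  | zero => omega
  | succ fuel ih =>
    have hlen : (σ ++ [q.target σ]).length ≤ d := by simpa using hσ
    by_cases hc : (q.nontarget σ).card ≠ 0 ∧ q.vol (σ ++ [q.target σ]) = 0
    · obtain ⟨i, hi, hstep⟩ := sim_retargetStep hp h hσ (card_pos.1 (Nat.pos_of_ne_zero hc.1)) hc.2
      have hcard := card_erase_add_one hi.mem
      obtain ⟨q', h1, h2, h3⟩ := ih (q.choose σ i) (h.choose hG hp hi) (by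
        rw [choose_nontarget_self]
        omega)
      refine ⟨q', h1, ⟨h2.V_eq, fun B hB => ?_, h2.clean⟩, ?_⟩
      · rw [h2.target_eq B hB, choose_target_ne hB]
      · refine ((sim_nontargetCard σ).bind ((sim_getTarget σ).bind ((sim_getSize hlen).bind
          ((sim_tick 2).bind (B₂ := 13 * k * accessCost k d + fuel * (18 * k * accessCost k d))
            ?_)))).mono ?_
        · rw [if_pos hc]
          exact hstep.bind h3
        · linarith
    · refine ⟨q, h, ⟨rfl, fun _ _ => rfl, fun hv => ?_⟩, ?_⟩
      · by_contra h0
        rw [not_lt, Nat.le_zero] at h0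
        -- The loop may stop at an empty target only if no candidate is left; then all of `σ` lies
        -- in its target, so `σ` is empty too.
        have hS : q.nontarget σ = ∅ := by
          by_contra hne
          exact hc ⟨fun e => hne (card_eq_zero.1 e), h0⟩
        have := cluster_eq_self_child (V := q.V) hσ (t := q.target σ) fun i hi =>
          card_eq_zero.1 (h.abandoned σ hσ i (by simp [hS]) hi)
        unfold Core.vol at hv h0
        rw [this] at hv
        omega
      · refine ((sim_nontargetCard σ).bind ((sim_getTarget σ).bind ((sim_getSize hlen).bind
          ((sim_tick 2).bind (B₂ := 0) ?_)))).mono ?_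
        · rw [if_neg hc]
          exact Sim.pure _
        · nlinarith

theorem sim_retarget (hG : IsSemiHypercube G) (hp : Params k d ρ τ) {σ : List (Fin k)}
    (hσ : σ.length < d) (h : Inv G ρ τ q D) :
    ∃ q', Inv G ρ τ q' D ∧ Retargeted σ q q' ∧
      Sim (Agrees q) (retarget σ) () (Agrees q') (37 * k ^ 2 * accessCost k d) := by
  obtain ⟨q', h1, h2, h3⟩ := sim_retargetLoop hG hp hσ ((q.nontarget σ).card + 1) q h (by omega)
  refine ⟨q', h1, h2, ((sim_nontargetCard σ).bind h3).mono ?_⟩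
  have h4 : (q.nontarget σ).card ≤ k := by simpa using card_le_univ (q.nontarget σ)
  have hk := hp.k_pos
  have h5 : ((q.nontarget σ).card + 1) * (18 * k * accessCost k d) ≤
      (2 * k) * (18 * k * accessCost k d) := Nat.mul_le_mul_right _ (by omega)
  have h6 : 1 * accessCost k d ≤ k ^ 2 * accessCost k d :=
    Nat.mul_le_mul_right _ (Nat.one_le_pow _ _ hk)
  nlinarith

end Retarget

end SemiHypercube

/-! ### Removal of a single vertex: marks and sizes. -/

namespace SemiHypercube

open Finset

variable {k d : ℕ} {G : SimpleGraph (Vertex k d)} {q q' : Core k d} {α : Type}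

theorem sim_forM {f : α → Prog k d Unit} {B : ℕ} {R : List α → State k d → Prop} {l : List α}
    (hf : ∀ pre a post, l = pre ++ a :: post → Sim (R pre) (f a) () (R (pre ++ [a])) B) :
    Sim (R []) (l.forM f) () (R l) (l.length * B) := by
  suffices H : ∀ post pre, l = pre ++ post →
      Sim (R pre) (post.forM f) () (R l) (post.length * B) from H l [] rfl
  intro post
  induction post with
  | nil =>
    intro pre h
    rw [List.append_nil] at h
    subst h
    exact (Sim.pure ()).mono (Nat.zero_le _)
  | cons a post ih =>
    intro pre h
    refine Sim.mono ((hf pre a post h).bind (ih (pre ++ [a]) (by simp [h]))) ?_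
    rw [List.length_cons]
    linarith

theorem foldl_count (p : α → Prop) [DecidablePred p] (l : List α) (n : ℕ) :
    l.foldl (fun n u => if p u then n + 1 else n) n = n + (l.filter p).length := by
  induction l generalizing n with
  | nil => simp
  | cons a l ih =>
    rw [List.foldl_cons, ih, List.filter_cons]
    by_cases h : p a
    · simp [h]
      omega
    · simp [h]

theorem sim_clusterDegree (hG : IsSemiHypercube G) (hk : 0 < k)
    {adj : Vertex k d → List (Vertex k d)} (hadj : IsAdjacencyList G adj) (σ : List (Fin k))
    (v : Vertex k d) :
    Sim (Agrees q) (clusterDegree adj σ v) (nbrs G q.V σ v).card (Agrees q)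
      (d * k * (4 * accessCost k d)) := by
  have hA := one_le_accessCost (d := d) hk
  have hcard : (adj v).foldl
      (fun n u => if u ∈ q.V ∧ lcp v.toList u.toList = σ then n + 1 else n) 0 =
      (nbrs G q.V σ v).card := by
    rw [foldl_count, zero_add,
      ← List.toFinset_card_of_nodup ((hadj v).1.filter _)]
    congr 1
    ext u
    rw [List.mem_toFinset, List.mem_filter, (hadj v).2, mem_nbrs, decide_eq_true_eq]
    tauto
  rw [← hcard]
  unfold clusterDegree
  refine (sim_foldlM (B := 4 * accessCost k d) (fun n u _ => ?_) 0).mono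
    (Nat.mul_le_mul_right _ (hG.length_adj_le hadj v))
  refine ((sim_tick 2).bind (sim_access.bind ((sim_vertexMem u).bind (B₂ := 0) ?_))).mono
    (by omega)
  simp only [decide_eq_true_eq]
  split_ifs
  · exact Sim.pure _
  · exact Sim.pure _

open Classical in
/-- The core after the marks caused by the removal of `x` have been added for the vertices of a
list. -/
noncomputable def Core.addMarks (G : SimpleGraph (Vertex k d)) (x : Vertex k d) (q : Core k d)
    (l : List (Vertex k d)) : Core k d :=
  { q with
    mark := fun σ j => q.mark σ j ∪ q.V.filter fun v =>
      v ∈ l ∧ lcp v.toList x.toList = σ ∧ (nbrs G q.V σ v).card = j }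

theorem Core.addMarks_nil (G : SimpleGraph (Vertex k d)) (x : Vertex k d) (q : Core k d) :
    q.addMarks G x [] = q := by
  simp [addMarks]

theorem mem_mark_addMarks {x v : Vertex k d} {l : List (Vertex k d)} {σ : List (Fin k)} {j : ℕ} :
    v ∈ (q.addMarks G x l).mark σ j ↔ v ∈ q.mark σ j ∨
      v ∈ q.V ∧ v ∈ l ∧ lcp v.toList x.toList = σ ∧ (nbrs G q.V σ v).card = j := by
  classical
  simp [Core.addMarks]

theorem Agrees.withShadow {s : State k d} (h : Agrees q s) :
    Agrees q { s with shadow := fun a b j => cluster (q.mark b j) a } :=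
  ⟨h.V_eq, h.target_eq, h.nontarget_eq, h.minfo_eq, h.size_eq, fun _ _ _ _ _ _ => rfl⟩

theorem sim_insertMarks (hk : 0 < k) (v : Vertex k d) {σ : List (Fin k)} (hσ : σ <+: v.toList)
    (hσd : σ.length < d) (j₀ : ℕ) (hq' : ∀ σ' j u, u ∈ q'.mark σ' j ↔
      u ∈ q.mark σ' j ∨ u = v ∧ σ' = σ ∧ j = j₀)
    (hV : q'.V = q.V) (ht : q'.target = q.target) (hn : q'.nontarget = q.nontarget)
    (hm : q'.minfo = q.minfo) :
    Sim (Agrees q) ((List.range' (σ.length + 1) (d - σ.length)).forM fun m => do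
        tick 1
        shadowInsert (v.toList.take m) σ j₀ v) () (Agrees q') (d * (2 * accessCost k d)) := by
  have hA := one_le_accessCost (d := d) hk
  -- Inside the loop the shadow sets agree with no core. The loop invariant says that everything
  -- else agrees with `q`, and that `v` has been added exactly for its prefixes whose lengths `ms`
  -- have been treated.
  let R : List ℕ → State k d → Prop := fun ms s =>
    Agrees q { s with shadow := fun a b j => cluster (q.mark b j) a } ∧
    ∀ a b j, b <+: a → b ≠ a → a.length ≤ d → s.shadow a b j =
      cluster (q.mark b j) a ∪
        if b = σ ∧ j = j₀ ∧ a <+: v.toList ∧ a.length ∈ ms then {v} else ∅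
  have hmem : ∀ m, m ∈ List.range' (σ.length + 1) (d - σ.length) ↔ σ.length < m ∧ m ≤ d := by
    intro m
    rw [List.mem_range'_1]
    omega
  have hloop : Sim (R []) ((List.range' (σ.length + 1) (d - σ.length)).forM fun m => do
        tick 1
        shadowInsert (v.toList.take m) σ j₀ v) ()
        (R (List.range' (σ.length + 1) (d - σ.length)))
        ((List.range' (σ.length + 1) (d - σ.length)).length * (2 * accessCost k d)) := by
    refine sim_forM fun pre m post hl => ?_
    have hmd : m ≤ d := ((hmem m).1 (by rw [hl]; simp)).2
    have h1 : Sim (R pre) (tick 1) () (R pre) 1 := fun s hs =>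
      ⟨rfl, ⟨hs.1.withWork _, hs.2⟩, le_rfl⟩
    refine (h1.bind (B₂ := accessCost k d) fun s hs => ⟨rfl, ⟨hs.1.withWork _, ?_⟩, le_rfl⟩).mono
      (by omega)
    intro a b j hab hne had
    have h2 := hs.2 a b j hab hne had
    change (if a = v.toList.take m ∧ b = σ ∧ j = j₀ then insert v (s.shadow a b j)
      else s.shadow a b j) = _
    rw [h2]
    have hiff : a = v.toList.take m ↔ a <+: v.toList ∧ a.length = m := by
      constructor
      · rintro rfl
        exact ⟨List.take_prefix _ _, by simp [hmd]⟩
      · rintro ⟨e1, e2⟩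
        rw [← e2]
        exact List.prefix_iff_eq_take.1 e1
    ext u
    simp only [hiff, List.mem_append, List.mem_singleton]
    by_cases e1 : b = σ ∧ j = j₀ ∧ a <+: v.toList
    · obtain ⟨e1, e2, e3⟩ := e1
      by_cases e4 : a.length = m
      · by_cases e5 : m ∈ pre
        · simp [e1, e2, e3, e4, e5]
        · simp [e1, e2, e3, e4, e5]
      · simp [e1, e2, e3, e4]
    · have e5 : ¬ ((a <+: v.toList ∧ a.length = m) ∧ b = σ ∧ j = j₀) := by tauto
      have e6 : ∀ X : Prop, ¬ (b = σ ∧ j = j₀ ∧ a <+: v.toList ∧ X) := by tauto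
      rw [if_neg e5, if_neg (e6 _), if_neg (e6 _)]
  refine ((hloop.pre fun s hs => ⟨hs.withShadow, fun a b j h1 h2 h3 => ?_⟩).post
    fun s hs => ?_).mono (Nat.mul_le_mul_right _ (by simp))
  · simp [hs.shadow_eq a b j h1 h2 h3]
  · refine ⟨hs.1.V_eq.trans hV.symm, hs.1.target_eq.trans ht.symm, hs.1.nontarget_eq.trans hn.symm,
      hs.1.minfo_eq.trans hm.symm, fun σ' hσ' => ?_, fun a b j hab hne had => ?_⟩
    · rw [Core.vol, hV]
      exact hs.1.size_eq σ' hσ'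
    · rw [hs.2 a b j hab hne had]
      ext u
      rw [mem_union, mem_cluster, mem_cluster, hq']
      have hlen : b = σ → a.length ∈ List.range' (σ.length + 1) (d - σ.length) := by
        rintro rfl
        exact (hmem _).2 ⟨length_lt_of_strict_prefix hab hne, had⟩
      split_ifs with hc
      · obtain ⟨e1, e2, e3, -⟩ := hc
        rw [mem_singleton]
        constructor
        · rintro (h | rfl)
          · exact ⟨Or.inl h.1, h.2⟩
          · exact ⟨Or.inr ⟨rfl, e1, e2⟩, e3⟩
        · rintro ⟨h1 | h1, h2⟩
          · exact Or.inl ⟨h1, h2⟩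
          · exact Or.inr h1.1
      · constructor
        · rintro (h | h)
          · exact ⟨Or.inl h.1, h.2⟩
          · simp at h
        · rintro ⟨h1 | ⟨rfl, h1, h3⟩, h2⟩
          · exact Or.inl ⟨h1, h2⟩
          · exact absurd ⟨h1, h3, h2, hlen h1⟩ hc

theorem sim_removeSizes (hk : 0 < k) {x : Vertex k d}
    {q₀ : Core k d} (hx : x ∈ q₀.V) (hV : q'.V = q₀.V.erase x)
    (hV' : q.V = q₀.V) (hm : q'.mark = q.mark) (ht : q'.target = q.target)
    (hn : q'.nontarget = q.nontarget) (hi : q'.minfo = q.minfo) :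
    Sim (Agrees q) (do
      vertexErase x
      (List.range (d + 1)).forM fun m => do
        tick 1
        decrSize (x.toList.take m)) () (Agrees q')
      (accessCost k d + (d + 1) * (2 * accessCost k d)) := by
  have hA := one_le_accessCost (d := d) hk
  have hvol : ∀ σ, q'.vol σ + (if σ <+: x.toList then 1 else 0) = q.vol σ := fun σ => by
    unfold Core.vol
    rw [hV, hV']
    exact card_cluster_erase hx σ
  -- The vertex set is already the final one, and a size is still too large by one exactly for those
  -- prefixes of `x` whose lengths are not yet in `ms`.
  let R : List ℕ → State k d → Prop := fun ms s =>
    Agrees q' { s with size := q'.vol } ∧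
    ∀ σ, σ.length ≤ d → s.size σ = q'.vol σ + if σ <+: x.toList ∧ σ.length ∉ ms then 1 else 0
  have herase : Sim (Agrees q) (vertexErase x) () (R []) (accessCost k d) := by
    intro s hs
    refine ⟨rfl, ⟨⟨?_, hs.target_eq.trans ht.symm, hs.nontarget_eq.trans hn.symm,
      hs.minfo_eq.trans hi.symm, fun _ _ => rfl, fun a b j h1 h2 h3 => ?_⟩, fun σ hσ => ?_⟩, le_rfl⟩
    · rw [hV, ← hV', ← hs.V_eq]
      rfl
    · rw [hm]
      exact hs.shadow_eq a b j h1 h2 h3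
    · simp only [List.not_mem_nil, not_false_eq_true, and_true]
      rw [hvol]
      exact hs.size_eq σ hσ
  have hloop : Sim (R []) ((List.range (d + 1)).forM fun m => do
        tick 1
        decrSize (x.toList.take m)) () (R (List.range (d + 1)))
        ((List.range (d + 1)).length * (2 * accessCost k d)) := by
    refine sim_forM fun pre m post hl => ?_
    have hmd : m ≤ d := by
      have : m ∈ List.range (d + 1) := by rw [hl]; simp
      rw [List.mem_range] at this
      omega
    -- No length occurs twice, so no size is decreased twice.
    have hpre : m ∉ pre := by
      have := List.nodup_range (n := d + 1)
      rw [hl, List.nodup_append] at this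
      intro hmem
      exact this.2.2 m hmem m (by simp) rfl
    have h1 : Sim (R pre) (tick 1) () (R pre) 1 := fun s hs =>
      ⟨rfl, ⟨hs.1.withWork _, hs.2⟩, le_rfl⟩
    refine (h1.bind (B₂ := accessCost k d) fun s hs => ⟨rfl, ⟨hs.1.withWork _, ?_⟩, le_rfl⟩).mono
      (by omega)
    intro σ hσ
    change Function.update s.size (x.toList.take m) (s.size (x.toList.take m) - 1) σ = _
    have h2 := hs.2 σ hσ
    by_cases e : σ = x.toList.take m
    · subst e
      have hlen : (x.toList.take m).length = m := by simp [hmd]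
      rw [Function.update_self, h2, if_pos ⟨List.take_prefix _ _, by rwa [hlen]⟩, if_neg]
      · omega
      · simp [hlen]
    · rw [Function.update_of_ne e, h2]
      congr 1
      refine if_congr (and_congr_right fun hpx => ?_) rfl rfl
      have hne : σ.length ≠ m := fun h => e (by rw [← h]; exact List.prefix_iff_eq_take.1 hpx)
      simp [hne]
  refine (herase.bind ((hloop.post fun s hs => ?_).mono (B₂ := (d + 1) * (2 * accessCost k d))
    (by simp)))
  refine ⟨hs.1.V_eq, hs.1.target_eq, hs.1.nontarget_eq, hs.1.minfo_eq, fun σ hσ => ?_,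
    hs.1.shadow_eq⟩
  rw [hs.2 σ hσ, if_neg, add_zero]
  rintro ⟨-, h⟩
  exact h (List.mem_range.2 (by omega))

theorem sim_processRemoval (hG : IsSemiHypercube G) (hk : 0 < k) (hd : 0 < d)
    {adj : Vertex k d → List (Vertex k d)} (hadj : IsAdjacencyList G adj) {x : Vertex k d}
    (hx : x ∈ q.V) :
    Sim (Agrees q) (processRemoval adj x) () (Agrees (q.remove G x))
      (14 * d ^ 2 * k ^ 2 * accessCost k d) := by
  have hA := one_le_accessCost (d := d) hk
  set A := accessCost k d with hAdef
  -- As `x` is only erased after this loop, all degrees are computed in the old vertex set, as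
  -- `Core.remove` demands.
  have hloop : Sim (Agrees (q.addMarks G x [])) ((adj x).forM fun v => do
      tick 1
      if ← vertexMem v then
        access
        let σ := lcp v.toList x.toList
        let deg ← clusterDegree adj σ v
        (List.range' (σ.length + 1) (d - σ.length)).forM fun m => do
          tick 1
          shadowInsert (v.toList.take m) σ deg v) () (Agrees (q.addMarks G x (adj x)))
      ((adj x).length * (9 * (d * k * A))) := by
    refine sim_forM (R := fun l => Agrees (q.addMarks G x l)) fun pre v post hl => ?_
    have hv : v ∈ adj x := by rw [hl]; simp
    have hne : v ≠ x := ((hadj x).2 v |>.1 hv).ne'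
    have hdk : 1 ≤ d * k := Nat.mul_pos hd hk
    have hdkA : A ≤ d * k * A := Nat.le_mul_of_pos_left A hdk
    have hdA : d * (2 * A) ≤ 2 * (d * k * A) := by
      have := Nat.mul_le_mul_right A (Nat.le_mul_of_pos_right d hk)
      linarith
    refine ((sim_tick 1).bind ((sim_vertexMem v).bind
      (B₂ := A + (d * k * (4 * A) + d * (2 * A))) ?_)).mono (by rw [← hAdef]; nlinarith)
    by_cases hvV : v ∈ q.V
    · have hvV' : v ∈ (q.addMarks G x pre).V := hvV
      simp only [hvV', decide_true, if_true]
      have hlen : (lcp v.toList x.toList).length < d := by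
        obtain ⟨i, j, -, h1, -⟩ := split_of_lcp (a := v.toList) (b := x.toList)
          (fun h => hne (vertex_ext h)) (by simp)
        have := h1.length_le
        simp at this
        omega
      refine sim_access.bind ((sim_clusterDegree hG hk hadj _ v).bind ?_)
      refine sim_insertMarks hk v (lcp_prefix_left _ _) hlen _ (fun σ' j u => ?_) rfl rfl rfl rfl
      rw [mem_mark_addMarks, mem_mark_addMarks, List.mem_append, List.mem_singleton]
      change _ ↔ _ ∨ u = v ∧ σ' = _ ∧ j = (nbrs G q.V _ v).card
      constructor
      · rintro (h | ⟨h1, h2 | rfl, h3, h4⟩)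
        · exact Or.inl (Or.inl h)
        · exact Or.inl (Or.inr ⟨h1, h2, h3, h4⟩)
        · exact Or.inr ⟨rfl, h3.symm, by rw [h3, h4]⟩
      · rintro ((h | ⟨h1, h2, h3, h4⟩) | ⟨rfl, rfl, rfl⟩)
        · exact Or.inl h
        · exact Or.inr ⟨h1, Or.inl h2, h3, h4⟩
        · exact Or.inr ⟨hvV, Or.inr rfl, rfl, rfl⟩
    · have hvV' : v ∉ (q.addMarks G x pre).V := hvV
      simp only [hvV', decide_false, Bool.false_eq_true, if_false]
      refine ((Sim.pure ()).mono (Nat.zero_le _)).post fun s hs => ?_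
      have : q.addMarks G x (pre ++ [v]) = q.addMarks G x pre := by
        unfold Core.addMarks
        congr 1
        funext σ j
        congr 1
        ext u
        simp only [mem_filter, List.mem_append, List.mem_singleton]
        constructor
        · rintro ⟨h1, h2 | rfl, h3⟩
          · exact ⟨h1, h2, h3⟩
          · exact absurd h1 hvV
        · rintro ⟨h1, h2, h3⟩
          exact ⟨h1, Or.inl h2, h3⟩
      rw [this]
      exact hs
  rw [Core.addMarks_nil] at hloop
  have hmark : (q.remove G x).mark = (q.addMarks G x (adj x)).mark := by
    funext σ j
    ext u
    rw [mem_mark_remove, mem_mark_addMarks, (hadj x).2, G.adj_comm]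
  unfold processRemoval
  refine (hloop.bind (sim_removeSizes (q := q.addMarks G x (adj x)) (q' := q.remove G x) (q₀ := q)
    hk hx rfl rfl hmark rfl rfl rfl)).mono ?_
  have h1 : (adj x).length * (9 * (d * k * A)) ≤ d * k * (9 * (d * k * A)) :=
    Nat.mul_le_mul_right _ (hG.length_adj_le hadj x)
  have h2 : d * A ≤ d ^ 2 * k ^ 2 * A := by
    apply Nat.mul_le_mul_right
    calc d = d * 1 := (mul_one d).symm
      _ ≤ d * (d * k ^ 2) := Nat.mul_le_mul_left _ (Nat.mul_pos hd (pow_pos hk 2))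
      _ = d ^ 2 * k ^ 2 := by ring
  have h3 : A ≤ d * A := Nat.le_mul_of_pos_left _ hd
  rw [← hAdef]
  nlinarith

end SemiHypercube

/-! ### Trimming, climbing to the root, and the update. -/

namespace SemiHypercube

open Finset

variable {k d : ℕ} {G : SimpleGraph (Vertex k d)} {ρ : ℕ} {τ : ℝ} {q q' : Core k d}
  {D D' : List (Fin k) → ℕ}

theorem Clean.of_remove {x : Vertex k d} {σ : List (Fin k)} (h : Clean q σ)
    (hV : q'.V = q.V.erase x) (ht : q'.target σ = q.target σ) (hx : ¬ σ <+: x.toList) :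
    Clean q' σ := by
  have : ∀ B, ¬ B <+: x.toList → q'.vol B = q.vol B := fun B hB => by
    unfold Core.vol
    rw [hV, cluster_erase, erase_eq_of_notMem fun h' => hB (mem_cluster.1 h').2]
  unfold Clean at h ⊢
  rw [ht, this σ hx, this _ fun h' => hx ((prefix_append_singleton _ _).trans h')]
  exact h

theorem Retargeted.clean_of {σ B : List (Fin k)} (h : Retargeted σ q q')
    (hB : B ≠ σ → Clean q B) : Clean q' B := by
  by_cases e : B = σ
  · exact e ▸ h.clean
  · unfold Clean Core.vol
    rw [h.target_eq B e, h.V_eq]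
    exact hB e

/-- The effect of `trim σ`, which removes the vertex `x`. -/
structure Trimmed (σ : List (Fin k)) (x : Vertex k d) (q q' : Core k d) : Prop where
  mem : x ∈ q.V
  isPrefix : σ <+: x.toList
  V_eq : q'.V = q.V.erase x
  clean : ∀ B, σ <+: B → B.length < d → Clean q' B
  target_eq : ∀ B, ¬ σ <+: B → q'.target B = q.target B

/-- The cluster `P` where the payment is made stays fixed while `σ` descends along targets; the
whole descent ends in a single `RemovalStep` from `D` to `D'`. Cleanliness below `σ` ensures that
the descent reaches a remaining vertex, and retargeting on the way back restores it. -/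
theorem sim_trim (hG : IsSemiHypercube G) (hp : Params k d ρ τ)
    {adj : Vertex k d → List (Vertex k d)} (hadj : IsAdjacencyList G adj) {P : List (Fin k)}
    (hD1 : ∀ σ, σ <+: P → σ ≠ P → D' σ = D σ + ρ) (hD2 : P.length < d → D' P + 1 = D P)
    (hD3 : ∀ σ, ¬ σ <+: P → D' σ = D σ) (h : Inv G ρ τ q D) :
    ∀ (r : ℕ) (σ : List (Fin k)) (hr : σ.length + r = d), P <+: σ →
      (∀ B, P <+: B → B <+: σ → B ≠ σ → B ++ [q.target B] <+: σ) →
      (∀ B, σ <+: B → B.length < d → Clean q B) → 0 < q.vol σ →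
      ∃ x q', Inv G ρ τ q' D' ∧ Trimmed σ x q q' ∧
        Sim (Agrees q) (trim adj r σ hr) x (Agrees q')
          (14 * d ^ 2 * k ^ 2 * accessCost k d + r * (39 * k ^ 2 * accessCost k d))
  | 0, σ, hr, hP, hchain, hclean, hv => by
    obtain ⟨x, hx⟩ : ∃ x : Vertex k d, x = ⟨σ, hr⟩ := ⟨_, rfl⟩
    have hxσ : x.toList = σ := by rw [hx]; rfl
    have hxV : x ∈ q.V := by
      obtain ⟨y, hy⟩ := card_pos.1 hv
      obtain ⟨h1, h2⟩ := mem_cluster.1 hy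
      have : y = x := vertex_ext (by rw [hxσ]; exact (h2.eq_of_length (by simpa using hr)).symm)
      exact this ▸ h1
    have hs : RemovalStep ρ q D D' P x :=
      ⟨hxV, by rw [hxσ]; exact hP, fun B hPB hBx hB => by
        rw [hxσ] at hBx ⊢
        exact hchain B hPB hBx fun e => by rw [e] at hB; omega, hD1, hD2, hD3⟩
    refine ⟨x, q.remove G x, h.remove hG hs, ⟨hxV, by rw [hxσ], rfl, fun B hB hBd => ?_,
      fun _ _ => rfl⟩, ?_⟩
    · have := hB.length_le
      omega
    · have := (sim_processRemoval hG hp.k_pos hp.d_pos hadj hxV).bind (f := fun _ => pure x)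
        (Sim.pure x)
      subst hx
      exact this.mono (by simp)
  | r + 1, σ, hr, hP, hchain, hclean, hv => by
    have hA := one_le_accessCost (d := d) hp.k_pos
    have hσ : σ.length < d := by omega
    have hr' : (σ ++ [q.target σ]).length + r = d := by
      simp only [List.length_append, List.length_singleton]
      omega
    obtain ⟨x, q₁, h1, h2, h3⟩ := sim_trim hG hp hadj hD1 hD2 hD3 h r (σ ++ [q.target σ]) hr'
      (hP.trans (prefix_append_singleton _ _)) (fun B hPB hB hne => by
        by_cases e : B = σ
        · rw [e]
        · have hlt := length_lt_of_strict_prefix hB hne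
          rw [List.length_append, List.length_singleton] at hlt
          have hBσ := List.prefix_of_prefix_length_le hB (prefix_append_singleton σ _) (by omega)
          exact (hchain B hPB hBσ e).trans (prefix_append_singleton _ _))
      (fun B hB hBd => hclean B ((prefix_append_singleton _ _).trans hB) hBd)
      (hclean σ List.prefix_rfl hσ hv)
    obtain ⟨q₂, h4, h5, h6⟩ := sim_retarget hG hp hσ h1
    have hσx := (prefix_append_singleton _ _).trans h2.isPrefix
    refine ⟨x, q₂, h4, ⟨h2.mem, hσx, h5.V_eq.trans h2.V_eq, fun B hB hBd => ?_, fun B hB => ?_⟩, ?_⟩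
    · refine h5.clean_of fun hne => ?_
      -- A strict descendant of `σ` lies below the target, where the recursive call leaves it clean,
      -- or below another child, which does not contain the removed vertex.
      by_cases hBt : σ ++ [q.target σ] <+: B
      · exact h2.clean B hBt hBd
      · refine (hclean B hB hBd).of_remove h2.V_eq (h2.target_eq B hBt) fun hBx => hBt ?_
        exact prefix_child_of_strict hB (Ne.symm hne) hBx h2.isPrefix
    · rw [h5.target_eq B fun e => hB (e ▸ List.prefix_rfl),
        h2.target_eq B fun e => hB ((prefix_append_singleton _ _).trans e)]
    · have hk : 1 * accessCost k d ≤ k ^ 2 * accessCost k d :=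
        Nat.mul_le_mul_right _ (Nat.one_le_pow _ _ hp.k_pos)
      refine ((sim_tick 1).bind ((sim_getTarget σ).bind (h3.bind (h6.bind (Sim.pure x))))).mono ?_
      linarith

/-- The outstanding payments while `m` levels above the deleted vertex `v` have not been processed,
where `c` vertices have been removed, and `n` payments are outstanding on the current level. -/
def debt (ρ : ℕ) (v : Vertex k d) (m c n : ℕ) (σ : List (Fin k)) : ℕ :=
  if σ <+: v.toList then
    if σ.length < m then ρ * c else if σ.length = m then n else 0
  else 0

/-- All clusters are clean but for those of depth less than `m` that contain `v`. -/
def CleanAbove (v : Vertex k d) (m : ℕ) (q : Core k d) : Prop :=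
  ∀ B, B.length < d → ¬ (B <+: v.toList ∧ B.length < m) → Clean q B

/-- The cost of a single call of `trim`. -/
def trimCost (k d : ℕ) : ℕ := 55 * d ^ 2 * k ^ 2 * accessCost k d

variable {adj : Vertex k d → List (Vertex k d)} {v : Vertex k d} {V₀ : Finset (Vertex k d)}

/-- One call of `trim` at level `m` has exactly the effect on debts that `RemovalStep` prescribes.
-/
theorem debt_step {m c n : ℕ} (hm : m ≤ d) (σ : List (Fin k)) :
    (σ <+: v.toList.take m → σ ≠ v.toList.take m →
      debt ρ v m (c + 1) n σ = debt ρ v m c (n + 1) σ + ρ) ∧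
    (σ = v.toList.take m → debt ρ v m (c + 1) n σ + 1 = debt ρ v m c (n + 1) σ) ∧
    (¬ σ <+: v.toList.take m → debt ρ v m (c + 1) n σ = debt ρ v m c (n + 1) σ) := by
  have hlen : (v.toList.take m).length = m := by simp [hm]
  have htake := List.take_prefix m v.toList
  unfold debt
  refine ⟨fun h1 h2 => ?_, fun h1 => ?_, fun h1 => ?_⟩
  · have := length_lt_of_strict_prefix h1 h2
    rw [if_pos (h1.trans htake), if_pos (h1.trans htake), if_pos (by omega), if_pos (by omega)]
    ring
  · rw [h1, hlen]
    simp [htake]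
  · by_cases h : σ <+: v.toList
    · have : ¬ σ.length ≤ m := fun h' =>
        h1 (List.prefix_of_prefix_length_le h htake (by omega))
      rw [if_pos h, if_pos h, if_neg (by omega), if_neg (by omega), if_neg (by omega),
        if_neg (by omega)]
    · rw [if_neg h, if_neg h]

/-- The number `e` stands for payments that are not made in this loop because the cluster has too
few vertices. -/
theorem sim_trimRepeat (hG : IsSemiHypercube G) (hp : Params k d ρ τ)
    (hadj : IsAdjacencyList G adj) {m r : ℕ} (hm : m < d) (e : ℕ)
    (hr : (v.toList.take m).length + r = d) :
    ∀ (n : ℕ) (R : Finset (Vertex k d)) (q : Core k d),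
      Inv G ρ τ q (debt ρ v m R.card (n + e)) → CleanAbove v m q → R = V₀ \ q.V → q.V ⊆ V₀ →
      n ≤ q.vol (v.toList.take m) →
      ∃ R' q', Inv G ρ τ q' (debt ρ v m R'.card e) ∧ CleanAbove v m q' ∧ R' = V₀ \ q'.V ∧
        q'.V ⊆ q.V ∧ R'.card = R.card + n ∧
        q'.vol (v.toList.take m) + n = q.vol (v.toList.take m) ∧
        Sim (Agrees q) (trimRepeat adj r (v.toList.take m) hr n R) R' (Agrees q')
          (n * trimCost k d) := by
  have hA := one_le_accessCost (d := d) hp.k_pos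
  have hlen : (v.toList.take m).length = m := by simp [hm.le]
  have htake := List.take_prefix m v.toList
  intro n
  induction n with
  | zero =>
    intro R q h hc hR hV _
    rw [zero_add] at h
    exact ⟨R, q, h, hc, hR, Subset.rfl, rfl, rfl, (Sim.pure R).mono (Nat.zero_le _)⟩
  | succ n ih =>
    intro R q h hc hR hV hn
    have h' : Inv G ρ τ q (debt ρ v m R.card (n + e + 1)) := by
      rwa [show n + e + 1 = n + 1 + e by ring]
    obtain ⟨x, q₁, h1, h2, h3⟩ := sim_trim hG hp hadj (P := v.toList.take m)
      (D' := debt ρ v m (R.card + 1) (n + e))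
      (fun σ => (debt_step hm.le σ).1) (fun _ => (debt_step hm.le _).2.1 rfl)
      (fun σ => (debt_step hm.le σ).2.2) h' r (v.toList.take m) hr List.prefix_rfl
      (fun B h1 h2 hne => absurd (h2.eq_of_length_le h1.length_le) hne)
      (fun B hB hBd => hc B hBd fun hlt => by
        have := hB.length_le
        omega) (by omega)
    have hxR : x ∉ R := by
      rw [hR]
      simp [h2.mem]
    have hcard : (insert x R).card = R.card + 1 := card_insert_of_notMem hxR
    have hRx : insert x R = V₀ \ q₁.V := by
      rw [h2.V_eq, hR]
      ext y
      simp only [mem_insert, mem_sdiff, mem_erase]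
      by_cases hyx : y = x
      · simp [hyx, hV h2.mem]
      · simp [hyx]
    have hVle : q₁.V ⊆ q.V := by
      rw [h2.V_eq]
      exact erase_subset _ _
    have hc₁ : CleanAbove v m q₁ := by
      intro B hB hBv
      by_cases hPB : v.toList.take m <+: B
      · exact h2.clean B hPB hB
      · refine (hc B hB hBv).of_remove h2.V_eq (h2.target_eq B hPB) fun hBx => hBv ?_
        rcases List.prefix_or_prefix_of_prefix hBx h2.isPrefix with h6 | h6
        · refine ⟨h6.trans htake, ?_⟩
          have h7 := length_lt_of_strict_prefix h6 fun e => hPB (e ▸ List.prefix_rfl)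
          omega
        · exact absurd h6 hPB
    have hvol : q₁.vol (v.toList.take m) + 1 = q.vol (v.toList.take m) := by
      have := card_cluster_erase h2.mem (v.toList.take m)
      rw [if_pos h2.isPrefix] at this
      unfold Core.vol
      rw [h2.V_eq]
      exact this
    rw [← hcard] at h1
    obtain ⟨R', q', i1, i2, i3, i4, i5, i6, i7⟩ := ih (insert x R) q₁ h1 hc₁ hRx (hVle.trans hV)
      (by omega)
    refine ⟨R', q', i1, i2, i3, i4.trans hVle, by omega, by omega, ?_⟩
    refine ((sim_tick 1).bind (h3.bind (sim_access.bind i7))).mono ?_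
    have hrd : r ≤ d ^ 2 := by nlinarith
    have h8 : r * (39 * k ^ 2 * accessCost k d) ≤ d ^ 2 * (39 * k ^ 2 * accessCost k d) :=
      Nat.mul_le_mul_right _ hrd
    have h9 : 1 * accessCost k d ≤ (d ^ 2 * k ^ 2) * accessCost k d :=
      Nat.mul_le_mul_right _ (Nat.mul_pos (pow_pos hp.d_pos 2) (pow_pos hp.k_pos 2))
    unfold trimCost
    nlinarith

/-- On each level at most `ρ` vertices are trimmed per vertex removed so far, whence the factor `1 +
ρ`. The work is charged to the levels and to the vertices added to `R`. -/
theorem sim_climb (hG : IsSemiHypercube G) (hp : Params k d ρ τ)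
    (hadj : IsAdjacencyList G adj) :
    ∀ (m : ℕ) (hm : m ≤ d) (R : Finset (Vertex k d)) (q : Core k d),
      Inv G ρ τ q (debt ρ v m R.card 0) → CleanAbove v m q → R = V₀ \ q.V → q.V ⊆ V₀ →
      ∃ R' q', Inv G ρ τ q' (fun _ => 0) ∧ CleanAbove v 0 q' ∧ R' = V₀ \ q'.V ∧ q'.V ⊆ q.V ∧
        R.card ≤ R'.card ∧ R'.card ≤ (1 + ρ) ^ m * R.card ∧
        Sim (Agrees q) (climb adj ρ v m hm R) R' (Agrees q')
          (m * (42 * k ^ 2 * accessCost k d) + (R'.card - R.card) * trimCost k d) := by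
  have hA := one_le_accessCost (d := d) hp.k_pos
  intro m
  induction m with
  | zero =>
    intro hm R q h hc hR hV
    have h' : Inv G ρ τ q fun _ => 0 := h.of_debt fun σ _ _ => by
      unfold debt
      simp
    exact ⟨R, q, h', hc, hR, Subset.rfl, le_rfl, by simp, (Sim.pure R).mono (Nat.zero_le _)⟩
  | succ m ih =>
    intro hm R q h hc hR hV
    have hlen : (v.toList.take m).length = m := by
      simp
      omega
    have hPd : (v.toList.take m).length < d := by omega
    have htake := List.take_prefix m v.toList
    have hr : (v.toList.take m).length + (d - m) = d := by omega
    obtain ⟨q₁, h1, h2, h3⟩ := sim_retarget hG hp hPd h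
    have hc₁ : CleanAbove v m q₁ := fun B hB hBv => h2.clean_of fun hne => hc B hB fun hB' => by
      refine hBv ⟨hB'.1, lt_of_le_of_ne (by omega) fun e => hne ?_⟩
      rw [← e]
      exact List.prefix_iff_eq_take.1 hB'.1
    set n := min (ρ * R.card) (q₁.vol (v.toList.take m)) with hn
    -- The debt of the next level is split into the `n` payments that will be made and the rest.
    have hdebt : debt ρ v (m + 1) R.card 0 = debt ρ v m R.card (n + (ρ * R.card - n)) := by
      funext σ
      unfold debt
      rw [show n + (ρ * R.card - n) = ρ * R.card by omega]
      split_ifs <;> first | rfl | omega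
    rw [hdebt] at h1
    have hR₁ : R = V₀ \ q₁.V := by rw [h2.V_eq]; exact hR
    have hV₁ : q₁.V ⊆ V₀ := by rw [h2.V_eq]; exact hV
    obtain ⟨R₂, q₂, i1, i2, i3, i4, i5, i6, i7⟩ := sim_trimRepeat hG hp hadj (by omega) _ hr n R q₁
      h1 hc₁ hR₁ hV₁ (min_le_right _ _)
    -- A nonzero rest means that the cluster has been emptied, and its debt can be dropped.
    have h4 : Inv G ρ τ q₂ (debt ρ v m R₂.card 0) := i1.of_debt fun σ _ hvσ => by
      unfold debt
      by_cases h5 : ρ * R.card - n = 0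
      · rw [h5]
      · have h6 : q₂.vol (v.toList.take m) = 0 := by omega
        have h7 : σ <+: v.toList → σ.length ≠ m := fun h7 h8 => by
          rw [List.prefix_iff_eq_take.1 h7, h8, h6] at hvσ
          exact lt_irrefl _ hvσ
        split_ifs with a b c
        · rfl
        · exact absurd c (h7 a)
        · rfl
        · rfl
    obtain ⟨R', q', j1, j2, j3, j4, j5, j6, j7⟩ := ih (by omega) R₂ q₂ h4 i2 i3 (i4.trans hV₁)
    have hq₁ : q₁.V ⊆ q.V := by rw [h2.V_eq]
    refine ⟨R', q', j1, j2, j3, j4.trans (i4.trans hq₁), by omega, ?_, ?_⟩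
    · refine j6.trans ?_
      rw [pow_succ, mul_assoc]
      apply Nat.mul_le_mul_left
      rw [i5, add_mul, one_mul]
      exact Nat.add_le_add_left (min_le_left _ _) _
    · refine ((sim_tick 1).bind (sim_access.bind (h3.bind ((sim_getSize hPd.le).bind
        ((sim_tick 2).bind (i7.bind j7)))))).mono ?_
      have h8 : 1 * accessCost k d ≤ k ^ 2 * accessCost k d :=
        Nat.mul_le_mul_right _ (Nat.one_le_pow _ _ hp.k_pos)
      have h9 : (R'.card - R.card) * trimCost k d =
          n * trimCost k d + (R'.card - R₂.card) * trimCost k d := by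
        rw [← add_mul]
        congr 1
        omega
      rw [h9]
      linarith

theorem sim_delete (hG : IsSemiHypercube G) (hp : Params k d ρ τ)
    (hadj : IsAdjacencyList G adj) (h : Inv G ρ τ q fun _ => 0)
    (hc : ∀ B : List (Fin k), B.length < d → Clean q B) (hv : v ∈ q.V) :
    ∃ P q', Inv G ρ τ q' (fun _ => 0) ∧ (∀ B : List (Fin k), B.length < d → Clean q' B) ∧
      P ⊆ q.V \ {v} ∧ q'.V = q.V \ (P ∪ {v}) ∧ P.card ≤ (1 + ρ) ^ d ∧
      Sim (Agrees q) (delete adj ρ v) P (Agrees q')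
        (113 * d ^ 2 * k ^ 2 * accessCost k d * (1 + ρ) ^ d) := by
  -- The deleted vertex is arbitrary, so it pays nowhere and only creates debts: here `P` is the
  -- full string of `v`.
  have hs : RemovalStep ρ q (fun _ => 0) (debt ρ v d 1 0) v.toList v := by
    refine ⟨hv, List.prefix_rfl, fun B h1 h2 hB => ?_, fun σ h1 h2 => ?_, fun hlt => ?_,
      fun σ h1 => ?_⟩
    · have := h1.length_le
      simp at this
      omega
    · have := length_lt_of_strict_prefix h1 h2
      rw [List.Vector.toList_length] at this
      unfold debt
      rw [if_pos h1, if_pos this]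
      ring
    · simp at hlt
    · unfold debt
      rw [if_neg h1]
  have h1 := h.remove hG hs
  have hc₁ : CleanAbove v d (q.remove G v) := fun B hB hBv =>
    (hc B hB).of_remove rfl rfl fun hBx => hBv ⟨hBx, hB⟩
  have hR : ({v} : Finset (Vertex k d)) = q.V \ (q.remove G v).V := by
    rw [remove_V, sdiff_erase_self hv]
  obtain ⟨R', q', i1, i2, i3, i4, -, i6, i7⟩ := sim_climb hG hp hadj d le_rfl {v} (q.remove G v)
    (by rw [card_singleton]; exact h1) hc₁ hR (erase_subset _ _)
  rw [card_singleton, mul_one] at i6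
  rw [card_singleton] at i7
  have hvq' : v ∉ q'.V := fun h => by simpa [remove_V] using i4 h
  have hsub : q'.V ⊆ q.V := i4.trans (erase_subset _ _)
  have hvR : v ∈ R' := by
    rw [i3]
    exact mem_sdiff.2 ⟨hv, hvq'⟩
  refine ⟨R'.erase v, q', i1, fun B hB => i2 B hB (by simp), ?_, ?_,
    (card_le_card (erase_subset _ _)).trans i6, ?_⟩
  · rw [i3]
    intro y hy
    simp only [mem_erase, mem_sdiff, mem_singleton] at hy ⊢
    exact ⟨hy.2.1, hy.1⟩
  · ext y
    rw [i3]
    simp only [mem_erase, mem_sdiff, mem_union, mem_singleton]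
    constructor
    · intro hy
      refine ⟨hsub hy, ?_⟩
      rintro (h' | rfl)
      · exact h'.2.2 hy
      · exact hvq' hy
    · rintro ⟨h1, h2⟩
      by_contra hy
      exact h2 (by tauto)
  · have hret : Sim (Agrees q') (access >>= fun _ => pure (R'.erase v)) (R'.erase v) (Agrees q')
        (accessCost k d + 0) := sim_access.bind (Sim.pure _)
    refine ((sim_processRemoval hG hp.k_pos hp.d_pos hadj hv).bind (sim_access.bind
      (i7.bind hret))).mono ?_
    have hpow : 1 ≤ (1 + ρ) ^ d := Nat.one_le_pow _ _ (by omega)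
    have hX : 1 * accessCost k d ≤ (d ^ 2 * k ^ 2) * accessCost k d :=
      Nat.mul_le_mul_right _ (Nat.mul_pos (pow_pos hp.d_pos 2) (pow_pos hp.k_pos 2))
    have hY : d * (42 * k ^ 2 * accessCost k d) ≤ d ^ 2 * (42 * k ^ 2 * accessCost k d) :=
      Nat.mul_le_mul_right _ (by have := hp.d_pos; nlinarith)
    have hZ : (R'.card - 1) * trimCost k d ≤ (1 + ρ) ^ d * trimCost k d :=
      Nat.mul_le_mul_right _ (by omega)
    unfold trimCost at hZ ⊢
    set X := d ^ 2 * k ^ 2 * accessCost k d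
    have hXp : X * 1 ≤ X * (1 + ρ) ^ d := Nat.mul_le_mul_left _ hpow
    have e1 : 113 * d ^ 2 * k ^ 2 * accessCost k d * (1 + ρ) ^ d = 113 * (X * (1 + ρ) ^ d) := by
      simp only [X]
      ring
    have e2 : (1 + ρ) ^ d * (55 * d ^ 2 * k ^ 2 * accessCost k d) = 55 * (X * (1 + ρ) ^ d) := by
      simp only [X]
      ring
    have e3 : d ^ 2 * (42 * k ^ 2 * accessCost k d) = 42 * X := by
      simp only [X]
      ring
    have e4 : 14 * d ^ 2 * k ^ 2 * accessCost k d = 14 * X := by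
      simp only [X]
      ring
    rw [e1, e4]
    rw [e2] at hZ
    rw [e3] at hY
    omega

end SemiHypercube

/-! ### Reachable states and the numerical bounds. -/

namespace SemiHypercube

open Finset

variable {k d : ℕ} {G : SimpleGraph (Vertex k d)} {ρ : ℕ} {τ : ℝ}
  {adj : Vertex k d → List (Vertex k d)}

theorem agrees_initState (k d : ℕ) (hk : 0 < k) :
    Agrees (initCore k d hk) (initState k d hk) where
  V_eq := rfl
  target_eq := rfl
  nontarget_eq := rfl
  minfo_eq := rfl
  size_eq _ hσ := (card_cluster_univ hσ).symm
  shadow_eq _ _ _ _ _ _ := rfl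

theorem clean_initCore (hk : 0 < k) {B : List (Fin k)} (hB : B.length < d) :
    Clean (initCore k d hk) B := fun _ => by
  change 0 < (cluster (univ : Finset (Vertex k d)) (B ++ [⟨0, hk⟩])).card
  rw [card_cluster_univ (by simpa using hB)]
  exact pow_pos hk _

theorem Reachable.exists_core (hG : IsSemiHypercube G) (hp : Params k d ρ τ)
    (hadj : IsAdjacencyList G adj) (hk : 0 < k) {s : State k d}
    (h : Reachable adj ρ (initState k d hk) s) :
    ∃ q, Agrees q s ∧ Inv G ρ τ q (fun _ => 0) ∧ ∀ B : List (Fin k), B.length < d → Clean q B := by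
  induction h with
  | init => exact ⟨_, agrees_initState k d hk, inv_initCore hG hp hk, fun _ => clean_initCore hk⟩
  | step _ hv ih =>
    obtain ⟨q, h1, h2, h3⟩ := ih
    obtain ⟨P, q', i1, i2, -, -, -, i6⟩ := sim_delete hG hp hadj h2 h3 (h1.V_eq ▸ hv)
    exact ⟨q', (i6 _ h1).2.1, i1, i2⟩

theorem one_le_log {k : ℕ} (hk : 3 ≤ k) : 1 ≤ Real.log k := by
  rw [Real.le_log_iff_exp_le (by positivity)]
  have h1 := Real.exp_one_lt_d9
  have h2 : (3 : ℝ) ≤ k := by exact_mod_cast hk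
  linarith

theorem params_rho (hd : 0 < d) (hkd : 16 * d ≤ k) (hτ : 0 < τ) (hτd : τ ≤ 1 / (4350 * (d : ℝ))) :
    Params k d (rho k d τ) τ := by
  have hd0 : (0 : ℝ) < d := by exact_mod_cast hd
  refine ⟨hd, hkd, hτ, ?_, ?_⟩
  · rwa [le_div_iff₀ (by positivity)] at hτd
  · have h := Nat.le_ceil (2 * ((harmonic k : ℚ) : ℝ) * ((2 * d + 1 : ℕ) : ℝ) / τ)
    rw [div_le_iff₀ hτ] at h
    rw [Nat.cast_add, Nat.cast_mul, Nat.cast_two, Nat.cast_one] at h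
    rw [rho, Nat.cast_add, Nat.cast_mul, Nat.cast_two, Nat.cast_one]
    exact h

theorem one_add_rho_le (hd : 0 < d) (hkd : 16 * d ≤ k) (hτ : 0 < τ)
    (hτd : τ ≤ 1 / (4350 * (d : ℝ))) :
    14 ≤ Real.log ((k : ℝ) ^ d) / τ ∧
      1 + (rho k d τ : ℝ) ≤ 14 * (Real.log ((k : ℝ) ^ d) / τ) := by
  have hd1 : (1 : ℝ) ≤ d := by exact_mod_cast hd
  have hd0 : (0 : ℝ) < d := by linarith
  have hlog := one_le_log (k := k) (by omega)
  have hh := harmonic_le_one_add_log k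
  rw [le_div_iff₀ (by positivity)] at hτd
  have hX : 14 ≤ Real.log ((k : ℝ) ^ d) / τ := by
    rw [Real.log_pow, le_div_iff₀ hτ]
    nlinarith
  refine ⟨hX, ?_⟩
  -- Uses `H_k ≤ 1 + log k ≤ 2 log k` and `2d+1 ≤ 3d`. Rounding up and the summand 1 raise the
  -- constant from 12 to 14.
  have hnum : 2 * ((harmonic k : ℚ) : ℝ) * ((2 * d + 1 : ℕ) : ℝ) ≤
      12 * Real.log ((k : ℝ) ^ d) := by
    rw [Real.log_pow]
    push_cast
    calc 2 * ((harmonic k : ℚ) : ℝ) * (2 * d + 1) ≤ 2 * (2 * Real.log k) * (3 * d) := by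
          apply mul_le_mul (by linarith) (by linarith) (by positivity) (by positivity)
      _ = _ := by ring
  have hpos : 0 ≤ 2 * ((harmonic k : ℚ) : ℝ) * ((2 * d + 1 : ℕ) : ℝ) / τ := by
    have : (0 : ℚ) ≤ harmonic k := by
      unfold harmonic
      positivity
    have : (0 : ℝ) ≤ ((harmonic k : ℚ) : ℝ) := by exact_mod_cast this
    positivity
  have h1 := Nat.ceil_lt_add_one hpos
  have h2 : 2 * ((harmonic k : ℚ) : ℝ) * ((2 * d + 1 : ℕ) : ℝ) / τ ≤
      12 * (Real.log ((k : ℝ) ^ d) / τ) := by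
    rw [mul_div_assoc']
    exact div_le_div_of_nonneg_right hnum hτ.le
  unfold rho
  linarith

theorem work_bound {X : ℝ} (hd : 0 < d) (hkd : 16 * d ≤ k) (hX : 14 ≤ X)
    (hρ : 1 + (ρ : ℝ) ≤ 14 * X) :
    ((113 * d ^ 2 * k ^ 2 * accessCost k d * (1 + ρ) ^ d : ℕ) : ℝ) ≤
      339 * ((k : ℝ) * X ^ d) ^ 6 := by
  have hsize : Nat.size k ≤ k := Nat.size_le.2 Nat.lt_two_pow_self
  have hacc : accessCost k d ≤ 3 * k ^ 2 := by
    unfold accessCost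
    calc (2 * d + 1) * Nat.size k ≤ (3 * k) * k := Nat.mul_le_mul (by omega) hsize
      _ = 3 * k ^ 2 := by ring
  have h1 : 113 * d ^ 2 * k ^ 2 * accessCost k d ≤ 339 * k ^ 6 := by
    calc 113 * d ^ 2 * k ^ 2 * accessCost k d ≤ 113 * k ^ 2 * k ^ 2 * (3 * k ^ 2) := by
          gcongr
          omega
      _ = 339 * k ^ 6 := by ring
  have h1' : ((113 * d ^ 2 * k ^ 2 * accessCost k d : ℕ) : ℝ) ≤ 339 * (k : ℝ) ^ 6 := by
    exact_mod_cast h1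
  -- As `14 ≤ X`, the constant in the bound for `1 + ρ` is absorbed by one more factor `X`; the
  -- exponent 6 is dictated by the power of `k`.
  have h2 : ((1 + ρ : ℕ) : ℝ) ^ d ≤ (X ^ d) ^ 6 := by
    rw [← pow_mul, mul_comm d 6, pow_mul]
    apply pow_le_pow_left₀ (by positivity)
    push_cast
    calc 1 + (ρ : ℝ) ≤ 14 * X := hρ
      _ ≤ X * X := by nlinarith
      _ = X ^ 2 := by ring
      _ ≤ X ^ 6 := pow_le_pow_right₀ (by linarith) (by norm_num)
  rw [Nat.cast_mul, Nat.cast_pow]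
  calc _ ≤ 339 * (k : ℝ) ^ 6 * (X ^ d) ^ 6 :=
        mul_le_mul h1' h2 (by positivity) (by positivity)
    _ = _ := by ring

end SemiHypercube

theorem mainTheorem1 :
    ∃ (C : ℝ) (c : ℕ), 0 < C ∧
      ∀ (k d : ℕ) (hk : 0 < k), 0 < d → 16 * d ≤ k →
      ∀ τ : ℝ, 0 < τ → τ ≤ 1 / (4350 * (d : ℝ)) →
      ∀ G : SimpleGraph (SemiHypercube.Vertex k d), SemiHypercube.IsSemiHypercube G →
      ∀ adj : SemiHypercube.Vertex k d → List (SemiHypercube.Vertex k d),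
        SemiHypercube.IsAdjacencyList G adj →
        (SemiHypercube.initState k d hk).V = Finset.univ ∧
        ∀ s : SemiHypercube.State k d,
          SemiHypercube.Reachable adj (SemiHypercube.rho k d τ)
            (SemiHypercube.initState k d hk) s →
          SemiHypercube.IsTauSemiHypercube τ G s.V ∧
          ∀ v ∈ s.V, ∀ (P : Finset (SemiHypercube.Vertex k d)) (s' : SemiHypercube.State k d),
            (SemiHypercube.delete adj (SemiHypercube.rho k d τ) v).run s = (P, s') →
            P ⊆ s.V \ {v} ∧
            s'.V = s.V \ (P ∪ {v}) ∧
            (P.card : ℝ) ≤ (C * (Real.log ((k : ℝ) ^ d) / τ)) ^ d ∧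
            (s'.work : ℝ) ≤ (s.work : ℝ) +
              C * ((k : ℝ) * (Real.log ((k : ℝ) ^ d) / τ) ^ d) ^ c := by
  -- The work bound of `work_bound` determines both constants: 339 is 3 times the 113 of
  -- `sim_delete`. For the size of the pruned set, 14 would do.
  refine ⟨339, 6, by norm_num, fun k d hk hd hkd τ hτ hτd G hG adj hadj => ⟨rfl, fun s hs => ?_⟩⟩
  have hp := SemiHypercube.params_rho hd hkd hτ hτd
  obtain ⟨hX, hρ⟩ := SemiHypercube.one_add_rho_le hd hkd hτ hτd
  obtain ⟨q, hq, hinv, hclean⟩ := hs.exists_core hG hp hadj hk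
  refine ⟨hq.V_eq ▸ hinv.isTauSemiHypercube hG hp, fun v hv P s' hrun => ?_⟩
  obtain ⟨P', q', -, -, h3, h4, h5, h6⟩ :=
    SemiHypercube.sim_delete hG hp hadj hinv hclean (hq.V_eq ▸ hv)
  obtain ⟨e1, e2, e3⟩ := h6 s hq
  rw [hrun] at e1 e2 e3
  dsimp only at e1 e2 e3
  subst e1
  refine ⟨hq.V_eq ▸ h3, by rw [e2.V_eq, h4, hq.V_eq], ?_, ?_⟩
  · have h7 : (P.card : ℝ) ≤ (1 + (SemiHypercube.rho k d τ : ℝ)) ^ d := by exact_mod_cast h5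
    refine h7.trans (pow_le_pow_left₀ (by positivity) (hρ.trans ?_) d)
    linarith
  · refine (Nat.cast_le (α := ℝ).2 e3).trans ?_
    rw [Nat.cast_add]
    exact add_le_add_right (SemiHypercube.work_bound hd hkd hX hρ) _
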